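/- Work over $\mathbb R$ with cohomological grading; operads are symmetric, labelled by finite sets and described by partial compositions $\circ_i$. *The operad $\mathsf{Gra}$.* For a finite set $V$ let $\mathsf{Gra}(V)$ be the vector space spanned by undirected graphs without tadpoles with vertex set $V$, together with an ordering of the edges, modulo the relation that permuting the edges by $\sigma$ gives the factor $\mathrm{sgn}(\sigma)$ (so edges are odd, of degree $-1$, and graphs with a multiple edge vanish). The composition $\Gamma\circ_i\Gamma'$ inserts $\Gamma'$ at the vertex $i$ of $\Gamma$ and sums over all ways of reconnecting the edges incident to $i$ to vertices of $\Gamma'$, the edges of $\Gamma$ coming first in the ordering. *The operad $\mathsf{fGraphs}=\mathit{Tw}\,\mathsf{Gra}$.* For a finite set $E$ and $p\in\mathbb Z$ the degree $p$ part of $\mathsf{fGraphs}(E)$ consists of the families $x=(x_k)_{k\ge 0}$, where $x_k$ is a linear combination of graphs in $\mathsf{Gra}(E\sqcup\{1,\dots,k\})$ with $2k-p$ edges which is invariant under the permutations of $\{1,\dots,k\}$. The elements of $E$ are called external vertices, and the elements of $\{1,\dots,k\}$, which have degree $+2$, internal vertices. The composition $x\circ_i y$ is the composition of $\mathsf{Gra}$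 at the external vertex $i$, summed over all ways of distributing the labels of the internal vertices. Let $\mu$ be the graph with two vertices joined by one edge. The differential has degree $+1$ and is given on elements of degree $p$ by $$\delta x=\mu\circ x-(-1)^{p}\Big(\sum_{a\in E}x\circ_a\mu+\tfrac12\sum_{j\text{ internal}}x\circ_j\mu\Big),$$ where in the first term $x$ is inserted at one vertex of $\mu$ and the other vertex of $\mu$ becomes internal, in the second term one vertex of $\mu$ takes the place of $a$ and the other becomes internal, in the third term both vertices of $\mu$ are internal, and everything is summed over the ways of labelling the internal vertices. With these operations, relabelling of the external vertices, and the graph with a single external vertex as unit, $\mathsf{fGraphs}$ is a differential graded operad. *Statement.* Let $\mathsf{Graphs}(E)\subset\mathsf{fGraphs}(E)$ be the graded subspace of those (possibly infinite) linear combinations, i.e. of those families $(x_k)_k$ for which every $x_k$ is a linear combination, of graphs such that 1. all internal vertices are at least trivalent, and 2. there is no connected component containing only internal vertices. Then $\mathsf{Graphs}$ is a differential graded suboperad of $\mathsf{fGraphs}$: it contains the unit and is closed under relabelling of the external vertices (the symmetric group actions), under the operadic compositions and under the differential. -/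

import Mathlib

noncomputable section

/-! ## Differential graded operads

Operads are labelled by finite sets: an operation of arity `n` is an operation whose inputs are
labelled by an arbitrary finite set `E` with `n` elements, relabelling along bijections replaces the
action of the symmetric groups, and `x ∘ᵢ y` has its inputs labelled by `(E ∖ {i}) ⊔ F`. -/

namespace DGOperad

variable {E F G : Type}

/-- The canonical bijection between the labels of `(x ∘ᵢ y) ∘ⱼ z` and of `x ∘ᵢ (y ∘ⱼ z)`. -/
def seqEquiv (i : E) (j : F) :
    {u : {a : E // a ≠ i} ⊕ F // u ≠ Sum.inr j} ⊕ G ≃ {a : E // a ≠ i} ⊕ ({b : F // b ≠ j} ⊕ G) where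
  toFun
    | Sum.inl ⟨Sum.inl a, _⟩ => Sum.inl a
    | Sum.inl ⟨Sum.inr b, h⟩ => Sum.inr (Sum.inl ⟨b, fun e => h (congrArg Sum.inr e)⟩)
    | Sum.inr c => Sum.inr (Sum.inr c)
  invFun
    | Sum.inl a => Sum.inl ⟨Sum.inl a, Sum.inl_ne_inr⟩
    | Sum.inr (Sum.inl b) => Sum.inl ⟨Sum.inr b.1, fun e => b.2 (Sum.inr_injective e)⟩
    | Sum.inr (Sum.inr c) => Sum.inr c
  left_inv := by rintro (⟨a | b, h⟩ | c) <;> rfl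
  right_inv := by rintro (a | b | c) <;> rfl

def parFun {i j : E} (hij : i ≠ j) :
    {u : {a : E // a ≠ i} ⊕ F // u ≠ Sum.inl ⟨j, hij.symm⟩} ⊕ G →
      {u : {a : E // a ≠ j} ⊕ G // u ≠ Sum.inl ⟨i, hij⟩} ⊕ F
  | Sum.inl ⟨Sum.inl a, h⟩ => Sum.inl ⟨Sum.inl ⟨a.1, fun e => h (congrArg Sum.inl (Subtype.ext e))⟩,
      fun e => a.2 (congrArg Subtype.val (Sum.inl_injective e))⟩
  | Sum.inl ⟨Sum.inr b, _⟩ => Sum.inr b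
  | Sum.inr c => Sum.inl ⟨Sum.inr c, Sum.inr_ne_inl⟩

/-- The canonical bijection between the labels of `(x ∘ᵢ y) ∘ⱼ z` and of `(x ∘ⱼ z) ∘ᵢ y`. -/
def parEquiv {i j : E} (hij : i ≠ j) :
    {u : {a : E // a ≠ i} ⊕ F // u ≠ Sum.inl ⟨j, hij.symm⟩} ⊕ G ≃
      {u : {a : E // a ≠ j} ⊕ G // u ≠ Sum.inl ⟨i, hij⟩} ⊕ F where
  toFun := parFun hij
  invFun := parFun hij.symm
  left_inv := by rintro (⟨a | b, h⟩ | c) <;> rfl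
  right_inv := by rintro (⟨a | b, h⟩ | c) <;> rfl

open Classical in
/-- The canonical bijection between the labels of `x ∘ᵢ id` and of `x`. -/
def unitEquiv (i : E) : {a : E // a ≠ i} ⊕ Unit ≃ E :=
  (Equiv.optionEquivSumPUnit _).symm.trans (Equiv.optionSubtypeNe i)

/-- The canonical bijection between the labels of `id ∘ y` and of `y`. -/
def unitEquivLeft : {a : Unit // a ≠ ()} ⊕ F ≃ F where
  toFun
    | Sum.inl a => absurd rfl a.2
    | Sum.inr b => b
  invFun := Sum.inr
  left_inv := by rintro (a | b); exacts [absurd rfl a.2, rfl]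
  right_inv := fun _ => rfl

end DGOperad

open DGOperad in
/-- A differential graded symmetric operad over `ℝ` (cohomological grading), given by partial
compositions. `obj E p` is the degree `p` part of the space of operations with inputs `E`.
The equations between integers (`p + q = r` and so on) only serve to name the degrees. -/
structure DGOperad where
  obj : (E : Type) → [Finite E] → ℤ → Type
  [addCommGroup : ∀ (E : Type) [Finite E] (p : ℤ), AddCommGroup (obj E p)]
  [module : ∀ (E : Type) [Finite E] (p : ℤ), Module ℝ (obj E p)]
  /-- relabelling of the inputs -/
  map : ∀ {E F : Type} [Finite E] [Finite F] (_ : E ≃ F) (p : ℤ), obj E p →ₗ[ℝ] obj F p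
  /-- the operadic unit -/
  unit : obj Unit 0
  /-- the partial composition `x ∘ᵢ y` -/
  comp : ∀ {E F : Type} [Finite E] [Finite F] {p q r : ℤ} (_ : p + q = r) (i : E),
    obj E p →ₗ[ℝ] obj F q →ₗ[ℝ] obj ({a : E // a ≠ i} ⊕ F) r
  /-- the differential -/
  d : ∀ {E : Type} [Finite E] {p q : ℤ} (_ : p + 1 = q), obj E p →ₗ[ℝ] obj E q
  map_refl : ∀ {E : Type} [Finite E] {p : ℤ} (x : obj E p), map (Equiv.refl E) p x = x
  map_trans : ∀ {E F G : Type} [Finite E] [Finite F] [Finite G] {p : ℤ} (e : E ≃ F) (e' : F ≃ G)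
    (x : obj E p), map e' p (map e p x) = map (e.trans e') p x
  comp_map : ∀ {E F E' F' : Type} [Finite E] [Finite F] [Finite E'] [Finite F'] {p q r : ℤ}
    (h : p + q = r) (σ : E ≃ E') (τ : F ≃ F') (i : E) (x : obj E p) (y : obj F q),
    comp h (σ i) (map σ p x) (map τ q y) =
      map (Equiv.sumCongr (σ.subtypeEquiv (p := (· ≠ i)) (q := (· ≠ σ i)) (fun a => by simp)) τ) r
        (comp h i x y)
  comp_unit : ∀ {E : Type} [Finite E] {p : ℤ} (i : E) (x : obj E p),
    map (unitEquiv i) p (comp (add_zero p) i x unit) = x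
  unit_comp : ∀ {F : Type} [Finite F] {q : ℤ} (y : obj F q),
    map unitEquivLeft q (comp (zero_add q) () unit y) = y
  /-- sequential associativity -/
  comp_seq : ∀ {E F G : Type} [Finite E] [Finite F] [Finite G] {p q r pq qr n : ℤ}
    (h₁ : p + q = pq) (h₂ : pq + r = n) (h₃ : q + r = qr) (h₄ : p + qr = n) (i : E) (j : F)
    (x : obj E p) (y : obj F q) (z : obj G r),
    map (seqEquiv i j) n (comp h₂ (Sum.inr j) (comp h₁ i x y) z) = comp h₄ i x (comp h₃ j y z)
  /-- parallel associativity -/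
  comp_par : ∀ {E F G : Type} [Finite E] [Finite F] [Finite G] {p q r pq pr n : ℤ}
    (h₁ : p + q = pq) (h₂ : pq + r = n) (h₃ : p + r = pr) (h₄ : pr + q = n) (i j : E) (hij : i ≠ j)
    (x : obj E p) (y : obj F q) (z : obj G r),
    map (parEquiv hij) n (comp h₂ (Sum.inl ⟨j, hij.symm⟩) (comp h₁ i x y) z) =
      (-1 : ℝ) ^ (q * r) • comp h₄ (Sum.inl ⟨i, hij⟩) (comp h₃ j x z) y
  d_d : ∀ {E : Type} [Finite E] {p q r : ℤ} (h : p + 1 = q) (h' : q + 1 = r) (x : obj E p),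
    d h' (d h x) = 0
  d_map : ∀ {E F : Type} [Finite E] [Finite F] {p q : ℤ} (h : p + 1 = q) (e : E ≃ F)
    (x : obj E p), d h (map e p x) = map e q (d h x)
  /-- the differential is a derivation -/
  d_comp : ∀ {E F : Type} [Finite E] [Finite F] {p q r p' q' r' : ℤ} (h : p + q = r)
    (hp : p + 1 = p') (hq : q + 1 = q') (hr : r + 1 = r') (h₁ : p' + q = r') (h₂ : p + q' = r')
    (i : E) (x : obj E p) (y : obj F q),
    d hr (comp h i x y) = comp h₁ i (d hp x) y + (-1 : ℝ) ^ p • comp h₂ i x (d hq y)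

attribute [instance] DGOperad.addCommGroup DGOperad.module

/-- A family of graded subspaces of a dg operad is a (dg) suboperad if it contains the unit and is
closed under relabelling (the symmetric group actions), the compositions and the differential. -/
structure DGOperad.IsSuboperad (P : DGOperad)
    (S : ∀ (E : Type) [Finite E] (p : ℤ), Submodule ℝ (P.obj E p)) : Prop where
  unit_mem : P.unit ∈ S Unit 0
  map_mem : ∀ {E F : Type} [Finite E] [Finite F] (e : E ≃ F) {p : ℤ} {x : P.obj E p},
    x ∈ S E p → P.map e p x ∈ S F p
  comp_mem : ∀ {E F : Type} [Finite E] [Finite F] {p q r : ℤ} (h : p + q = r) (i : E)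
    {x : P.obj E p} {y : P.obj F q}, x ∈ S E p → y ∈ S F q → P.comp h i x y ∈ S _ r
  d_mem : ∀ {E : Type} [Finite E] {p q : ℤ} (h : p + 1 = q) {x : P.obj E p},
    x ∈ S E p → P.d h x ∈ S E q

/-! ## The operad of graphs -/

/-- The vector space with basis the unordered pairs of distinct elements of `V`: the possible edges
of a graph with vertex set `V`. -/
abbrev Gra.EdgeSpace (V : Type) : Type := {e : Sym2 V // ¬ e.IsDiag} →₀ ℝ

/-- `Gra V`: linear combinations of undirected graphs without tadpoles with vertex set `V`, equipped
with an ordering of the edges, modulo the relation that permuting the edges produces the sign of the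
permutation (edges are odd, of degree `-1`). This is the exterior algebra on the space of possible
edges: a graph is the product of its edges. Graphs with a multiple edge vanish by symmetry. -/
abbrev Gra (V : Type) : Type := ExteriorAlgebra ℝ (Gra.EdgeSpace V)

namespace Gra

variable {V W U : Type}

open Classical in
/-- The basis vector of an unordered pair, set to be zero for tadpoles. -/
def edgeVec (e : Sym2 V) : EdgeSpace V :=
  if h : e.IsDiag then 0 else Finsupp.single ⟨e, h⟩ 1

/-- The graph with a single edge. -/
def edge (e : Sym2 V) : Gra V := ExteriorAlgebra.ι ℝ (edgeVec e)

/-- The graph with the given ordered list of edges. -/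
def monomial (l : List (Sym2 V)) : Gra V := (l.map edge).prod

/-- The linear combinations of graphs with `m` edges. -/
def homog (V : Type) (m : ℤ) : Submodule ℝ (Gra V) :=
  Submodule.span ℝ {x | ∃ l : List (Sym2 V), (l.length : ℤ) = m ∧ x = monomial l}

/-- If every vertex `v` is replaced by a set `T v` of vertices, an edge is replaced by the sum of all
ways of reconnecting its ends to the new vertices. -/
def substEdge (T : V → Finset W) (e : Sym2 V) : EdgeSpace W :=
  Sym2.lift ⟨fun a b => ∑ a' ∈ T a, ∑ b' ∈ T b, edgeVec s(a', b'), fun a b => by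
    dsimp only
    rw [Finset.sum_comm]
    exact Finset.sum_congr rfl fun _ _ => Finset.sum_congr rfl fun _ _ => by rw [Sym2.eq_swap]⟩ e

/-- Replace every vertex `v` of a graph by the set `T v`, summing over all ways of reconnecting the
edges incident to `v` to the elements of `T v`. -/
def subst (T : V → Finset W) : Gra V →ₐ[ℝ] Gra W :=
  ExteriorAlgebra.map (Finsupp.linearCombination ℝ
    fun e : {e : Sym2 V // ¬ e.IsDiag} => substEdge T e.1)

/-- Relabelling of the vertices along an (injective) map. -/
def relabel (f : V → W) : Gra V →ₐ[ℝ] Gra W := subst fun v => {f v}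

open Classical in
/-- The vertex `i` is replaced by all of `W`, the other vertices are kept. -/
def insertion (W : Type) [Finite W] (i v : V) : Finset ({v : V // v ≠ i} ⊕ W) :=
  if h : v = i then (Set.range Sum.inr).toFinite.toFinset else {Sum.inl ⟨v, h⟩}

/-- The operadic composition `Γ ∘ᵢ Γ'` in `Gra`: insert the graph `Γ'` at the vertex `i` of `Γ` and
sum over all ways of reconnecting the edges incident to `i` to vertices of `Γ'`. The edges of `Γ`
come first in the ordering. -/
def comp [Finite W] (i : V) (Γ : Gra V) (Γ' : Gra W) : Gra ({v : V // v ≠ i} ⊕ W) :=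
  subst (insertion W i) Γ * relabel Sum.inr Γ'

end Gra

/-! ## The twisted operad `fGraphs = Tw Gra` -/

/-- Families of elements of `Gra` with external vertices `E` and `k` internal vertices, for all `k`
(infinite linear combinations are allowed). -/
abbrev TwSpace (E : Type) : Type := (k : ℕ) → Gra (E ⊕ Fin k)

namespace TwGra

open Gra

variable {E F : Type}

/-- The degree `p` part of `Tw Gra`: families whose component with `k` internal vertices is invariant
under permutations of the internal vertices (they are even, of degree `2`), and is a combination of
graphs with `2 * k - p` edges. -/
def deg (E : Type) (p : ℤ) : Submodule ℝ (TwSpace E) where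
  carrier := {x | ∀ k : ℕ, x k ∈ homog (E ⊕ Fin k) (2 * k - p) ∧
    ∀ σ : Equiv.Perm (Fin k), relabel (Sum.map id σ) (x k) = x k}
  zero_mem' := fun k => ⟨zero_mem _, fun σ => map_zero _⟩
  add_mem' := fun hx hy k => ⟨add_mem (hx k).1 (hy k).1, fun σ => by
    simp [(hx k).2 σ, (hy k).2 σ]⟩
  smul_mem' := fun c x hx k => ⟨Submodule.smul_mem _ c (hx k).1, fun σ => by
    simp [(hx k).2 σ]⟩

/-- For an invariant element `x`, its component with internal vertices labelled by a set `S`. -/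
def on (x : TwSpace E) {N : ℕ} (S : Finset (Fin N)) : Gra (E ⊕ S) :=
  relabel (Sum.map id (S.orderIsoOfFin rfl)) (x S.card)

/-- Relabelling of the external vertices. -/
def map (e : E ≃ F) (x : TwSpace E) : TwSpace F := fun k => relabel (Sum.map e id) (x k)

/-- The operadic unit: the graph with one external and no internal vertex. -/
def unit : TwSpace Unit := fun k => if k = 0 then 1 else 0

/-- The vertices of `x ∘ᵢ y`, if `x` has internal vertices `S` and `y` the complement of `S`. -/
def compLabel (i : E) {N : ℕ} (S : Finset (Fin N)) :
    {v : E ⊕ S // v ≠ Sum.inl i} ⊕ (F ⊕ ↥Sᶜ) → ({a : E // a ≠ i} ⊕ F) ⊕ Fin N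
  | Sum.inl ⟨Sum.inl a, h⟩ => Sum.inl (Sum.inl ⟨a, fun e => h (e ▸ rfl)⟩)
  | Sum.inl ⟨Sum.inr j, _⟩ => Sum.inr j
  | Sum.inr (Sum.inl b) => Sum.inl (Sum.inr b)
  | Sum.inr (Sum.inr j) => Sum.inr j

/-- The composition `x ∘ᵢ y` in `Tw Gra`: compose in `Gra` at the external vertex `i`, and sum over
all ways (shuffles) of distributing the labels of the internal vertices. -/
def comp [Finite F] (i : E) (x : TwSpace E) (y : TwSpace F) : TwSpace ({a : E // a ≠ i} ⊕ F) :=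
  fun N => ∑ S : Finset (Fin N),
    relabel (compLabel i S) (Gra.comp (Sum.inl i) (on x S) (on y Sᶜ))

/-- The image in `Gra` of the Lie bracket: two vertices joined by an edge. -/
def mu : Gra (Fin 2) := edge s(0, 1)

/-- The vertices of `mu ∘₁ x`, with the vertex `0` of `mu` made internal with label `s`. -/
def rootLabel {N : ℕ} (s : Fin N) :
    {v : Fin 2 // v ≠ 1} ⊕ (E ⊕ ({s}ᶜ : Finset (Fin N))) → E ⊕ Fin N
  | Sum.inl _ => Sum.inr s
  | Sum.inr u => Sum.map id Subtype.val u

/-- The vertices of `x ∘ᵥ mu`, with the vertex `0` of `mu` made internal with label `s`, and the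
vertex `1` of `mu` taking the place of `v`. -/
def splitLabel {N : ℕ} (s : Fin N) (v : E ⊕ ({s}ᶜ : Finset (Fin N))) :
    {u : E ⊕ ({s}ᶜ : Finset (Fin N)) // u ≠ v} ⊕ Fin 2 → E ⊕ Fin N
  | Sum.inl u => Sum.map id Subtype.val u.1
  | Sum.inr 0 => Sum.inr s
  | Sum.inr 1 => Sum.map id Subtype.val v

/-- The twisted differential on the degree `p` part:
`mu ∘₁ x - (-1)^p (∑ₐ x ∘ₐ mu + 1/2 ∑ⱼ x ∘ⱼ mu)`, with `a` running over the external and `j` over the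
internal vertices of `x`. In the first two terms the vertex `0` of `mu`, in the last term both
vertices of `mu` are made internal. Everything is summed over the label `s` of the new internal
vertex. (It comes from `a ↦ [m, a]` on the inputs and on the output and from `d m = -1/2 [m, m]`
for the Maurer-Cartan element `m` inserted into the internal vertices.) -/
def diff [Finite E] (p : ℤ) (x : TwSpace E) : TwSpace E := fun N => ∑ s : Fin N,
  (relabel (rootLabel s) (Gra.comp 1 mu (on x {s}ᶜ))
    - (-1 : ℝ) ^ p • ((∑ᶠ a : E,
          relabel (splitLabel s (Sum.inl a)) (Gra.comp (Sum.inl a) (on x {s}ᶜ) mu))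
        + (1 / 2 : ℝ) • ∑ j : ({s}ᶜ : Finset (Fin N)),
          relabel (splitLabel s (Sum.inr j)) (Gra.comp (Sum.inr j) (on x {s}ᶜ) mu)))

end TwGra

/-! ## Verification of the operad axioms

Everything up to the definition of `fGraphs` below consists of auxiliary notions and proofs for the
verification that the operations just defined satisfy the axioms of a dg operad. -/

namespace Gra

variable {V W U : Type}

theorem insertion_disjoint [Finite W] (i : V) (a b : V) (hab : a ≠ b) :
    Disjoint (insertion W i a) (insertion W i b) := by
  rw [Finset.disjoint_left]
  unfold insertion
  intro u hu
  by_cases h1 : a = i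
  · have h2 : b ≠ i := fun h2 => hab (h1.trans h2.symm)
    rw [dif_pos h1] at hu
    simp only [Set.Finite.mem_toFinset, Set.mem_range] at hu
    obtain ⟨w, rfl⟩ := hu
    simp [h2]
  · rw [dif_neg h1, Finset.mem_singleton] at hu
    subst hu
    by_cases h2 : b = i <;> simp [h2, hab]

theorem edge_diag (a : V) : edge s(a, a) = 0 := by
  simp [edge, edgeVec]

theorem edge_swap (a b : V) : edge s(a, b) = edge s(b, a) := by
  rw [Sym2.eq_swap]

theorem edge_mul_edge (e f : Sym2 V) : edge e * edge f = - (edge f * edge e) :=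
  eq_neg_of_add_eq_zero_left (ExteriorAlgebra.ι_add_mul_swap _ _)

theorem edge_sq (e : Sym2 V) : edge e * edge e = 0 := ExteriorAlgebra.ι_sq_zero _

theorem subst_edge (T : V → Finset W) {a b : V} (h : a ≠ b) :
    subst T (edge s(a, b)) = ∑ a' ∈ T a, ∑ b' ∈ T b, edge s(a', b') := by
  have : edgeVec s(a, b) = Finsupp.single ⟨s(a, b), by simpa using h⟩ 1 := by
    simp [edgeVec, h]
  simp [subst, edge, this, substEdge, map_sum]

theorem relabel_edge {f : V → W} (_ : Function.Injective f) (e : Sym2 V) :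
    relabel f (edge e) = edge (e.map f) := by
  induction e with | _ a b =>
  by_cases h : a = b
  · subst h; simp [edge_diag]
  · simp [relabel, subst_edge _ h]

theorem algHom_ext {A : Type} [Semiring A] [Algebra ℝ A] {f g : Gra V →ₐ[ℝ] A}
    (h : ∀ a b : V, a ≠ b → f (edge s(a, b)) = g (edge s(a, b))) : f = g := by
  apply ExteriorAlgebra.hom_ext
  apply Finsupp.lhom_ext'
  rintro ⟨e, he⟩
  induction e with | _ a b =>
  ext
  have := h a b (by simpa using he)
  have h2 : edgeVec s(a, b) = Finsupp.single ⟨s(a, b), he⟩ 1 := by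
    simp only [edgeVec, dif_neg he]
  simpa [edge, h2] using this

open Classical in
theorem subst_subst (T : W → Finset U) (S : V → Finset W)
    (hS : ∀ a b, a ≠ b → Disjoint (S a) (S b)) (hd : ∀ v, (S v : Set W).PairwiseDisjoint T)
    (x : Gra V) : subst T (subst S x) = subst (fun v => (S v).biUnion T) x := by
  suffices (subst T).comp (subst S) = subst (fun v => (S v).biUnion T) from
    DFunLike.congr_fun this x
  apply algHom_ext
  intro a b hab
  simp only [AlgHom.comp_apply, subst_edge _ hab, map_sum]
  rw [Finset.sum_biUnion (hd a)]
  refine Finset.sum_congr rfl fun a' ha' => ?_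
  have : ∀ b' ∈ S b, subst T (edge s(a', b')) = ∑ i ∈ T a', ∑ j ∈ T b', edge s(i, j) := by
    intro b' hb'
    refine subst_edge _ ?_
    rintro rfl
    exact Finset.disjoint_left.1 (hS a b hab) ha' hb'
  rw [Finset.sum_congr rfl this, Finset.sum_comm]
  refine Finset.sum_congr rfl fun i _ => ?_
  rw [Finset.sum_biUnion (hd b)]

theorem subst_relabel (T : W → Finset U) {f : V → W} (hf : Function.Injective f) (x : Gra V) :
    subst T (relabel f x) = subst (fun v => T (f v)) x := by
  suffices (subst T).comp (relabel f) = subst (fun v => T (f v)) from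
    DFunLike.congr_fun this x
  apply algHom_ext
  intro a b hab
  simp [relabel_edge hf, subst_edge _ hab, subst_edge _ (hf.ne hab)]

theorem relabel_subst {g : W → U} (hg : Function.Injective g) (S : V → Finset W)
    (hS : ∀ a b, a ≠ b → Disjoint (S a) (S b)) (x : Gra V) :
    relabel g (subst S x) = subst (fun v => (S v).map ⟨g, hg⟩) x := by
  classical
  rw [relabel, subst_subst _ _ hS]
  · congr 2
    ext v u
    simp [eq_comm]
  · intro v a _ b _ hab
    simpa [Function.onFun] using hg.ne hab

theorem relabel_relabel (g : W → U) {f : V → W} (hf : Function.Injective f) (x : Gra V) :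
    relabel g (relabel f x) = relabel (g ∘ f) x := subst_relabel _ hf x

theorem relabel_id (x : Gra V) : relabel id x = x := by
  suffices relabel (id : V → V) = AlgHom.id ℝ (Gra V) from DFunLike.congr_fun this x
  apply algHom_ext
  intro a b _
  simp [relabel_edge Function.injective_id]

theorem monomial_append (l l' : List (Sym2 V)) :
    monomial (l ++ l') = monomial l * monomial l' := by
  simp [monomial]

theorem monomial_mem (l : List (Sym2 V)) : monomial l ∈ homog V l.length :=
  Submodule.subset_span ⟨l, rfl, rfl⟩

theorem edge_mem (e : Sym2 V) : edge e ∈ homog V 1 := by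
  simpa [monomial] using monomial_mem [e]

theorem one_mem : (1 : Gra V) ∈ homog V 0 := by
  simpa [monomial] using monomial_mem ([] : List (Sym2 V))

theorem mul_mem {m n k : ℤ} (h : m + n = k) {x y : Gra V} (hx : x ∈ homog V m)
    (hy : y ∈ homog V n) : x * y ∈ homog V k := by
  have := Submodule.mul_mem_mul hx hy
  rw [homog, homog, Submodule.span_mul_span] at this
  refine Submodule.span_mono ?_ this
  rintro _ ⟨_, ⟨l, hl, rfl⟩, _, ⟨l', hl', rfl⟩, rfl⟩
  exact ⟨l ++ l', by simp [hl, hl', h], (monomial_append l l').symm⟩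

theorem subst_mem (T : V → Finset W) {m : ℤ} {x : Gra V} (hx : x ∈ homog V m) :
    subst T x ∈ homog W m := by
  induction hx using Submodule.span_induction with
  | zero => simp
  | add x y _ _ hx hy => simpa using add_mem hx hy
  | smul c x _ hx => simpa using Submodule.smul_mem _ c hx
  | mem x hx =>
    obtain ⟨l, rfl, rfl⟩ := hx
    induction l with
    | nil => simpa [monomial] using one_mem
    | cons e l ih =>
      have : subst T (monomial (e :: l)) = subst T (edge e) * subst T (monomial l) := by
        simp [monomial]
      rw [this]
      refine mul_mem (m := 1) (by push_cast [List.length_cons]; ring) ?_ ih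
      induction e with | _ a b =>
      by_cases hab : a = b
      · subst hab; simp [edge_diag]
      · rw [subst_edge _ hab]
        exact sum_mem fun _ _ => sum_mem fun _ _ => edge_mem _

theorem mul_edge {m : ℤ} {x : Gra V} (hx : x ∈ homog V m) (e : Sym2 V) :
    x * edge e = (-1 : ℝ) ^ m • (edge e * x) := by
  induction hx using Submodule.span_induction with
  | zero => simp
  | add x y _ _ hx hy => simp [add_mul, mul_add, hx, hy]
  | smul c x _ hx => simp [hx, smul_comm c]
  | mem x hx =>
    obtain ⟨l, rfl, rfl⟩ := hx
    induction l with
    | nil => simp [monomial]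
    | cons f l ih =>
      have h : monomial (f :: l) = edge f * monomial l := by simp [monomial]
      rw [h, mul_assoc, ih, mul_smul_comm, ← mul_assoc, ← mul_assoc, edge_mul_edge f e,
        List.length_cons]
      push_cast
      rw [zpow_add₀ (by norm_num)]
      simp

theorem mul_comm_sign {m n : ℤ} {x y : Gra V} (hx : x ∈ homog V m) (hy : y ∈ homog V n) :
    x * y = (-1 : ℝ) ^ (m * n) • (y * x) := by
  induction hy using Submodule.span_induction with
  | zero => simp
  | add y z _ _ hy hz => simp [add_mul, mul_add, hy, hz]
  | smul c y _ hy => simp [hy, smul_comm c]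
  | mem y hy =>
    obtain ⟨l, rfl, rfl⟩ := hy
    induction l with
    | nil => simp [monomial]
    | cons f l ih =>
      have h : monomial (f :: l) = edge f * monomial l := by simp [monomial]
      rw [h, ← mul_assoc, mul_edge hx, smul_mul_assoc, mul_assoc, ih, List.length_cons]
      push_cast
      rw [mul_add, zpow_add₀ (by norm_num), mul_one, mul_smul_comm, smul_smul, mul_comm, mul_assoc]

/-- supported on P -/
def SuppOn (P : Set V) (x : Gra V) : Prop := ∃ x' : Gra P, relabel Subtype.val x' = x

theorem subst_congr_on {P : Set V} {x : Gra V} (hx : SuppOn P x) {S T : V → Finset W}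
    (h : ∀ v ∈ P, S v = T v) : subst S x = subst T x := by
  obtain ⟨x', rfl⟩ := hx
  rw [subst_relabel _ Subtype.val_injective, subst_relabel _ Subtype.val_injective]
  congr 2
  ext v : 1
  exact h v v.2

open Classical in
theorem subst_subst_on {P : Set V} {x : Gra V} (hx : SuppOn P x) {S : V → Finset W}
    {T : W → Finset U} {R : V → Finset U}
    (hS : ∀ a ∈ P, ∀ b ∈ P, a ≠ b → Disjoint (S a) (S b))
    (hT : ∀ v ∈ P, (S v : Set W).PairwiseDisjoint T)
    (hR : ∀ v ∈ P, (S v).biUnion T = R v) : subst T (subst S x) = subst R x := by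
  obtain ⟨x', rfl⟩ := hx
  rw [subst_relabel _ Subtype.val_injective, subst_relabel _ Subtype.val_injective, subst_subst]
  · congr 2
    ext v : 1
    exact hR v v.2
  · exact fun a b hab => hS a a.2 b b.2 (Subtype.val_injective.ne hab)
  · exact fun v => hT v v.2

theorem SuppOn.mono {P Q : Set V} (h : P ⊆ Q) {x : Gra V} (hx : SuppOn P x) : SuppOn Q x := by
  obtain ⟨x', rfl⟩ := hx
  exact ⟨relabel (Set.inclusion h) x', relabel_relabel _ (Set.inclusion_injective h) _⟩

end Gra

namespace TwGra

open Gra DGOperad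

variable {E F G U : Type}


def restr (x : TwSpace E) {N : ℕ} (S : Finset (Fin N)) : Gra (E ⊕ Fin N) :=
  relabel (Sum.map id (S.orderEmbOfFin rfl)) (x S.card)

def verts (E : Type) [Finite E] {N : ℕ} (S : Finset (Fin N)) : Finset (E ⊕ Fin N) :=
  (@Finset.univ E (Fintype.ofFinite E)).disjSum S

@[simp] theorem inl_mem_verts [Finite E] {N : ℕ} (S : Finset (Fin N)) (a : E) :
    Sum.inl a ∈ verts E S := by simp [verts]

@[simp] theorem inr_mem_verts [Finite E] {N : ℕ} (S : Finset (Fin N)) (j : Fin N) :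
    Sum.inr j ∈ verts E S ↔ j ∈ S := by simp [verts]

theorem at_eq_on (x : TwSpace E) {N : ℕ} (S : Finset (Fin N)) :
    relabel (Sum.map id Subtype.val) (on x S) = restr x S := by
  rw [on, relabel_relabel, restr]
  · congr 2
    ext v
    cases v <;> simp
  · exact Sum.map_injective.2 ⟨Function.injective_id, (S.orderIsoOfFin rfl).injective⟩

theorem subst_on (x : TwSpace E) {N : ℕ} (S : Finset (Fin N)) (T : E ⊕ S → Finset U)
    (T' : E ⊕ Fin N → Finset U) (h : ∀ v, T v = T' (Sum.map id Subtype.val v)) :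
    subst T (on x S) = subst T' (restr x S) := by
  rw [← at_eq_on, subst_relabel]
  · congr 2; ext v : 1; exact h v
  · exact Sum.map_injective.2 ⟨Function.injective_id, Subtype.val_injective⟩

theorem suppOn_at [Finite E] (x : TwSpace E) {N : ℕ} (S : Finset (Fin N)) :
    SuppOn (verts E S : Set (E ⊕ Fin N)) (restr x S) := by
  have hm : ∀ v : E ⊕ S, Sum.map id Subtype.val v ∈ (verts E S : Set (E ⊕ Fin N)) := by
    intro v; cases v <;> simp
  refine ⟨relabel (fun v => ⟨Sum.map id Subtype.val v, hm v⟩) (on x S), ?_⟩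
  rw [relabel_relabel, ← at_eq_on]
  · rfl
  · intro a b h
    have : Function.Injective (Sum.map (id : E → E) (Subtype.val : S → Fin N)) :=
      Sum.map_injective.2 ⟨Function.injective_id, Subtype.val_injective⟩
    exact this (congrArg Subtype.val h)

def Inv (x : TwSpace E) : Prop :=
  ∀ (k : ℕ) (σ : Equiv.Perm (Fin k)), relabel (Sum.map id σ) (x k) = x k

theorem map_id_injective {k N : ℕ} (f : Fin k ↪ Fin N) :
    Function.Injective (Sum.map (id : E → E) f) :=
  Sum.map_injective.2 ⟨Function.injective_id, f.injective⟩

theorem Inv.at_eq {x : TwSpace E} (hx : Inv x) {k N : ℕ} (f : Fin k ↪ Fin N) :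
    relabel (Sum.map id f) (x k) = restr x (Finset.univ.map f) := by
  have hk : (Finset.univ.map f).card = k := by simp
  have hm : ∀ j, f j ∈ Finset.univ.map f := fun j => by simp
  generalize Finset.univ.map f = S at hk hm
  subst hk
  have hinj : Function.Injective (fun j => (S.orderIsoOfFin rfl).symm ⟨f j, hm j⟩) := by
    intro a b h
    simpa using h
  let σ : Equiv.Perm (Fin S.card) := Equiv.ofBijective _ (Finite.injective_iff_bijective.1 hinj)
  have hσ : ∀ j, S.orderEmbOfFin rfl (σ j) = f j := by
    intro j
    simp [σ, ← Finset.coe_orderIsoOfFin_apply]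
  conv_rhs => rw [restr, ← hx _ σ]
  rw [relabel_relabel _ (f := Sum.map id σ) (map_id_injective σ.toEmbedding)]
  congr 2
  ext v
  cases v <;> simp [hσ]

theorem Inv.map_at {x : TwSpace E} (hx : Inv x) {k N : ℕ} (f : Fin k ↪ Fin N)
    (S : Finset (Fin k)) :
    relabel (Sum.map id f) (restr x S) = restr x (S.map f) := by
  rw [restr, relabel_relabel _ (f := Sum.map id (S.orderEmbOfFin rfl))
    (map_id_injective (S.orderEmbOfFin rfl).toEmbedding)]
  have := hx.at_eq ((S.orderEmbOfFin rfl).toEmbedding.trans f)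
  rw [← Finset.map_map, Finset.map_orderEmbOfFin_univ] at this
  rw [← this]
  congr 2
  ext v
  cases v <;> simp

theorem Inv.at_univ {x : TwSpace E} (hx : Inv x) (N : ℕ) : restr x Finset.univ = x N := by
  have := hx.at_eq (Function.Embedding.refl (Fin N))
  rw [Finset.map_refl] at this
  rw [← this]
  convert relabel_id (x N) using 3
  ext v
  cases v <;> simp

theorem Inv.ext {x y : TwSpace E} (hx : Inv x) (hy : Inv y)
    (h : ∀ N, restr x (Finset.univ : Finset (Fin N)) = restr y Finset.univ) : x = y := by
  funext N
  rw [← hx.at_univ, h, hy.at_univ]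

theorem at_mem {x : TwSpace E} {p : ℤ} (hx : x ∈ deg E p) {N : ℕ} (S : Finset (Fin N)) :
    restr x S ∈ homog _ (2 * S.card - p) := subst_mem _ (hx S.card).1

theorem on_mem {x : TwSpace E} {p : ℤ} (hx : x ∈ deg E p) {N : ℕ} (S : Finset (Fin N)) :
    on x S ∈ homog _ (2 * S.card - p) := subst_mem _ (hx S.card).1

/-! composition -/

theorem sumInr_injective {i : E} {N : ℕ} :
    Function.Injective (Sum.map (Sum.inr : F → {a : E // a ≠ i} ⊕ F) (id : Fin N → Fin N)) :=
  Sum.map_injective.2 ⟨Sum.inr_injective, Function.injective_id⟩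

open Classical in
def ker [Finite F] (i : E) {N : ℕ} (Y : Finset (Fin N)) :
    E ⊕ Fin N → Finset (({a : E // a ≠ i} ⊕ F) ⊕ Fin N)
  | Sum.inl a => if h : a = i then (verts F Y).map ⟨_, sumInr_injective⟩
      else {Sum.inl (Sum.inl ⟨a, h⟩)}
  | Sum.inr j => {Sum.inr j}

def term [Finite F] (i : E) (x : TwSpace E) (y : TwSpace F) {N : ℕ} (A B : Finset (Fin N)) :
    Gra (({a : E // a ≠ i} ⊕ F) ⊕ Fin N) :=
  subst (ker i B) (restr x A) * relabel (Sum.map Sum.inr id) (restr y B)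

theorem compLabel_injective (i : E) {N : ℕ} (S : Finset (Fin N)) :
    Function.Injective (compLabel (F := F) i S) := by
  have h1 : ∀ a ∈ S, ∀ b ∉ S, a ≠ b := by rintro a ha _ hb rfl; exact hb ha
  rintro (⟨a | a, ha⟩ | a | a) (⟨b | b, hb⟩ | b | b) h <;>
    simp [compLabel] at h ⊢ <;> first | exact h | exact Subtype.ext h | skip
  · have := b.2; rw [← h] at this; simp at this
  · have := a.2; rw [h] at this; simp at this

theorem term_eq [Finite F] (i : E) (x : TwSpace E) (y : TwSpace F) {N : ℕ}
    (S : Finset (Fin N)) :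
    relabel (compLabel i S) (Gra.comp (Sum.inl i) (on x S) (on y Sᶜ)) = term i x y S Sᶜ := by
  classical
  rw [Gra.comp, map_mul, term]
  congr 1
  · rw [relabel_subst (compLabel_injective i S) _ (insertion_disjoint _)]
    apply subst_on
    rintro (a | a)
    · ext u
      by_cases h : a = i
      · subst h
        simp only [insertion, ker, Sum.map_inl, id, dif_pos, Finset.mem_map,
          Set.Finite.mem_toFinset, Set.mem_range, Function.Embedding.coeFn_mk]
        constructor
        · rintro ⟨_, ⟨(b | b), rfl⟩, rfl⟩
          · exact ⟨Sum.inl b, by simp, rfl⟩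
          · exact ⟨Sum.inr b, by simp, rfl⟩
        · rintro ⟨(b | b), hb, rfl⟩
          · exact ⟨_, ⟨Sum.inl b, rfl⟩, rfl⟩
          · exact ⟨_, ⟨Sum.inr ⟨b, by simpa using hb⟩, rfl⟩, rfl⟩
      · have h' : (Sum.inl a : E ⊕ S) ≠ Sum.inl i := by simpa using h
        simp only [insertion, ker, Sum.map_inl, id, dif_neg h, dif_neg h', Finset.mem_map,
          Finset.mem_singleton, exists_eq_left]
        simp [compLabel, eq_comm]
    · ext u
      simp [insertion, ker, compLabel, eq_comm]
  · rw [relabel_relabel _ Sum.inr_injective, ← at_eq_on, relabel_relabel]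
    · congr 2
      ext v
      rcases v with v | v <;> rfl
    · exact Sum.map_injective.2 ⟨Function.injective_id, Subtype.val_injective⟩

theorem ker_self [Finite F] (i : E) {N : ℕ} (Y : Finset (Fin N)) :
    ker (F := F) i Y (Sum.inl i) = (verts F Y).map ⟨_, sumInr_injective⟩ := by
  simp [ker]

theorem ker_ne [Finite F] {i a : E} (h : a ≠ i) {N : ℕ} (Y : Finset (Fin N)) :
    ker (F := F) i Y (Sum.inl a) = {Sum.inl (Sum.inl ⟨a, h⟩)} := by
  simp [ker, h]

theorem ker_inr [Finite F] (i : E) {N : ℕ} (Y : Finset (Fin N)) (j : Fin N) :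
    ker (F := F) i Y (Sum.inr j) = {Sum.inr j} := rfl

theorem ker_disjoint [Finite E] [Finite F] (i : E) {N : ℕ} {A B : Finset (Fin N)} (h : Disjoint A B)
    (a : E ⊕ Fin N) (ha : a ∈ (verts E A : Set (E ⊕ Fin N)))
    (b : E ⊕ Fin N) (hb : b ∈ (verts E A : Set (E ⊕ Fin N))) (hab : a ≠ b) :
    Disjoint (ker (F := F) i B a) (ker i B b) := by
  have h1 : ∀ j ∈ A, j ∉ B := fun j hj => Finset.disjoint_left.1 h hj
  rcases a with a | a <;> rcases b with b | b
  · by_cases ha : a = i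
    · subst ha
      have hb : b ≠ a := fun h => hab (by rw [h])
      rw [ker_self, ker_ne hb, Finset.disjoint_singleton_right]
      rintro hu
      obtain ⟨(u | u), _, hu⟩ := Finset.mem_map.1 hu <;> simp at hu
    · by_cases hb : b = i
      · subst hb
        rw [ker_self, ker_ne ha, Finset.disjoint_singleton_left]
        rintro hu
        obtain ⟨(u | u), _, hu⟩ := Finset.mem_map.1 hu <;> simp at hu
      · rw [ker_ne ha, ker_ne hb]
        simpa using hab
  · by_cases ha : a = i
    · subst ha
      rw [ker_self, ker_inr, Finset.disjoint_singleton_right]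
      rintro hu
      obtain ⟨(u | u), hm, hu⟩ := Finset.mem_map.1 hu <;> simp at hu
      subst hu
      exact h1 _ (by simpa using hb) (by simpa using hm)
    · rw [ker_ne ha, ker_inr]
      simp
  · by_cases hb : b = i
    · subst hb
      rw [ker_self, ker_inr, Finset.disjoint_singleton_left]
      rintro hu
      obtain ⟨(u | u), hm, hu⟩ := Finset.mem_map.1 hu <;> simp at hu
      subst hu
      exact h1 _ (by simpa using ha) (by simpa using hm)
    · rw [ker_ne hb, ker_inr]
      simp
  · rw [ker_inr, ker_inr]
    simpa using hab

theorem relabel_comp [Finite E] [Finite F] (i : E) {x : TwSpace E} {y : TwSpace F} (hx : Inv x) (hy : Inv y)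
    {k N : ℕ} (f : Fin k ↪ Fin N) :
    relabel (Sum.map id f) (comp i x y k) =
      ∑ A ∈ (Finset.univ.map f).powerset, term i x y A (Finset.univ.map f \ A) := by
  classical
  have key : ∀ A : Finset (Fin k), relabel (Sum.map id f) (term i x y A Aᶜ) =
      term i x y (A.map f) ((Aᶜ).map f) := by
    intro A
    rw [term, map_mul, term, ← hx.map_at f A, ← hy.map_at f]
    congr 1
    · rw [subst_relabel _ (map_id_injective f)]
      refine subst_subst_on (suppOn_at x A) (ker_disjoint i disjoint_compl_right) ?_ ?_
      · intro v _ u _ w _ huw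
        simpa [Function.onFun] using (map_id_injective f).ne huw
      · rintro (a | a) ha
        · by_cases h : a = i
          · subst h
            simp only [Sum.map_inl, id, ker_self]
            ext u
            simp only [Finset.mem_biUnion, Finset.mem_map, Finset.mem_singleton,
              Function.Embedding.coeFn_mk]
            constructor
            · rintro ⟨_, ⟨(w | w), hw, rfl⟩, rfl⟩
              · exact ⟨Sum.inl w, by simp, rfl⟩
              · exact ⟨Sum.inr (f w), by simpa using hw, rfl⟩
            · rintro ⟨(w | w), hw, rfl⟩
              · exact ⟨_, ⟨Sum.inl w, by simp, rfl⟩, rfl⟩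
              · simp only [inr_mem_verts, Finset.mem_map] at hw
                obtain ⟨w, hw, rfl⟩ := hw
                exact ⟨_, ⟨Sum.inr w, by simpa using hw, rfl⟩, rfl⟩
          · simp [ker_ne h]
        · simp [ker_inr]
    · rw [relabel_relabel _ sumInr_injective, relabel_relabel _ (map_id_injective f)]
      congr 2
      ext v
      rcases v with v | v <;> rfl
  simp only [comp, map_sum, term_eq, key]
  refine Finset.sum_bij (fun A _ => A.map f) ?_ ?_ ?_ ?_
  · intro A _
    simp [Finset.map_subset_map]
  · intro A _ B _ h
    exact Finset.map_injective f h
  · intro B hB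
    rw [Finset.mem_powerset, Finset.subset_map_iff] at hB
    obtain ⟨A, _, rfl⟩ := hB
    exact ⟨A, by simp, rfl⟩
  · intro A _
    congr 1
    ext j
    simp only [Finset.mem_map, Finset.mem_sdiff, Finset.mem_compl, Finset.mem_univ, true_and]
    constructor
    · rintro ⟨a, ha, rfl⟩
      exact ⟨⟨a, rfl⟩, fun ⟨b, hb, e⟩ => ha (f.injective e ▸ hb)⟩
    · rintro ⟨⟨a, rfl⟩, h⟩
      exact ⟨a, fun ha => h ⟨a, ha, rfl⟩, rfl⟩


/-! differential -/

def wt {N : ℕ} : E ⊕ Fin N → ℝ := Sum.elim (fun _ => 1) (fun _ => 1 / 2)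

open Classical in
def spl (v s u : U) : Finset U := if u = v then {v, s} else {u}

open Classical in
theorem spl_self (v s : U) : spl v s v = {v, s} := by
  ext; simp [spl]

theorem spl_ne {v s u : U} (h : u ≠ v) : spl v s u = {u} := by simp [spl, h]

def dterm (x : TwSpace E) {N : ℕ} (S : Finset (Fin N)) (s : Fin N) (v : E ⊕ Fin N) :
    Gra (E ⊕ Fin N) :=
  edge s(Sum.inr s, v) * (restr x S - wt v • subst (spl v (Sum.inr s)) (restr x S))

def dsum [Finite E] (x : TwSpace E) {N : ℕ} (S : Finset (Fin N)) : Gra (E ⊕ Fin N) :=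
  ∑ s ∈ S, ∑ v ∈ verts E (S.erase s), dterm x (S.erase s) s v

theorem mapVal_injective {N : ℕ} (S : Finset (Fin N)) :
    Function.Injective (Sum.map (id : E → E) (Subtype.val : S → Fin N)) :=
  Sum.map_injective.2 ⟨Function.injective_id, Subtype.val_injective⟩

theorem mapVal_ne {N : ℕ} {s : Fin N} (v : E ⊕ ({s}ᶜ : Finset (Fin N))) :
    Sum.map id Subtype.val v ≠ Sum.inr s := by
  rcases v with v | ⟨v, hv⟩
  · simp
  · simpa using hv

theorem splitLabel_injective {N : ℕ} (s : Fin N) (v : E ⊕ ({s}ᶜ : Finset (Fin N))) :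
    Function.Injective (splitLabel s v) := by
  rintro (⟨a, ha⟩ | a) (⟨b, hb⟩ | b) h
  · have := mapVal_injective _ h
    simpa using this
  · fin_cases b
    · exact absurd h (mapVal_ne _)
    · exact absurd (mapVal_injective _ h) ha
  · fin_cases a
    · exact absurd h.symm (mapVal_ne _)
    · exact absurd (mapVal_injective _ h.symm) hb
  · fin_cases a <;> fin_cases b
    · rfl
    · exact absurd h.symm (mapVal_ne _)
    · exact absurd h (mapVal_ne _)
    · rfl

theorem rootLabel_injective {N : ℕ} (s : Fin N) :
    Function.Injective (rootLabel (E := E) s) := by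
  rintro (⟨a, ha⟩ | a) (⟨b, hb⟩ | b) h
  · have h1 : a = 0 := by omega
    have h2 : b = 0 := by omega
    simp [h1, h2]
  · exact absurd h.symm (mapVal_ne _)
  · exact absurd h (mapVal_ne _)
  · exact congrArg _ (mapVal_injective _ h)

theorem root_eq [Finite E] (x : TwSpace E) {N : ℕ} (s : Fin N) :
    relabel (rootLabel s) (Gra.comp 1 mu (on x {s}ᶜ)) =
      ∑ v ∈ verts E {s}ᶜ, edge s(Sum.inr s, v) * restr x {s}ᶜ := by
  classical
  rw [Gra.comp, map_mul, mu, subst_edge _ (by decide), ← Finset.sum_mul, ← at_eq_on,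
    relabel_relabel _ Sum.inr_injective]
  congr 1
  have h0 : insertion (E ⊕ ({s}ᶜ : Finset (Fin N))) (1 : Fin 2) 0 =
      {Sum.inl ⟨0, by decide⟩} := by simp [insertion]
  rw [h0, Finset.sum_singleton, map_sum]
  refine Finset.sum_bij (fun u _ => rootLabel s u) ?_ ?_ ?_ ?_
  · intro u hu
    simp only [insertion, dif_pos, Set.Finite.mem_toFinset, Set.mem_range] at hu
    obtain ⟨(u | u), rfl⟩ := hu
    · simp [rootLabel]
    · simp [rootLabel]
  · intro a _ b _ h
    exact rootLabel_injective s h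
  · rintro (v | v) hv
    · exact ⟨Sum.inr (Sum.inl v), by simp [insertion], rfl⟩
    · exact ⟨Sum.inr (Sum.inr ⟨v, by simpa using hv⟩), by simp [insertion], rfl⟩
  · intro u _
    rw [relabel_edge (rootLabel_injective s)]
    rfl

theorem split_eq (x : TwSpace E) {N : ℕ} {p : ℤ} (hx : x ∈ deg E p) (s : Fin N)
    (v : E ⊕ ({s}ᶜ : Finset (Fin N))) :
    (-1 : ℝ) ^ p • relabel (splitLabel s v) (Gra.comp v (on x {s}ᶜ) mu) =
      edge s(Sum.inr s, Sum.map id Subtype.val v) *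
        subst (spl (Sum.map id Subtype.val v) (Sum.inr s)) (restr x {s}ᶜ) := by
  classical
  rw [Gra.comp, map_mul, relabel_relabel _ Sum.inr_injective, mu, relabel_edge,
    relabel_subst (splitLabel_injective s v) _ (insertion_disjoint _)]
  · have h1 : subst (fun u => (insertion (Fin 2) v u).map ⟨_, splitLabel_injective s v⟩)
        (on x {s}ᶜ) = subst (spl (Sum.map id Subtype.val v) (Sum.inr s)) (restr x {s}ᶜ) := by
      apply subst_on
      intro u
      ext w
      by_cases h : u = v
      · subst h
        rw [spl_self]
        simp [insertion, splitLabel, or_comm, eq_comm]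
      · rw [spl_ne ((mapVal_injective _).ne h)]
        simp only [insertion, dif_neg h]
        simp [splitLabel]
    rw [h1, mul_edge (subst_mem _ (at_mem hx _)), smul_smul, ← zpow_add₀ (by norm_num)]
    rw [Even.neg_one_zpow (by simp), one_smul]
    rfl
  · exact (splitLabel_injective s v).comp Sum.inr_injective

theorem diff_eq [Finite E] {x : TwSpace E} {p : ℤ} (hx : x ∈ deg E p) (N : ℕ) :
    diff p x N = ∑ s : Fin N, ∑ v ∈ verts E {s}ᶜ, dterm x {s}ᶜ s v := by
  classical
  refine Finset.sum_congr rfl fun s _ => ?_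
  simp only [dterm, mul_sub, Finset.sum_sub_distrib, root_eq]
  congr 1
  let _ := Fintype.ofFinite E
  rw [finsum_eq_sum_of_fintype, smul_add, Finset.smul_sum, smul_comm, Finset.smul_sum]
  simp only [split_eq x hx]
  rw [verts, Finset.sum_disjSum]
  congr 1
  · simp [wt]
  · rw [Finset.smul_sum]
    simp only [wt, Sum.elim_inr, mul_smul_comm]
    exact Finset.sum_coe_sort ({s}ᶜ : Finset (Fin N)) (fun j => (1 / 2 : ℝ) •
      (edge s(Sum.inr s, Sum.inr j) * subst (spl (Sum.inr j) (Sum.inr s)) (restr x {s}ᶜ)))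

theorem relabel_diff [Finite E] {x : TwSpace E} {p : ℤ} (hx : x ∈ deg E p) {k N : ℕ}
    (f : Fin k ↪ Fin N) :
    relabel (Sum.map id f) (diff p x k) = dsum x (Finset.univ.map f) := by
  classical
  have hI : Inv x := fun k => (hx k).2
  rw [diff_eq hx, dsum, Finset.sum_map, map_sum]
  refine Finset.sum_congr rfl fun s _ => ?_
  have he : (Finset.univ.map f).erase (f s) = ({s}ᶜ : Finset (Fin k)).map f := by
    ext j
    simp only [Finset.mem_erase, Finset.mem_map, Finset.mem_univ, true_and, Finset.mem_compl,
      Finset.mem_singleton]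
    constructor
    · rintro ⟨h, a, rfl⟩
      exact ⟨a, fun e => h (by rw [e]), rfl⟩
    · rintro ⟨a, h, rfl⟩
      exact ⟨f.injective.ne h, a, rfl⟩
  have hv : verts E (({s}ᶜ : Finset (Fin k)).map f) =
      (verts E {s}ᶜ).map ⟨Sum.map id f, map_id_injective f⟩ := by
    ext u
    rcases u with u | u <;> simp
  rw [he, hv, Finset.sum_map, map_sum]
  refine Finset.sum_congr rfl fun v _ => ?_
  have hi := map_id_injective (E := E) f
  have hw : wt (Sum.map id f v : E ⊕ Fin N) = wt v := by cases v <;> rfl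
  simp only [dterm, map_mul, map_sub, map_smul, relabel_edge hi, Function.Embedding.coeFn_mk,
    hI.map_at, hw]
  congr 3
  rw [← hI.map_at f, subst_relabel _ hi]
  refine subst_subst_on (suppOn_at x _) ?_ ?_ ?_
  · intro a ha b hb hab
    have hs : ∀ c ∈ (verts E ({s}ᶜ : Finset (Fin k)) : Set (E ⊕ Fin k)), c ≠ Sum.inr s := by
      rintro (c | c) hc
      · simp
      · simpa using hc
    by_cases h1 : a = v
    · subst h1
      rw [spl_self, spl_ne hab.symm]
      simp [hab.symm, hs b hb]
    · by_cases h2 : b = v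
      · subst h2
        rw [spl_self, spl_ne hab]
        simp [hab, hs a ha]
      · rw [spl_ne h1, spl_ne h2]
        simpa using hab
  · intro a _ u _ w _ huw
    simpa [Function.onFun] using hi.ne huw
  · intro a _
    by_cases h1 : a = v
    · subst h1
      rw [spl_self, spl_self]
      ext; simp
    · rw [spl_ne h1, spl_ne (hi.ne h1)]
      simp

theorem verts_ne [Finite E] {N : ℕ} {S : Finset (Fin N)} {s : Fin N} (hs : s ∉ S)
    {v : E ⊕ Fin N} (hv : v ∈ verts E S) : v ≠ Sum.inr s := by
  rintro rfl
  exact hs (by simpa using hv)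

theorem spl_disjoint [Finite E] {N : ℕ} {S : Finset (Fin N)} {s : Fin N} (hs : s ∉ S)
    (v : E ⊕ Fin N) (a : E ⊕ Fin N) (ha : a ∈ (verts E S : Set (E ⊕ Fin N)))
    (b : E ⊕ Fin N) (hb : b ∈ (verts E S : Set (E ⊕ Fin N))) (hab : a ≠ b) :
    Disjoint (spl v (Sum.inr s) a) (spl v (Sum.inr s) b) := by
  classical
  have h3 := verts_ne hs ha
  have h4 := verts_ne hs hb
  by_cases h1 : a = v
  · subst h1
    rw [spl_self, spl_ne hab.symm]
    simp [hab.symm, h4]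
  · by_cases h2 : b = v
    · subst h2
      rw [spl_self, spl_ne hab]
      simp [hab, h3]
    · rw [spl_ne h1, spl_ne h2]
      simpa using hab

theorem perm_map {k : ℕ} (σ : Equiv.Perm (Fin k)) :
    (Finset.univ : Finset (Fin k)).map σ.toEmbedding = Finset.univ := by
  ext; simp

theorem deg.inv {x : TwSpace E} {p : ℤ} (hx : x ∈ deg E p) : Inv x := fun k => (hx k).2

theorem comp_inv [Finite E] [Finite F] (i : E) {x : TwSpace E} {y : TwSpace F}
    (hx : Inv x) (hy : Inv y) : Inv (comp i x y) := by
  intro k σ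
  have h := relabel_comp i hx hy σ.toEmbedding
  have h' := relabel_comp i hx hy (Equiv.refl (Fin k)).toEmbedding
  rw [perm_map] at h h'
  refine h.trans (h'.symm.trans ?_)
  convert relabel_id _ using 3
  ext v
  cases v <;> simp

theorem at_comp [Finite E] [Finite F] (i : E) {x : TwSpace E} {y : TwSpace F}
    (hx : Inv x) (hy : Inv y) {N : ℕ} (S : Finset (Fin N)) :
    restr (comp i x y) S = ∑ A ∈ S.powerset, term i x y A (S \ A) := by
  rw [restr]
  have := relabel_comp i hx hy (S.orderEmbOfFin rfl).toEmbedding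
  rw [Finset.map_orderEmbOfFin_univ] at this
  exact this

theorem comp_mem [Finite E] [Finite F] (i : E) {p q r : ℤ} (h : p + q = r)
    {x : TwSpace E} {y : TwSpace F} (hx : x ∈ deg E p) (hy : y ∈ deg F q) :
    comp i x y ∈ deg _ r := by
  intro k
  refine ⟨?_, comp_inv i (deg.inv hx) (deg.inv hy) k⟩
  refine sum_mem fun S _ => ?_
  rw [term_eq, term]
  refine mul_mem ?_ (subst_mem _ (at_mem hx _)) (subst_mem _ (at_mem hy _))
  have := Finset.card_add_card_compl S
  rw [Fintype.card_fin] at this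
  rw [← h]
  have : (S.card : ℤ) + (Sᶜ.card : ℤ) = k := by exact_mod_cast this
  linarith

theorem diff_inv [Finite E] {x : TwSpace E} {p : ℤ} (hx : x ∈ deg E p) : Inv (diff p x) := by
  intro k σ
  have h := relabel_diff hx σ.toEmbedding
  have h' := relabel_diff hx (Equiv.refl (Fin k)).toEmbedding
  rw [perm_map] at h h'
  refine h.trans (h'.symm.trans ?_)
  convert relabel_id _ using 3
  ext v
  cases v <;> simp

theorem at_diff [Finite E] {x : TwSpace E} {p : ℤ} (hx : x ∈ deg E p) {N : ℕ}
    (S : Finset (Fin N)) : restr (diff p x) S = dsum x S := by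
  rw [restr]
  have := relabel_diff hx (S.orderEmbOfFin rfl).toEmbedding
  rw [Finset.map_orderEmbOfFin_univ] at this
  exact this

theorem diff_mem [Finite E] {p q : ℤ} (h : p + 1 = q) {x : TwSpace E} (hx : x ∈ deg E p) :
    diff p x ∈ deg E q := by
  intro k
  refine ⟨?_, diff_inv hx k⟩
  rw [diff_eq hx]
  refine sum_mem fun s _ => sum_mem fun v _ => ?_
  refine mul_mem (m := 1) ?_ (edge_mem _) (sub_mem (at_mem hx _)
    (Submodule.smul_mem _ _ (subst_mem _ (at_mem hx _))))
  have := Finset.card_add_card_compl ({s} : Finset (Fin k))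
  rw [Fintype.card_fin, Finset.card_singleton] at this
  rw [← h]
  have : (1 : ℤ) + ((({s} : Finset (Fin k))ᶜ).card : ℤ) = k := by exact_mod_cast this
  linarith


theorem equiv_injective (e : E ≃ F) {N : ℕ} :
    Function.Injective (Sum.map e (id : Fin N → Fin N)) :=
  Sum.map_injective.2 ⟨e.injective, Function.injective_id⟩

theorem map_mem (e : E ≃ F) {p : ℤ} {x : TwSpace E} (hx : x ∈ deg E p) : map e x ∈ deg F p := by
  intro k
  refine ⟨subst_mem _ (hx k).1, fun σ => ?_⟩
  conv_rhs => rw [map, ← (hx k).2 σ]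
  rw [map, relabel_relabel _ (equiv_injective e),
    relabel_relabel _ (f := Sum.map id σ) (map_id_injective σ.toEmbedding)]
  congr 2
  ext v
  cases v <;> rfl

theorem at_map (e : E ≃ F) (x : TwSpace E) {N : ℕ} (S : Finset (Fin N)) :
    restr (map e x) S = relabel (Sum.map e id) (restr x S) := by
  rw [restr, restr, map, relabel_relabel _ (equiv_injective e), relabel_relabel _
    (f := Sum.map id (S.orderEmbOfFin rfl)) (map_id_injective (S.orderEmbOfFin rfl).toEmbedding)]
  congr 2
  ext v
  cases v <;> rfl

theorem unit_mem : unit ∈ deg Unit 0 := by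
  intro k
  by_cases h : k = 0
  · subst h; simpa [unit] using one_mem
  · simp [unit, h]

theorem at_unit {N : ℕ} (S : Finset (Fin N)) : restr unit S = if S = ∅ then 1 else 0 := by
  by_cases h : S = ∅
  · subst h
    rw [if_pos rfl]
    exact map_one _
  · have : S.card ≠ 0 := by simpa using h
    simp [restr, unit, h]

theorem map_refl (x : TwSpace E) : map (Equiv.refl E) x = x := by
  funext k
  rw [map]
  convert relabel_id (x k) using 3
  ext v
  cases v <;> rfl

theorem map_trans (e : E ≃ F) (e' : F ≃ G) (x : TwSpace E) :
    map e' (map e x) = map (e.trans e') x := by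
  funext k
  rw [map, map, map, relabel_relabel _ (equiv_injective e)]
  congr 2
  ext v
  cases v <;> rfl

theorem relabel_subst_on {V W U : Type} {P : Set V} {x : Gra V} (hx : SuppOn P x) {g : W → U}
    (hg : Function.Injective g) {S : V → Finset W}
    (hS : ∀ a ∈ P, ∀ b ∈ P, a ≠ b → Disjoint (S a) (S b)) :
    relabel g (subst S x) = subst (fun v => (S v).map ⟨g, hg⟩) x := by
  classical
  refine subst_subst_on hx hS ?_ ?_
  · intro v _ u _ w _ h
    simpa [Function.onFun] using hg.ne h
  · intro v _
    ext
    simp [eq_comm]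

@[simp] theorem mem_ker_inl [Finite F] (i : E) {N : ℕ} (Y : Finset (Fin N)) (a : E)
    (u : ({a : E // a ≠ i} ⊕ F) ⊕ Fin N) :
    u ∈ ker i Y (Sum.inl a) ↔ (a = i ∧ ((∃ b, u = Sum.inl (Sum.inr b)) ∨ ∃ j ∈ Y, u = Sum.inr j)) ∨
      ∃ h : a ≠ i, u = Sum.inl (Sum.inl ⟨a, h⟩) := by
  by_cases h : a = i
  · subst h
    rw [ker_self]
    simp [eq_comm]
  · rw [ker_ne h]
    simp [h]

@[simp] theorem mem_ker_inr [Finite F] (i : E) {N : ℕ} (Y : Finset (Fin N)) (j : Fin N)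
    (u : ({a : E // a ≠ i} ⊕ F) ⊕ Fin N) :
    u ∈ ker i Y (Sum.inr j) ↔ u = Sum.inr j := by
  rw [ker_inr, Finset.mem_singleton]

theorem comp_map {E' F' : Type} [Finite E] [Finite F] [Finite E'] [Finite F'] (σ : E ≃ E')
    (τ : F ≃ F') (i : E) {p q : ℤ} {x : TwSpace E} {y : TwSpace F} (hx : x ∈ deg E p)
    (hy : y ∈ deg F q) :
    comp (σ i) (map σ x) (map τ y) =
      map (Equiv.sumCongr (σ.subtypeEquiv (p := (· ≠ i)) (q := (· ≠ σ i)) (fun a => by simp)) τ)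
        (comp i x y) := by
  refine Inv.ext (deg.inv (comp_mem _ rfl (map_mem σ hx) (map_mem τ hy)))
    (deg.inv (map_mem _ (comp_mem i rfl hx hy))) fun N => ?_
  rw [at_map, at_comp _ (deg.inv hx) (deg.inv hy), at_comp _ (deg.inv (map_mem σ hx)) (deg.inv (map_mem τ hy)), map_sum]
  refine Finset.sum_congr rfl fun A hA => ?_
  rw [term, term, map_mul, at_map, at_map, relabel_relabel _ (equiv_injective _),
    relabel_relabel _ sumInr_injective, subst_relabel _ (equiv_injective _),
    relabel_subst_on (suppOn_at x A) (equiv_injective _) (ker_disjoint i Finset.disjoint_sdiff)]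
  congr 1
  · congr 2
    ext v u
    rcases v with v | v
    · by_cases h : v = i
      · subst h
        rcases u with (u | u) | u <;> simp
        exact ⟨τ.symm u, by simp⟩
      · have h' : ¬ i = v := fun e => h e.symm
        rcases u with (u | u) | u <;> simp [h, h', eq_comm]
    · rcases u with (u | u) | u <;> simp [eq_comm]
  · congr 2
    ext v
    cases v <;> rfl

theorem comp_unit [Finite E] (i : E) {p : ℤ} {x : TwSpace E} (hx : x ∈ deg E p) :
    map (unitEquiv i) (comp i x unit) = x := by
  classical
  refine Inv.ext (deg.inv (map_mem _ (comp_mem i (add_zero p) hx unit_mem))) (deg.inv hx) fun N => ?_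
  rw [at_map, at_comp _ (deg.inv hx) (deg.inv unit_mem), Finset.sum_eq_single Finset.univ]
  · rw [term, at_unit, Finset.sdiff_self, if_pos rfl, map_one, mul_one,
      relabel_subst_on (suppOn_at x _) (equiv_injective _)
        (ker_disjoint i (Finset.disjoint_empty_right _))]
    conv_rhs => rw [← relabel_id (restr x Finset.univ)]
    rw [relabel]
    congr 2
    ext v u
    rcases v with v | v
    · by_cases h : v = i
      · subst h; rcases u with u | u <;> simp [unitEquiv, eq_comm]
      · rcases u with u | u <;> simp [h, unitEquiv, eq_comm]
    · rcases u with u | u <;> simp [eq_comm]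
  · intro A _ hA
    rw [term, at_unit, if_neg, map_zero, mul_zero]
    intro h
    exact hA (Finset.univ_subset_iff.1 (Finset.sdiff_eq_empty_iff_subset.1 h))
  · simp

theorem unit_comp [Finite F] {q : ℤ} {y : TwSpace F} (hy : y ∈ deg F q) :
    map unitEquivLeft (comp () unit y) = y := by
  classical
  refine Inv.ext (deg.inv (map_mem _ (comp_mem () (zero_add q) unit_mem hy))) (deg.inv hy) fun N => ?_
  rw [at_map, at_comp _ (deg.inv unit_mem) (deg.inv hy), Finset.sum_eq_single ∅]
  · rw [term, at_unit, Finset.sdiff_empty, if_pos rfl, map_one, one_mul,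
      relabel_relabel _ sumInr_injective]
    conv_rhs => rw [← relabel_id (restr y Finset.univ)]
    congr 2
    ext v
    cases v <;> rfl
  · intro A _ hA
    rw [term, at_unit, if_neg hA, map_zero, zero_mul]
  · simp

theorem sum_nested {M : Type} [AddCommMonoid M] {N : ℕ} (S : Finset (Fin N))
    (f : Finset (Fin N) → Finset (Fin N) → Finset (Fin N) → M) :
    ∑ A ∈ S.powerset, ∑ A' ∈ A.powerset, f A' (A \ A') (S \ A) =
      ∑ A ∈ S.powerset, ∑ B ∈ (S \ A).powerset, f A B ((S \ A) \ B) := by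
  rw [Finset.sum_sigma', Finset.sum_sigma']
  refine Finset.sum_bij' (fun u _ => ⟨u.2, u.1 \ u.2⟩) (fun u _ => ⟨u.1 ∪ u.2, u.1⟩) ?_ ?_ ?_ ?_ ?_
  · rintro ⟨A, A'⟩ h
    simp only [Finset.mem_sigma, Finset.mem_powerset] at h ⊢
    exact ⟨h.2.trans h.1, Finset.sdiff_subset_sdiff h.1 subset_rfl⟩
  · rintro ⟨A, B⟩ h
    simp only [Finset.mem_sigma, Finset.mem_powerset] at h ⊢
    exact ⟨Finset.union_subset h.1 (h.2.trans Finset.sdiff_subset), Finset.subset_union_left⟩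
  · rintro ⟨A, A'⟩ h
    simp only [Finset.mem_sigma, Finset.mem_powerset] at h
    simp [Finset.union_eq_right.2 h.2]
  · rintro ⟨A, B⟩ h
    simp only [Finset.mem_sigma, Finset.mem_powerset] at h
    have : Disjoint A B := Finset.disjoint_of_subset_right h.2 Finset.disjoint_sdiff
    simp [Finset.union_sdiff_cancel_left this]
  · rintro ⟨A, A'⟩ h
    simp only [Finset.mem_sigma, Finset.mem_powerset] at h
    congr 1
    ext j
    simp only [Finset.mem_sdiff]
    have := @h.2 j
    tauto

theorem sum_nested_swap {M : Type} [AddCommMonoid M] {N : ℕ} (S : Finset (Fin N))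
    (f : Finset (Fin N) → Finset (Fin N) → Finset (Fin N) → M) :
    ∑ A ∈ S.powerset, ∑ A' ∈ A.powerset, f A' (A \ A') (S \ A) =
      ∑ A ∈ S.powerset, ∑ A' ∈ A.powerset, f A' (S \ A) (A \ A') := by
  rw [sum_nested S f, sum_nested S (fun X Y Z => f X Z Y)]
  refine Finset.sum_congr rfl fun A _ => ?_
  refine Finset.sum_bij' (fun B _ => (S \ A) \ B) (fun B _ => (S \ A) \ B) ?_ ?_ ?_ ?_ ?_
  · intro B _; simp
  · intro B _; simp
  · intro B h; simpa using h
  · intro B h; simpa using h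
  · intro B h
    rw [Finset.sdiff_sdiff_eq_self (Finset.mem_powerset.1 h)]

theorem subst_ker_subst_ker {i : E} [Finite E] [Finite F] [Finite G] {j : {a : E // a ≠ i} ⊕ F}
    (x : TwSpace E) {N : ℕ} {A B C : Finset (Fin N)} (hAB : Disjoint A B)
    (hC : Disjoint (A ∪ B) C) {W : Type}
    {g : ({a : {a : E // a ≠ i} ⊕ F // a ≠ j} ⊕ G) ⊕ Fin N → W}
    (hg : Function.Injective g) {R : E ⊕ Fin N → Finset W}
    (hR : ∀ v ∈ verts E A, ∀ u, u ∈ R v ↔ ∃ b ∈ ker i B v, ∃ c ∈ ker j C b, g c = u) :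
    relabel g (subst (ker j C) (subst (ker i B) (restr x A))) = subst R (restr x A) := by
  classical
  have hsub : ∀ v ∈ (verts E A : Set (E ⊕ Fin N)), ∀ u ∈ ker (F := F) i B v,
      u ∈ (verts ({a : E // a ≠ i} ⊕ F) (A ∪ B) : Set (({a : E // a ≠ i} ⊕ F) ⊕ Fin N)) := by
    rintro v hv (u | u) hu
    · simp
    · rcases v with v | v
      · simp at hu ⊢; tauto
      · simp at hu hv ⊢; subst hu; tauto
  have hd := ker_disjoint (F := G) j hC
  have hpd : ∀ v ∈ (verts E A : Set (E ⊕ Fin N)),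
      (ker (F := F) i B v : Set (({a : E // a ≠ i} ⊕ F) ⊕ Fin N)).PairwiseDisjoint
        (ker (F := G) j C) :=
    fun v hv a ha b hb hab => hd a (hsub v hv a ha) b (hsub v hv b hb) hab
  rw [subst_subst_on (suppOn_at x A) (ker_disjoint i hAB) hpd (fun v _ => rfl),
    relabel_subst_on (suppOn_at x A) hg]
  · refine subst_congr_on (suppOn_at x A) fun v hv => ?_
    ext u
    rw [hR v hv]
    simp only [Finset.mem_map, Finset.mem_biUnion, Function.Embedding.coeFn_mk]
    constructor
    · rintro ⟨c, ⟨b, hb, hc⟩, rfl⟩; exact ⟨b, hb, c, hc, rfl⟩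
    · rintro ⟨b, hb, c, hc, rfl⟩; exact ⟨c, ⟨b, hb, hc⟩, rfl⟩
  · intro a ha b hb hab
    rw [Finset.disjoint_left]
    intro u hu hu'
    obtain ⟨c, hc, hcu⟩ : ∃ c ∈ ker i B a, u ∈ ker j C c := by simpa only [Finset.mem_biUnion] using hu
    obtain ⟨d, hd', hdu⟩ : ∃ d ∈ ker i B b, u ∈ ker j C d := by simpa only [Finset.mem_biUnion] using hu'
    have hcd : c ≠ d := by
      rintro rfl
      exact Finset.disjoint_left.1 (ker_disjoint i hAB a ha b hb hab) hc hd'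
    exact Finset.disjoint_left.1 (hd c (hsub a ha c hc) d (hsub b hb d hd') hcd) hcu hdu

theorem ker_seq [Finite F] [Finite G] (i : E) (j : F) {N : ℕ} {B C D : Finset (Fin N)}
    (hcov : ∀ a, a ∈ D ↔ a ∈ B ∨ a ∈ C) (v : E ⊕ Fin N)
    (u : ({a : E // a ≠ i} ⊕ ({b : F // b ≠ j} ⊕ G)) ⊕ Fin N) :
    u ∈ ker i D v ↔ ∃ b ∈ ker i B v, ∃ c ∈ ker (Sum.inr j) C b,
      Sum.map (seqEquiv i j) id c = u := by
  rcases v with v | v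
  · by_cases h : v = i
    · subst h
      simp only [ker_self, Finset.mem_map, Function.Embedding.coeFn_mk]
      constructor
      · rintro ⟨(w | w), hw, rfl⟩
        · rcases w with w | w
          · refine ⟨_, ⟨Sum.inl w.1, by simp, rfl⟩, Sum.inl (Sum.inl ⟨Sum.inr w.1, ?_⟩), ?_, rfl⟩
            · exact fun e => w.2 (Sum.inr_injective e)
            · simpa using w.2
          · exact ⟨_, ⟨Sum.inl j, by simp, rfl⟩, Sum.inl (Sum.inr w), by simp, rfl⟩
        · rw [inr_mem_verts, hcov] at hw
          rcases hw with hw | hw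
          · exact ⟨_, ⟨Sum.inr w, by simpa using hw, rfl⟩, Sum.inr w, by simp, rfl⟩
          · exact ⟨_, ⟨Sum.inl j, by simp, rfl⟩, Sum.inr w, by simpa using hw, rfl⟩
      · rintro ⟨_, ⟨(w | w), hw, rfl⟩, c, hc, rfl⟩
        · by_cases h : w = j
          · subst h
            rcases (mem_ker_inl _ _ _ _).1 hc with ⟨_, ⟨b, rfl⟩ | ⟨b, hb, rfl⟩⟩ | ⟨h, _⟩
            · exact ⟨Sum.inl (Sum.inr b), by simp, rfl⟩
            · exact ⟨Sum.inr b, by simp [hcov, hb], rfl⟩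
            · exact absurd rfl h
          · have h' : (Sum.inr w : {a : E // a ≠ v} ⊕ F) ≠ Sum.inr j := by simpa using h
            have hc' : c ∈ ker (F := G) (E := {a : E // a ≠ v} ⊕ F) (Sum.inr j) C
              (Sum.inl (Sum.inr w)) := hc
            rw [ker_ne h', Finset.mem_singleton] at hc'
            subst hc'
            exact ⟨Sum.inl (Sum.inl ⟨w, h⟩), by simp, rfl⟩
        · have hc' := (mem_ker_inr _ _ _ _).1 hc
          subst hc'
          rw [inr_mem_verts] at hw
          exact ⟨Sum.inr w, by simp [hcov, hw], rfl⟩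
    · rw [ker_ne h, ker_ne h]
      simp only [Finset.mem_singleton, exists_eq_left]
      rw [ker_ne Sum.inl_ne_inr]
      simp only [Finset.mem_singleton, exists_eq_left]
      exact eq_comm
  · rw [ker_inr, ker_inr]
    simp only [Finset.mem_singleton, exists_eq_left]
    rw [ker_inr]
    simp only [Finset.mem_singleton, exists_eq_left]
    exact eq_comm

theorem ker_seq_right [Finite F] [Finite G] (i : E) (j : F) {N : ℕ} (C : Finset (Fin N))
    (v : F ⊕ Fin N) (u : ({a : E // a ≠ i} ⊕ ({b : F // b ≠ j} ⊕ G)) ⊕ Fin N) :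
    (∃ c ∈ ker (F := G) (E := {a : E // a ≠ i} ⊕ F) (Sum.inr j) C (Sum.map Sum.inr id v),
      Sum.map (seqEquiv i j) id c = u) ↔ ∃ c ∈ ker j C v, Sum.map Sum.inr id c = u := by
  rcases v with v | v
  · by_cases h : v = j
    · subst h
      simp only [Sum.map_inl, ker_self, Finset.mem_map, Function.Embedding.coeFn_mk]
      constructor
      · rintro ⟨_, ⟨(w | w), hw, rfl⟩, rfl⟩
        · exact ⟨_, ⟨Sum.inl w, hw, rfl⟩, rfl⟩
        · exact ⟨_, ⟨Sum.inr w, hw, rfl⟩, rfl⟩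
      · rintro ⟨_, ⟨(w | w), hw, rfl⟩, rfl⟩
        · exact ⟨_, ⟨Sum.inl w, hw, rfl⟩, rfl⟩
        · exact ⟨_, ⟨Sum.inr w, hw, rfl⟩, rfl⟩
    · have h' : (Sum.inr v : {a : E // a ≠ i} ⊕ F) ≠ Sum.inr j := by simpa using h
      rw [Sum.map_inl, ker_ne h, ker_ne h']
      simp only [Finset.mem_singleton, exists_eq_left]
      rfl
  · rw [Sum.map_inr, ker_inr, id, ker_inr]
    simp only [Finset.mem_singleton, exists_eq_left]
    rfl

def parG (F : Type) {i j : E} (hij : i ≠ j) (c : G) :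
    {u : {a : E // a ≠ j} ⊕ G // u ≠ Sum.inl ⟨i, hij⟩} ⊕ F := Sum.inl ⟨Sum.inr c, Sum.inr_ne_inl⟩

theorem ker_par [Finite F] [Finite G] {i j : E} (hij : i ≠ j) {N : ℕ} {B C : Finset (Fin N)}
    (v : E ⊕ Fin N) (u : ({u : {a : E // a ≠ j} ⊕ G // u ≠ Sum.inl ⟨i, hij⟩} ⊕ F) ⊕ Fin N) :
    (∃ b ∈ ker j C v, u ∈ ker (E := {a : E // a ≠ j} ⊕ G) (F := F) (Sum.inl ⟨i, hij⟩) B b) ↔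
    ∃ b ∈ ker i B v, ∃ c ∈ ker (E := {a : E // a ≠ i} ⊕ F) (F := G) (Sum.inl ⟨j, hij.symm⟩) C b,
      Sum.map (parEquiv hij) id c = u := by
  rcases v with v | v
  · by_cases h : v = i
    · subst h
      rw [ker_ne hij, ker_self]
      simp only [Finset.mem_singleton, exists_eq_left, ker_self, Finset.mem_map,
        Function.Embedding.coeFn_mk]
      constructor
      · rintro ⟨(w | w), hw, rfl⟩
        · exact ⟨_, ⟨Sum.inl w, hw, rfl⟩, Sum.inl (Sum.inl ⟨Sum.inr w, Sum.inr_ne_inl⟩),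
            by simp, rfl⟩
        · exact ⟨_, ⟨Sum.inr w, hw, rfl⟩, Sum.inr w, by simp, rfl⟩
      · rintro ⟨_, ⟨(w | w), hw, rfl⟩, c, hc, rfl⟩
        · rw [Sum.map_inl, ker_ne Sum.inr_ne_inl, Finset.mem_singleton] at hc
          subst hc
          exact ⟨Sum.inl w, hw, rfl⟩
        · rw [Sum.map_inr, id, ker_inr, Finset.mem_singleton] at hc
          subst hc
          exact ⟨Sum.inr w, hw, rfl⟩
    · by_cases h' : v = j
      · subst h'
        rw [ker_ne h, ker_self]
        simp only [Finset.mem_singleton, exists_eq_left, ker_self, Finset.mem_map,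
          Function.Embedding.coeFn_mk]
        constructor
        · rintro ⟨_, ⟨(w | w), hw, rfl⟩, hc⟩
          · rw [Sum.map_inl, ker_ne Sum.inr_ne_inl, Finset.mem_singleton] at hc
            subst hc
            exact ⟨_, ⟨Sum.inl w, hw, rfl⟩, rfl⟩
          · rw [Sum.map_inr, id, ker_inr, Finset.mem_singleton] at hc
            subst hc
            exact ⟨_, ⟨Sum.inr w, hw, rfl⟩, rfl⟩
        · rintro ⟨_, ⟨(w | w), hw, rfl⟩, rfl⟩
          · refine ⟨_, ⟨Sum.inl w, hw, rfl⟩, ?_⟩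
            rw [Sum.map_inl, ker_ne Sum.inr_ne_inl, Finset.mem_singleton]
            rfl
          · refine ⟨_, ⟨Sum.inr w, hw, rfl⟩, ?_⟩
            rw [Sum.map_inr, id, ker_inr, Finset.mem_singleton]
            rfl
      · rw [ker_ne h, ker_ne h']
        simp only [Finset.mem_singleton, exists_eq_left]
        rw [ker_ne (by simpa using h), ker_ne (by simpa using h')]
        simp only [Finset.mem_singleton, exists_eq_left]
        exact eq_comm
  · rw [ker_inr, ker_inr]
    simp only [Finset.mem_singleton, exists_eq_left]
    rw [ker_inr, ker_inr]
    simp only [Finset.mem_singleton, exists_eq_left]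
    exact eq_comm

theorem comp_assoc [Finite E] [Finite F] [Finite G] (i : E) (j : F) {p q r : ℤ} {x : TwSpace E}
    {y : TwSpace F} {z : TwSpace G} (hx : x ∈ deg E p) (hy : y ∈ deg F q) (hz : z ∈ deg G r) :
    map (seqEquiv i j) (comp (Sum.inr j) (comp i x y) z) = comp i x (comp j y z) := by
  classical
  have hxy := comp_mem i rfl hx hy
  have hyz := comp_mem j rfl hy hz
  refine Inv.ext (deg.inv (map_mem _ (comp_mem _ rfl hxy hz)))
    (deg.inv (comp_mem i rfl hx hyz)) fun N => ?_
  rw [at_map, at_comp _ (deg.inv hxy) (deg.inv hz), at_comp _ (deg.inv hx) (deg.inv hyz), map_sum]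
  obtain ⟨f, hf⟩ : ∃ f : Finset (Fin N) → Finset (Fin N) → Finset (Fin N) → Gra _,
      f = fun X Y Z => relabel (Sum.map (seqEquiv i j) id)
        (subst (ker (Sum.inr j) Z) (term i x y X Y) * relabel (Sum.map Sum.inr id) (restr z Z)) :=
    ⟨_, rfl⟩
  have hL : ∀ A ∈ (Finset.univ : Finset (Fin N)).powerset,
      relabel (Sum.map (seqEquiv i j) id) (term (Sum.inr j) (comp i x y) z A (Finset.univ \ A)) =
      ∑ A' ∈ A.powerset, f A' (A \ A') (Finset.univ \ A) := by
    intro A _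
    rw [hf, term, at_comp _ (deg.inv hx) (deg.inv hy), map_sum, Finset.sum_mul, map_sum]
  refine (Finset.sum_congr rfl hL).trans ((sum_nested _ f).trans ?_)
  rw [hf]
  refine Finset.sum_congr rfl fun A hA => ?_
  rw [term, at_comp _ (deg.inv hy) (deg.inv hz), map_sum, Finset.mul_sum]
  refine Finset.sum_congr rfl fun B hB => ?_
  rw [Finset.mem_powerset] at hB
  have hAB : Disjoint A B := Finset.disjoint_of_subset_right hB Finset.disjoint_sdiff
  have hABC : Disjoint (A ∪ B) ((Finset.univ \ A) \ B) := by
    rw [Finset.disjoint_left]; intro a; simp; tauto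
  have hBC : Disjoint B ((Finset.univ \ A) \ B) := Finset.disjoint_sdiff
  have hcov : ∀ a, a ∈ Finset.univ \ A ↔ a ∈ B ∨ a ∈ (Finset.univ \ A) \ B := by
    intro a
    have := @hB a
    simp at this ⊢
    tauto
  generalize (Finset.univ \ A) \ B = C at *
  generalize Finset.univ \ A = D at *
  simp only [term, map_mul]
  rw [mul_assoc]
  congr 1
  · refine subst_ker_subst_ker x hAB hABC (equiv_injective _) ?_
    exact fun v _ u => ker_seq i j hcov v u
  · congr 1
    · rw [subst_relabel _ sumInr_injective, relabel_subst_on (suppOn_at y B) (equiv_injective _),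
        relabel_subst_on (suppOn_at y B) sumInr_injective (ker_disjoint j hBC)]
      · congr 2
        ext v u
        simp only [Finset.mem_map, Function.Embedding.coeFn_mk]
        exact ker_seq_right i j C v u
      · intro a ha b hb hab
        refine ker_disjoint (A := B) (Sum.inr j) hBC _ ?_ _ ?_ (sumInr_injective.ne hab)
        · rcases a with a | a <;> simpa using ha
        · rcases b with b | b <;> simpa using hb
    · rw [relabel_relabel _ sumInr_injective, relabel_relabel _ sumInr_injective]
      congr 2
      ext v
      rcases v with v | v <;> rfl

theorem comp_par [Finite E] [Finite F] [Finite G] {i j : E} (hij : i ≠ j) {p q r : ℤ}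
    {x : TwSpace E} {y : TwSpace F} {z : TwSpace G} (hx : x ∈ deg E p) (hy : y ∈ deg F q)
    (hz : z ∈ deg G r) :
    map (parEquiv hij) (comp (Sum.inl ⟨j, hij.symm⟩) (comp i x y) z) =
      (-1 : ℝ) ^ (q * r) • comp (Sum.inl ⟨i, hij⟩) (comp j x z) y := by
  classical
  have hxy := comp_mem i rfl hx hy
  have hxz := comp_mem j rfl hx hz
  have hR := comp_mem (Sum.inl ⟨i, hij⟩) rfl hxz hy
  refine Inv.ext (deg.inv (map_mem _ (comp_mem _ rfl hxy hz)))
    (deg.inv (Submodule.smul_mem _ _ hR)) fun N => ?_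
  have hs : restr ((-1 : ℝ) ^ (q * r) • comp (Sum.inl ⟨i, hij⟩) (comp j x z) y)
      (Finset.univ : Finset (Fin N)) =
      (-1 : ℝ) ^ (q * r) • restr (comp (Sum.inl ⟨i, hij⟩) (comp j x z) y) Finset.univ := by
    rw [restr, restr, Pi.smul_apply]
    exact map_smul _ _ _
  rw [hs, at_map, at_comp _ (deg.inv hxy) (deg.inv hz), at_comp _ (deg.inv hxz) (deg.inv hy),
    map_sum, Finset.smul_sum]
  obtain ⟨f, hf⟩ : ∃ f : Finset (Fin N) → Finset (Fin N) → Finset (Fin N) → Gra _,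
      f = fun X Y Z => relabel (Sum.map (parEquiv hij) id)
        (subst (ker (E := {a : E // a ≠ i} ⊕ F) (F := G) (Sum.inl ⟨j, hij.symm⟩) Z) (term i x y X Y) *
          relabel (Sum.map Sum.inr id) (restr z Z)) := ⟨_, rfl⟩
  have hL : ∀ A ∈ (Finset.univ : Finset (Fin N)).powerset,
      relabel (Sum.map (parEquiv hij) id)
        (term (Sum.inl ⟨j, hij.symm⟩) (comp i x y) z A (Finset.univ \ A)) =
      ∑ A' ∈ A.powerset, f A' (A \ A') (Finset.univ \ A) := by
    intro A _
    rw [hf, term, at_comp _ (deg.inv hx) (deg.inv hy), map_sum, Finset.sum_mul, map_sum]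
  refine (Finset.sum_congr rfl hL).trans ((sum_nested_swap _ f).trans ?_)
  rw [hf]
  refine Finset.sum_congr rfl fun A hA => ?_
  rw [term, at_comp _ (deg.inv hx) (deg.inv hz), map_sum, Finset.sum_mul, Finset.smul_sum]
  refine Finset.sum_congr rfl fun X hX => ?_
  rw [Finset.mem_powerset] at hX
  have h1 : Disjoint X (A \ X) := Finset.disjoint_sdiff
  have h2 : Disjoint X (Finset.univ \ A) :=
    Finset.disjoint_of_subset_left hX Finset.disjoint_sdiff
  have h3 : Disjoint (A \ X) (Finset.univ \ A) :=
    Finset.disjoint_of_subset_left Finset.sdiff_subset Finset.disjoint_sdiff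
  generalize A \ X = C at *
  generalize Finset.univ \ A = B at *
  have hsign : relabel (Sum.map Sum.inr id) (restr y B) *
        relabel (Sum.map (parG F hij) id) (restr z C) =
      (-1 : ℝ) ^ (q * r) • (relabel (Sum.map (parG F hij) id)
          (restr z C) * relabel (Sum.map Sum.inr id) (restr y B) :
            Gra (({u : {a : E // a ≠ j} ⊕ G // u ≠ Sum.inl ⟨i, hij⟩} ⊕ F) ⊕ Fin N)) := by
    refine (mul_comm_sign (subst_mem _ (at_mem hy B)) (subst_mem _ (at_mem hz C))).trans ?_
    congr 1
    have : (2 * (B.card : ℤ) - q) * (2 * C.card - r) =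
        2 * (2 * B.card * C.card - B.card * r - q * C.card) + q * r := by ring
    rw [this, zpow_add₀ (by norm_num), Even.neg_one_zpow (by simp), one_mul]
  simp only [term, map_mul]
  have e2 : relabel (Sum.map (parEquiv hij) id) (subst (ker (E := {a : E // a ≠ i} ⊕ F) (F := G) (Sum.inl ⟨j, hij.symm⟩) C)
      (relabel (Sum.map Sum.inr id) (restr y B))) =
      (relabel (Sum.map Sum.inr id) (restr y B) :
        Gra (({u : {a : E // a ≠ j} ⊕ G // u ≠ Sum.inl ⟨i, hij⟩} ⊕ F) ⊕ Fin N)) := by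
    rw [subst_relabel _ sumInr_injective, relabel_subst_on (suppOn_at y B) (equiv_injective _)]
    · rw [relabel]
      congr 2
      ext v : 1
      rcases v with v | v
      · rw [Sum.map_inl, ker_ne Sum.inr_ne_inl, Finset.map_singleton]
        rfl
      · rw [Sum.map_inr, id, ker_inr, Finset.map_singleton]
        rfl
    · intro a ha b hb hab
      refine ker_disjoint (E := {a : E // a ≠ i} ⊕ F) (F := G) (A := B) (Sum.inl ⟨j, hij.symm⟩) h3.symm _ ?_ _ ?_
        (sumInr_injective.ne hab)
      · rcases a with a | a <;> simpa using ha
      · rcases b with b | b <;> simpa using hb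
  have e3 : relabel (Sum.map (parEquiv hij) id) (relabel (Sum.map Sum.inr id) (restr z C)) =
      (relabel (Sum.map (parG F hij) id) (restr z C) :
        Gra (({u : {a : E // a ≠ j} ⊕ G // u ≠ Sum.inl ⟨i, hij⟩} ⊕ F) ⊕ Fin N)) := by
    rw [relabel_relabel _ sumInr_injective]
    congr 2
    ext v
    rcases v with v | v <;> rfl
  have e4 : subst (ker (E := {a : E // a ≠ j} ⊕ G) (F := F) (Sum.inl ⟨i, hij⟩) B) (relabel (Sum.map Sum.inr id) (restr z C)) =
      (relabel (Sum.map (parG F hij) id) (restr z C) :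
        Gra (({u : {a : E // a ≠ j} ⊕ G // u ≠ Sum.inl ⟨i, hij⟩} ⊕ F) ⊕ Fin N)) := by
    rw [subst_relabel _ sumInr_injective, relabel]
    congr 2
    ext v : 1
    rcases v with v | v
    · rw [Sum.map_inl, ker_ne Sum.inr_ne_inl]
      rfl
    · rw [Sum.map_inr, id, ker_inr]
      rfl
  have e1 : relabel (Sum.map (parEquiv hij) id) (subst (ker (E := {a : E // a ≠ i} ⊕ F) (F := G) (Sum.inl ⟨j, hij.symm⟩) C)
      (subst (ker i B) (restr x X))) =
      (subst (ker (E := {a : E // a ≠ j} ⊕ G) (F := F) (Sum.inl ⟨i, hij⟩) B) (subst (ker j C) (restr x X)) :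
        Gra (({u : {a : E // a ≠ j} ⊕ G // u ≠ Sum.inl ⟨i, hij⟩} ⊕ F) ⊕ Fin N)) := by
    rw [← relabel_id (subst (ker (E := {a : E // a ≠ j} ⊕ G) (F := F) (Sum.inl ⟨i, hij⟩) B) (subst (ker j C) (restr x X)))]
    rw [subst_ker_subst_ker x h1 (Finset.disjoint_union_left.2 ⟨h2, h3⟩) Function.injective_id
      (R := fun v => ((ker j C v).biUnion (ker (E := {a : E // a ≠ j} ⊕ G) (F := F) (Sum.inl ⟨i, hij⟩) B)))]
    · refine subst_ker_subst_ker x h2 (Finset.disjoint_union_left.2 ⟨h1, h3.symm⟩)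
        (equiv_injective _) ?_
      intro v _ u
      rw [Finset.mem_biUnion]
      exact ker_par hij v u
    · intro v _ u
      simp
  rw [e1, e2, e3, e4, mul_assoc, hsign, mul_smul_comm, mul_assoc]

theorem diff_map [Finite E] [Finite F] (e : E ≃ F) {p : ℤ} {x : TwSpace E} (hx : x ∈ deg E p) :
    diff p (map e x) = map e (diff p x) := by
  classical
  refine Inv.ext (diff_inv (map_mem e hx)) (deg.inv (map_mem e (diff_mem rfl hx))) fun N => ?_
  rw [at_map, at_diff hx, at_diff (map_mem e hx), dsum, dsum, map_sum]
  refine Finset.sum_congr rfl fun s _ => ?_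
  generalize hS : Finset.univ.erase s = S
  have hs : s ∉ S := by rw [← hS]; simp
  have hv : verts F S = (verts E S).map ⟨_, equiv_injective e⟩ := by
    ext u
    rcases u with u | u
    · simp only [inl_mem_verts, Finset.mem_map, Function.Embedding.coeFn_mk, true_iff]
      exact ⟨Sum.inl (e.symm u), by simp, by simp⟩
    · simp
  rw [hv, Finset.sum_map, map_sum]
  refine Finset.sum_congr rfl fun v _ => ?_
  have hi := equiv_injective e (N := N)
  have hw : wt (Sum.map e id v : F ⊕ Fin N) = wt v := by cases v <;> rfl
  simp only [dterm, map_mul, map_sub, map_smul, relabel_edge hi, Function.Embedding.coeFn_mk,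
    at_map, hw]
  rw [subst_relabel _ hi, relabel_subst_on (suppOn_at x S) hi (spl_disjoint hs v)]
  have hk : (fun a => spl (Sum.map e id v) (Sum.inr s) (Sum.map e id a)) =
      fun a => (spl v (Sum.inr s) a).map ⟨_, hi⟩ := ?_
  · rw [hk]; rfl
  ext a : 1
  by_cases h : a = v
  · subst h
    rw [spl_self, spl_self]
    ext; simp
  · rw [spl_ne h, spl_ne (hi.ne h)]
    simp

theorem sum_swap_erase {M : Type} [AddCommMonoid M] {N : ℕ} (S : Finset (Fin N))
    (f : Fin N → Finset (Fin N) → Finset (Fin N) → M) :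
    ∑ A ∈ S.powerset, ∑ s ∈ A, f s (A.erase s) (S \ A) =
      ∑ s ∈ S, ∑ A ∈ (S.erase s).powerset, f s A (S.erase s \ A) := by
  rw [Finset.sum_sigma', Finset.sum_sigma']
  refine Finset.sum_bij' (fun u _ => ⟨u.2, u.1.erase u.2⟩) (fun u _ => ⟨insert u.1 u.2, u.1⟩)
    ?_ ?_ ?_ ?_ ?_
  · rintro ⟨A, s⟩ h
    simp only [Finset.mem_sigma, Finset.mem_powerset] at h ⊢
    exact ⟨h.1 h.2, Finset.erase_subset_erase s h.1⟩
  · rintro ⟨s, A⟩ h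
    simp only [Finset.mem_sigma, Finset.mem_powerset] at h ⊢
    exact ⟨Finset.insert_subset h.1 (h.2.trans (Finset.erase_subset _ _)),
      Finset.mem_insert_self _ _⟩
  · rintro ⟨A, s⟩ h
    simp only [Finset.mem_sigma] at h
    simp [Finset.insert_erase h.2]
  · rintro ⟨s, A⟩ h
    simp only [Finset.mem_sigma, Finset.mem_powerset] at h
    have : s ∉ A := fun hs => by simpa using h.2 hs
    simp [Finset.erase_insert this]
  · rintro ⟨A, s⟩ h
    simp only [Finset.mem_sigma, Finset.mem_powerset] at h
    congr 1
    ext j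
    simp only [Finset.mem_sdiff, Finset.mem_erase]
    by_cases hj : j = s
    · subst hj; simp [h.2]
    · simp [hj]

theorem sum_swap_erase_right {M : Type} [AddCommMonoid M] {N : ℕ} (S : Finset (Fin N))
    (f : Fin N → Finset (Fin N) → Finset (Fin N) → M) :
    ∑ A ∈ S.powerset, ∑ s ∈ S \ A, f s A ((S \ A).erase s) =
      ∑ s ∈ S, ∑ A ∈ (S.erase s).powerset, f s A (S.erase s \ A) := by
  rw [Finset.sum_sigma', Finset.sum_sigma']
  refine Finset.sum_bij' (fun u _ => ⟨u.2, u.1⟩) (fun u _ => ⟨u.2, u.1⟩) ?_ ?_ ?_ ?_ ?_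
  · rintro ⟨A, s⟩ h
    simp only [Finset.mem_sigma, Finset.mem_powerset, Finset.mem_sdiff] at h ⊢
    exact ⟨h.2.1, fun a ha => Finset.mem_erase.2 ⟨fun e => h.2.2 (e ▸ ha), h.1 ha⟩⟩
  · rintro ⟨s, A⟩ h
    simp only [Finset.mem_sigma, Finset.mem_powerset, Finset.mem_sdiff] at h ⊢
    exact ⟨h.2.trans (Finset.erase_subset _ _), h.1, fun hs => by simpa using h.2 hs⟩
  · rintro ⟨A, s⟩ h; rfl
  · rintro ⟨s, A⟩ h; rfl
  · rintro ⟨A, s⟩ h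
    congr 1
    ext j
    simp only [Finset.mem_sdiff, Finset.mem_erase]
    tauto

theorem sum_anti {M : Type} [AddCommGroup M] [Module ℝ M] {N : ℕ} (S : Finset (Fin N))
    (f : Fin N → Fin N → M) (h : ∀ s ∈ S, ∀ t ∈ S, s ≠ t → f s t = - f t s) :
    ∑ s ∈ S, ∑ t ∈ S.erase s, f s t = 0 := by
  have h1 : ∑ s ∈ S, ∑ t ∈ S.erase s, f s t = ∑ s ∈ S, ∑ t ∈ S.erase s, f t s := by
    rw [Finset.sum_sigma', Finset.sum_sigma']
    refine Finset.sum_bij' (fun u _ => ⟨u.2, u.1⟩) (fun u _ => ⟨u.2, u.1⟩) ?_ ?_ ?_ ?_ ?_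
    · rintro ⟨A, s⟩ h
      simp only [Finset.mem_sigma, Finset.mem_erase] at h ⊢
      exact ⟨h.2.2, h.2.1.symm, h.1⟩
    · rintro ⟨A, s⟩ h
      simp only [Finset.mem_sigma, Finset.mem_erase] at h ⊢
      exact ⟨h.2.2, h.2.1.symm, h.1⟩
    · rintro ⟨A, s⟩ h; rfl
    · rintro ⟨A, s⟩ h; rfl
    · rintro ⟨A, s⟩ h; rfl
  have h2 : ∑ s ∈ S, ∑ t ∈ S.erase s, f s t = - ∑ s ∈ S, ∑ t ∈ S.erase s, f t s := by
    rw [← Finset.sum_neg_distrib]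
    refine Finset.sum_congr rfl fun s hs => ?_
    rw [← Finset.sum_neg_distrib]
    refine Finset.sum_congr rfl fun t ht => ?_
    rw [Finset.mem_erase] at ht
    exact h s hs t ht.2 ht.1.symm
  rw [← h1] at h2
  have h3 : (2 : ℝ) • (∑ s ∈ S, ∑ t ∈ S.erase s, f s t) = 0 := by
    rw [two_smul]
    nth_rewrite 1 [h2]
    simp
  exact (smul_eq_zero.1 h3).resolve_left (by norm_num)

theorem verts_eq_biUnion [Finite E] [Finite F] (i : E) {N : ℕ} {A B : Finset (Fin N)}
    (h : Disjoint A B) {M : Type} [AddCommMonoid M]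
    (f : ({a : E // a ≠ i} ⊕ F) ⊕ Fin N → M) :
    ∑ u ∈ verts _ (A ∪ B), f u = ∑ v ∈ verts E A, ∑ u ∈ ker i B v, f u := by
  classical
  rw [← Finset.sum_biUnion (fun a ha b hb hab => ker_disjoint i h a ha b hb hab)]
  refine Finset.sum_congr ?_ fun _ _ => rfl
  ext u
  rcases u with (u | u) | u
  · simp only [inl_mem_verts, Finset.mem_biUnion, true_iff]
    exact ⟨Sum.inl u.1, by simp, by simp [u.2]⟩
  · simp only [inl_mem_verts, Finset.mem_biUnion, true_iff]
    exact ⟨Sum.inl i, by simp, by simp⟩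
  · simp only [inr_mem_verts, Finset.mem_union, Finset.mem_biUnion]
    constructor
    · rintro (hu | hu)
      · exact ⟨Sum.inr u, by simpa using hu, by simp⟩
      · exact ⟨Sum.inl i, by simp, by simpa using hu⟩
    · rintro ⟨v | v, hv, hu⟩
      · right
        have := (mem_ker_inl _ _ _ _).1 hu
        simp at this
        exact this.2
      · left
        have := (mem_ker_inr _ _ _ _).1 hu
        simp at this hv
        rwa [this]

theorem ker_subset [Finite E] [Finite F] (i : E) {N : ℕ} {A B : Finset (Fin N)}
    {v : E ⊕ Fin N} (hv : v ∈ verts E A) {u : ({a : E // a ≠ i} ⊕ F) ⊕ Fin N}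
    (hu : u ∈ ker i B v) : u ∈ verts ({a : E // a ≠ i} ⊕ F) (A ∪ B) := by
  rcases u with u | u
  · simp
  · rcases v with v | v
    · simp at hu ⊢; tauto
    · simp at hu hv ⊢; subst hu; tauto

theorem subst_spl_ker [Finite E] [Finite F] (i : E) (x : TwSpace E) {N : ℕ}
    {A B : Finset (Fin N)} (h : Disjoint A B) {s : Fin N} (hA : s ∉ A) (hB : s ∉ B)
    (u : ({a : E // a ≠ i} ⊕ F) ⊕ Fin N)
    {R : E ⊕ Fin N → Finset (({a : E // a ≠ i} ⊕ F) ⊕ Fin N)}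
    (hR : ∀ v ∈ verts E A, ∀ c, c ∈ R v ↔ ∃ b ∈ ker i B v, c ∈ spl u (Sum.inr s) b) :
    subst (spl u (Sum.inr s)) (subst (ker i B) (restr x A)) = subst R (restr x A) := by
  classical
  refine subst_subst_on (suppOn_at x A) (ker_disjoint i h) ?_ ?_
  · intro v hv a ha b hb hab
    exact spl_disjoint (S := A ∪ B) (by simp [hA, hB]) u a (ker_subset i hv ha) b
      (ker_subset i hv hb) hab
  · intro v hv
    ext c
    rw [hR v hv]
    simp only [Finset.mem_biUnion]

theorem subst_ker_spl [Finite E] [Finite F] (i : E) (x : TwSpace E) {N : ℕ}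
    {A B : Finset (Fin N)} (h : Disjoint A B) {s : Fin N} (hA : s ∉ A) (hB : s ∉ B)
    (w : E ⊕ Fin N) (hw : w ∈ verts E A)
    {R : E ⊕ Fin N → Finset (({a : E // a ≠ i} ⊕ F) ⊕ Fin N)}
    (hR : ∀ v ∈ verts E A, ∀ c, c ∈ R v ↔ ∃ b ∈ spl w (Sum.inr s) v, c ∈ ker i B b) :
    subst (ker i B) (subst (spl w (Sum.inr s)) (restr x A)) = subst R (restr x A) := by
  classical
  have hsub : ∀ v ∈ verts E A, ∀ a ∈ spl w (Sum.inr s) v, a ∈ verts E (insert s A) := by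
    intro v hv a ha
    have hm : ∀ c ∈ verts E A, c ∈ verts E (insert s A) := by
      rintro (c | c) hc
      · simp
      · simp at hc ⊢; exact Or.inr hc
    by_cases e : v = w
    · subst e
      rw [spl_self] at ha
      simp only [Finset.mem_insert, Finset.mem_singleton] at ha
      rcases ha with rfl | rfl
      · exact hm _ hv
      · simp
    · rw [spl_ne e, Finset.mem_singleton] at ha
      subst ha
      exact hm _ hv
  have hd : Disjoint (insert s A) B := by
    rw [Finset.disjoint_insert_left]; exact ⟨hB, h⟩
  refine subst_subst_on (suppOn_at x A) (spl_disjoint hA w) ?_ ?_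
  · intro v hv a ha b hb hab
    exact ker_disjoint i hd a (hsub v hv a ha) b (hsub v hv b hb) hab
  · intro v hv
    ext c
    rw [hR v hv]
    simp only [Finset.mem_biUnion]

theorem mem_spl {v s u c : U} : c ∈ spl v s u ↔ c = u ∨ (u = v ∧ c = s) := by
  by_cases h : u = v
  · subst h
    rw [spl_self]; simp
  · rw [spl_ne h]; simp [h]

/-- vertexwise Leibniz rule -/
theorem leibniz_term [Finite E] [Finite F] (i : E) {p : ℤ} {x : TwSpace E} {y : TwSpace F}
    (hx : x ∈ deg E p) {N : ℕ} {A B : Finset (Fin N)} (h : Disjoint A B) {s : Fin N}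
    (hA : s ∉ A) (hB : s ∉ B) :
    ∑ u ∈ verts _ (A ∪ B), edge s(Sum.inr s, u) *
        (term i x y A B - wt u • subst (spl u (Sum.inr s)) (term i x y A B)) =
      subst (ker i B) (∑ v ∈ verts E A, dterm x A s v) * relabel (Sum.map Sum.inr id) (restr y B) +
      (-1 : ℝ) ^ p • (subst (ker i (insert s B)) (restr x A) *
        relabel (Sum.map Sum.inr id) (∑ w ∈ verts F B, dterm y B s w)) := by
  classical
  have hedge : ∀ v ∈ verts E A, subst (ker (F := F) i B) (edge s(Sum.inr s, v)) =
      ∑ u ∈ ker i B v, edge s(Sum.inr s, u) := by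
    intro v hv
    rw [subst_edge _ (verts_ne hA hv).symm, ker_inr, Finset.sum_singleton]
  obtain ⟨Y, hY⟩ : ∃ Y, relabel (Sum.map (Sum.inr : F → {a : E // a ≠ i} ⊕ F) id) (restr y B) = Y :=
    ⟨_, rfl⟩
  obtain ⟨X, hX⟩ : ∃ X, subst (ker (F := F) i B) (restr x A) = X := ⟨_, rfl⟩
  obtain ⟨X', hX'⟩ : ∃ X, subst (ker (F := F) i (insert s B)) (restr x A) = X := ⟨_, rfl⟩
  have hXs : X' ∈ homog _ (2 * A.card - p) := hX' ▸ subst_mem _ (at_mem hx A)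
  have hc : ∀ w ∈ verts F B, subst (spl (Sum.map Sum.inr id w) (Sum.inr s)) X = X' := by
    intro w hw
    rw [← hX, ← hX']
    refine subst_spl_ker i x h hA hB _ ?_
    rintro (v | v) hv c
    · by_cases e : v = i
      · subst e
        simp only [ker_self, Finset.mem_map, Function.Embedding.coeFn_mk, mem_spl]
        constructor
        · rintro ⟨(d | d), hd, rfl⟩
          · exact ⟨_, ⟨Sum.inl d, by simp, rfl⟩, Or.inl rfl⟩
          · simp only [inr_mem_verts, Finset.mem_insert] at hd
            rcases hd with rfl | hd
            · exact ⟨_, ⟨w, hw, rfl⟩, Or.inr ⟨rfl, rfl⟩⟩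
            · exact ⟨_, ⟨Sum.inr d, by simpa using hd, rfl⟩, Or.inl rfl⟩
        · rintro ⟨_, ⟨d, hd, rfl⟩, rfl | ⟨_, rfl⟩⟩
          · refine ⟨d, ?_, rfl⟩
            rcases d with d | d
            · simp
            · simp at hd ⊢; exact Or.inr hd
          · exact ⟨Sum.inr s, by simp, rfl⟩
      · rw [ker_ne e, ker_ne e]
        simp only [Finset.mem_singleton, exists_eq_left, mem_spl]
        rcases w with w | w <;> simp
    · rw [ker_inr, ker_inr]
      simp only [Finset.mem_singleton, exists_eq_left, mem_spl]
      rcases w with w | w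
      · simp
      · have : v ≠ w := by
          rintro rfl
          simp at hv hw
          exact Finset.disjoint_left.1 h hv hw
        simp [this]
  have hd : ∀ w ∈ verts F B, subst (spl (Sum.map Sum.inr id w) (Sum.inr s)) Y =
      relabel (Sum.map Sum.inr id) (subst (spl w (Sum.inr s)) (restr y B)) := by
    intro w hw
    rw [← hY, subst_relabel _ sumInr_injective,
      relabel_subst_on (suppOn_at y B) sumInr_injective (spl_disjoint hB w)]
    congr 2
    ext v c
    simp only [Finset.mem_map, Function.Embedding.coeFn_mk, mem_spl]
    constructor
    · rintro (rfl | ⟨e, rfl⟩)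
      · exact ⟨v, Or.inl rfl, rfl⟩
      · exact ⟨Sum.inr s, Or.inr ⟨sumInr_injective e, rfl⟩, rfl⟩
    · rintro ⟨_, (rfl | ⟨rfl, rfl⟩), rfl⟩
      · exact Or.inl rfl
      · exact Or.inr ⟨rfl, rfl⟩
  have he : subst (ker (F := F) i B) (subst (spl (Sum.inl i) (Sum.inr s)) (restr x A)) = X' := by
    rw [← hX']
    refine subst_ker_spl i x h hA hB _ (by simp) ?_
    rintro (v | v) hv c
    · by_cases e : v = i
      · subst e
        simp only [mem_spl]
        rcases c with (c | c) | c <;> simp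
        tauto
      · rw [ker_ne e, spl_ne (by simpa using e)]
        simp only [Finset.mem_singleton, exists_eq_left, ker_ne e]
    · rw [ker_inr, spl_ne (by simp)]
      simp only [Finset.mem_singleton, exists_eq_left, ker_inr]
  have ho : ∀ v ∈ verts E A, v ≠ Sum.inl i → ∃ u, ker (F := F) i B v = {u} ∧ wt u = wt v ∧
      subst (spl u (Sum.inr s)) X =
        subst (ker (F := F) i B) (subst (spl v (Sum.inr s)) (restr x A)) ∧
      subst (spl u (Sum.inr s)) Y = Y := by
    intro v hv hvi
    obtain ⟨u, hu, hwu⟩ : ∃ u, ker (F := F) i B v = {u} ∧ wt u = wt v := by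
      rcases v with v | v
      · exact ⟨_, ker_ne (fun e => hvi (by rw [e])) B, rfl⟩
      · exact ⟨_, ker_inr i B v, rfl⟩
    have hne : ∀ a ∈ verts E A, a ≠ v → u ∉ ker (F := F) i B a := by
      intro a ha hav hua
      have := ker_disjoint (F := F) i h a ha v hv hav
      rw [hu, Finset.disjoint_singleton_right] at this
      exact this hua
    refine ⟨u, hu, hwu, ?_, ?_⟩
    · rw [← hX, subst_spl_ker i x h hA hB u (R := fun a => (ker i B a).biUnion (spl u (Sum.inr s)))
        (by intro v _ c; simp)]
      symm
      refine subst_ker_spl i x h hA hB v hv ?_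
      intro a ha c
      simp only [Finset.mem_biUnion]
      by_cases e : a = v
      · subst e
        rw [hu]
        simp only [mem_spl, Finset.mem_singleton, exists_eq_left]
        constructor
        · rintro (rfl | ⟨_, rfl⟩)
          · exact ⟨a, Or.inl rfl, by rw [hu]; simp⟩
          · exact ⟨Sum.inr s, Or.inr ⟨trivial, rfl⟩, by rw [ker_inr]; simp⟩
        · rintro ⟨b, rfl | ⟨_, rfl⟩, hc⟩
          · rw [hu, Finset.mem_singleton] at hc
            exact Or.inl hc
          · rw [ker_inr, Finset.mem_singleton] at hc
            exact Or.inr ⟨trivial, hc⟩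
      · rw [spl_ne e]
        simp only [Finset.mem_singleton, exists_eq_left]
        constructor
        · rintro ⟨b, hb, hcb⟩
          rw [spl_ne (fun e' : b = u => hne a ha e (by rw [← e']; exact hb)), Finset.mem_singleton] at hcb
          exact hcb ▸ hb
        · intro hc
          exact ⟨c, hc, mem_spl.2 (Or.inl rfl)⟩
    · rw [← hY, subst_relabel _ sumInr_injective, relabel]
      refine subst_congr_on (suppOn_at y B) fun w hw => spl_ne ?_
      intro e
      refine hne (Sum.inl i) (by simp) hvi.symm ?_
      rw [ker_self, ← e]
      exact Finset.mem_map.2 ⟨w, hw, rfl⟩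
  rw [verts_eq_biUnion i h, map_sum, Finset.sum_mul,
    ← Finset.add_sum_erase _ _ (inl_mem_verts A i), ← Finset.add_sum_erase _ _ (inl_mem_verts A i)]
  have hrest : ∀ v ∈ (verts E A).erase (Sum.inl i),
      ∑ u ∈ ker i B v, edge s(Sum.inr s, u) *
        (term i x y A B - wt u • subst (spl u (Sum.inr s)) (term i x y A B)) =
      subst (ker i B) (dterm x A s v) * relabel (Sum.map Sum.inr id) (restr y B) := by
    intro v hv
    rw [Finset.mem_erase] at hv
    obtain ⟨u, hu, hwu, h1, h2⟩ := ho v hv.2 hv.1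
    rw [dterm, map_mul, hedge v hv.2, hu, Finset.sum_singleton, Finset.sum_singleton, map_sub,
      map_smul, ← h1, term, map_mul, hX, hY, h2, hwu, mul_assoc, sub_mul, smul_mul_assoc]
  rw [Finset.sum_congr rfl hrest, add_right_comm]
  congr 1
  rw [dterm, map_mul, hedge _ (inl_mem_verts A i), map_sub, map_smul, he, hX, hX', ker_self,
    Finset.sum_map, Finset.sum_map, Finset.sum_mul, Finset.sum_mul, map_sum, Finset.mul_sum,
    Finset.smul_sum, ← Finset.sum_add_distrib]
  refine Finset.sum_congr rfl fun w hw => ?_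
  simp only [Function.Embedding.coeFn_mk]
  rw [term, map_mul, hX, hY, hc w hw, hd w hw, dterm, map_mul, relabel_edge sumInr_injective,
    map_sub, map_smul, hY, ← mul_assoc X', mul_edge hXs]
  have hsg : (-1 : ℝ) ^ p * (-1 : ℝ) ^ (2 * (A.card : ℤ) - p) = 1 := by
    rw [← zpow_add₀ (by norm_num)]
    exact Even.neg_one_zpow (by simp)
  rw [smul_mul_assoc, smul_smul, hsg, one_smul]
  have hw1 : wt (Sum.map Sum.inr id w : ({a : E // a ≠ i} ⊕ F) ⊕ Fin N) = wt w := by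
    cases w <;> rfl
  have hw2 : wt (Sum.inl i : E ⊕ Fin N) = 1 := rfl
  have hl : (s((Sum.inr s : F ⊕ Fin N), w)).map (Sum.map (Sum.inr : F → {a : E // a ≠ i} ⊕ F) id) =
    s(Sum.inr s, Sum.map Sum.inr id w) := rfl
  rw [hw1, hw2, hl, one_smul]
  simp only [mul_sub, sub_mul, mul_smul_comm, mul_assoc]
  abel

theorem leibniz [Finite E] [Finite F] (i : E) {p q r : ℤ} (hr : p + q = r) {x : TwSpace E}
    {y : TwSpace F} (hx : x ∈ deg E p) (hy : y ∈ deg F q) :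
    diff r (comp i x y) = comp i (diff p x) y + (-1 : ℝ) ^ p • comp i x (diff q y) := by
  classical
  have hxy := comp_mem i hr hx hy
  have hdx := diff_mem rfl hx
  have hdy := diff_mem rfl hy
  have h1 := comp_mem i (r := r + 1) (by rw [← hr]; ring) hdx hy
  have h2 := comp_mem i (r := r + 1) (by rw [← hr]; ring) hx hdy
  refine Inv.ext (diff_inv hxy) (deg.inv (add_mem h1 (Submodule.smul_mem _ _ h2))) fun N => ?_
  have hs : restr (comp i (diff p x) y + (-1 : ℝ) ^ p • comp i x (diff q y))
      (Finset.univ : Finset (Fin N)) = restr (comp i (diff p x) y) Finset.univ +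
      (-1 : ℝ) ^ p • restr (comp i x (diff q y)) Finset.univ := by
    rw [restr, Pi.add_apply, Pi.smul_apply, map_add, map_smul]
    rfl
  rw [hs, at_diff hxy, at_comp _ (deg.inv hdx) (deg.inv hy), at_comp _ (deg.inv hx) (deg.inv hdy)]
  generalize (Finset.univ : Finset (Fin N)) = S
  obtain ⟨f1, hf1⟩ : ∃ f : Fin N → Finset (Fin N) → Finset (Fin N) → Gra _,
      f = fun s A B => subst (ker i B) (∑ v ∈ verts E A, dterm x A s v) *
        relabel (Sum.map Sum.inr id) (restr y B) := ⟨_, rfl⟩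
  obtain ⟨f2, hf2⟩ : ∃ f : Fin N → Finset (Fin N) → Finset (Fin N) → Gra _,
      f = fun s A B => subst (ker i (insert s B)) (restr x A) *
        relabel (Sum.map Sum.inr id) (∑ w ∈ verts F B, dterm y B s w) := ⟨_, rfl⟩
  have e1 : ∀ A ∈ S.powerset, term i (diff p x) y A (S \ A) =
      ∑ s ∈ A, f1 s (A.erase s) (S \ A) := by
    intro A _
    rw [term, at_diff hx, dsum, map_sum, Finset.sum_mul, hf1]
  have e2 : ∀ A ∈ S.powerset, term i x (diff q y) A (S \ A) =
      ∑ s ∈ S \ A, f2 s A ((S \ A).erase s) := by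
    intro A _
    rw [term, at_diff hy, dsum, map_sum, Finset.mul_sum, hf2]
    refine Finset.sum_congr rfl fun s hs => ?_
    simp only [Finset.insert_erase hs]
  rw [Finset.sum_congr rfl e1, Finset.sum_congr rfl e2, sum_swap_erase S f1, sum_swap_erase_right S f2,
    dsum, Finset.smul_sum, ← Finset.sum_add_distrib]
  refine Finset.sum_congr rfl fun s hs => ?_
  rw [Finset.smul_sum, ← Finset.sum_add_distrib]
  simp only [dterm, at_comp i (deg.inv hx) (deg.inv hy), map_sum, Finset.smul_sum,
    ← Finset.sum_sub_distrib, Finset.mul_sum]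
  rw [Finset.sum_comm]
  refine Finset.sum_congr rfl fun A hA => ?_
  rw [Finset.mem_powerset] at hA
  have hu : S.erase s = A ∪ (S.erase s \ A) := (Finset.union_sdiff_of_subset hA).symm
  have hd : Disjoint A (S.erase s \ A) := Finset.disjoint_sdiff
  have hsA : s ∉ A := fun h => by simpa using hA h
  have hsB : s ∉ S.erase s \ A := by simp
  rw [hf1, hf2]
  generalize S.erase s \ A = B at *
  rw [hu]
  exact leibniz_term i hx hd hsA hsB

theorem edge_inr_ne {N : ℕ} {s t : Fin N} (h : s ≠ t) :
    (Sum.inr s : E ⊕ Fin N) ≠ Sum.inr t := fun e => h (Sum.inr_injective e)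

open Classical in
theorem subst_spl_edge {V : Type} {v s a b : V} (hab : a ≠ b) (ha : a ≠ v) (hvs : v ≠ s) :
    subst (spl v s) (edge s(a, b)) = edge s(a, b) + if b = v then edge s(a, s) else 0 := by
  rw [subst_edge _ hab, spl_ne ha, Finset.sum_singleton]
  by_cases h : b = v
  · subst h
    rw [spl_self, Finset.sum_pair hvs, if_pos rfl]
  · rw [spl_ne h, Finset.sum_singleton, if_neg h, add_zero]

/-- the vertex w replaced by w, s, t -/
def spl2 {V : Type} [DecidableEq V] (v s w t u : V) : Finset V :=
  {u} ∪ (if u = v then {s} else ∅) ∪ (if u = w then {t} else ∅)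

open Classical in
theorem spl_spl [Finite E] (x : TwSpace E) {N : ℕ} {S : Finset (Fin N)} {s t : Fin N}
    (hs : s ∉ S) (ht : t ∉ S) (hst : s ≠ t) {v w : E ⊕ Fin N} (hv : v ∈ verts E S)
    (hw : w ∈ verts E S) :
    subst (spl v (Sum.inr s)) (subst (spl w (Sum.inr t)) (restr x S)) =
      subst (spl2 v (Sum.inr s) w (Sum.inr t)) (restr x S) := by
  have hsub : ∀ a ∈ verts E S, ∀ b ∈ spl w (Sum.inr t) a, b ∈ verts E (insert t S) := by
    intro a ha b hb
    rw [mem_spl] at hb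
    rcases hb with rfl | ⟨_, rfl⟩
    · rcases b with b | b
      · simp
      · simp at ha ⊢; exact Or.inr ha
    · simp
  have hst' : s ∉ insert t S := by simp [hst, hs]
  have htv : (Sum.inr t : E ⊕ Fin N) ≠ v := (verts_ne ht hv).symm
  refine subst_subst_on (suppOn_at x S) (spl_disjoint ht w) ?_ ?_
  · intro u hu a ha b hb hab
    exact spl_disjoint hst' v a (hsub u hu a ha) b (hsub u hu b hb) hab
  · intro u hu
    ext c
    simp only [Finset.mem_biUnion, mem_spl, spl2, Finset.mem_union, Finset.mem_singleton]
    constructor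
    · rintro ⟨b, rfl | ⟨rfl, rfl⟩, rfl | ⟨rfl, rfl⟩⟩
      · simp
      · simp
      · simp
      · exact absurd rfl htv
    · rintro ((rfl | h) | h)
      · exact ⟨c, Or.inl rfl, Or.inl rfl⟩
      · by_cases e : u = v
        · rw [if_pos e, Finset.mem_singleton] at h
          exact ⟨u, Or.inl rfl, Or.inr ⟨e, h⟩⟩
        · simp [e] at h
      · by_cases e : u = w
        · rw [if_pos e, Finset.mem_singleton] at h
          exact ⟨Sum.inr t, Or.inr ⟨e, rfl⟩, Or.inl h⟩
        · simp [e] at h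

open Classical in
theorem spl_spl_new [Finite E] (x : TwSpace E) {N : ℕ} {S : Finset (Fin N)} {s t : Fin N}
    (hs : s ∉ S) (ht : t ∉ S) (hst : s ≠ t) {w : E ⊕ Fin N} (hw : w ∈ verts E S) :
    subst (spl (Sum.inr t) (Sum.inr s)) (subst (spl w (Sum.inr t)) (restr x S)) =
      subst (spl2 w (Sum.inr s) w (Sum.inr t)) (restr x S) := by
  have hsub : ∀ a ∈ verts E S, ∀ b ∈ spl w (Sum.inr t) a, b ∈ verts E (insert t S) := by
    intro a ha b hb
    rw [mem_spl] at hb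
    rcases hb with rfl | ⟨_, rfl⟩
    · rcases b with b | b
      · simp
      · simp at ha ⊢; exact Or.inr ha
    · simp
  have hst' : s ∉ insert t S := by simp [hst, hs]
  refine subst_subst_on (suppOn_at x S) (spl_disjoint ht w) ?_ ?_
  · intro u hu a ha b hb hab
    exact spl_disjoint hst' _ a (hsub u hu a ha) b (hsub u hu b hb) hab
  · intro u hu
    have hut : u ≠ Sum.inr t := verts_ne ht hu
    ext c
    simp only [Finset.mem_biUnion, mem_spl, spl2, Finset.mem_union, Finset.mem_singleton]
    constructor
    · rintro ⟨b, rfl | ⟨rfl, rfl⟩, rfl | ⟨h, rfl⟩⟩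
      · simp
      · exact absurd h hut
      · simp
      · simp
    · rintro ((rfl | h) | h)
      · exact ⟨c, Or.inl rfl, Or.inl rfl⟩
      · by_cases e : u = w
        · rw [if_pos e, Finset.mem_singleton] at h
          exact ⟨Sum.inr t, Or.inr ⟨e, rfl⟩, Or.inr ⟨rfl, h⟩⟩
        · simp [e] at h
      · by_cases e : u = w
        · rw [if_pos e, Finset.mem_singleton] at h
          exact ⟨Sum.inr t, Or.inr ⟨e, rfl⟩, Or.inl h⟩
        · simp [e] at h

theorem spl_at [Finite E] (x : TwSpace E) {N : ℕ} {S : Finset (Fin N)} {s t : Fin N}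
    (ht : t ∉ S) : subst (spl (Sum.inr t) (Sum.inr s)) (restr x S) = restr x S := by
  conv_rhs => rw [← relabel_id (restr x S), relabel]
  exact subst_congr_on (suppOn_at x S) fun v hv => spl_ne (verts_ne ht hv)

theorem sum_spl_self {V M : Type} [AddCommMonoid M] {v s : V} (h : v ≠ s) (f : V → M) :
    ∑ a ∈ spl v s v, f a = f v + f s := by
  classical
  have : spl v s v = {v, s} := by
    ext c; simp [mem_spl]
  rw [this, Finset.sum_pair h]

theorem spl2_comm {V : Type} [DecidableEq V] (v s w t : V) : spl2 v s w t = spl2 w t v s := by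
  funext u
  rw [spl2, spl2, Finset.union_right_comm]

open Classical in
def sqG (x : TwSpace E) {N : ℕ} (S : Finset (Fin N)) (s t : Fin N) (v w : E ⊕ Fin N) :
    Gra (E ⊕ Fin N) :=
  edge s(Sum.inr s, v) * (edge s(Sum.inr t, w) * (restr x S
    - wt w • subst (spl w (Sum.inr t)) (restr x S) - wt v • subst (spl v (Sum.inr s)) (restr x S)
    + (wt v * wt w) • subst (spl2 v (Sum.inr s) w (Sum.inr t)) (restr x S)))

open Classical in
def sqJ (x : TwSpace E) {N : ℕ} (S : Finset (Fin N)) (s t : Fin N) (w : E ⊕ Fin N) :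
    Gra (E ⊕ Fin N) :=
  edge s(Sum.inr s, Sum.inr t) * (edge s(Sum.inr t, w) * ((1 / 2 : ℝ) • restr x S
    - wt w • subst (spl w (Sum.inr t)) (restr x S)
    + (1 / 2 * wt w) • subst (spl2 w (Sum.inr s) w (Sum.inr t)) (restr x S)))

open Classical in
def sqP (x : TwSpace E) {N : ℕ} (S : Finset (Fin N)) (s t : Fin N) (w : E ⊕ Fin N) :
    Gra (E ⊕ Fin N) :=
  (wt w - wt w ^ 2) • (edge s(Sum.inr s, Sum.inr t) * (edge s(Sum.inr s, w) *
    subst (spl2 w (Sum.inr s) w (Sum.inr t)) (restr x S)))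

theorem edge_swap_mul {V : Type} (e f : Sym2 V) (z : Gra V) :
    edge e * (edge f * z) = - (edge f * (edge e * z)) := by
  rw [← mul_assoc, edge_mul_edge, neg_mul, mul_assoc]

theorem sqG_anti (x : TwSpace E) {N : ℕ} (S : Finset (Fin N)) (s t : Fin N) (v w : E ⊕ Fin N) :
    sqG x S s t v w = - sqG x S t s w v := by
  classical
  rw [sqG, sqG, edge_swap_mul, spl2_comm, mul_comm (wt v)]
  congr 4
  abel

open Classical in
theorem pair_outer [Finite E] (x : TwSpace E) {N : ℕ} {S : Finset (Fin N)} {s t : Fin N}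
    (hs : s ∉ S) (ht : t ∉ S) (hst : s ≠ t) {v w : E ⊕ Fin N} (hv : v ∈ verts E S)
    (hw : w ∈ verts E S) :
    edge s(Sum.inr s, v) *
        (dterm x S t w - wt v • subst (spl v (Sum.inr s)) (dterm x S t w)) =
      sqG x S s t v w + if w = v then - (wt w • (edge s(Sum.inr s, w) *
        (edge s(Sum.inr t, Sum.inr s) * (subst (spl w (Sum.inr s)) (restr x S)
          - wt w • subst (spl2 w (Sum.inr s) w (Sum.inr t)) (restr x S))))) else 0 := by
  rw [dterm, map_mul, subst_spl_edge (verts_ne ht hw).symm (verts_ne ht hv).symm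
    (verts_ne hs hv), map_sub, map_smul, spl_spl x hs ht hst hv hw, sqG]
  by_cases h : w = v
  · subst h
    rw [if_pos rfl, if_pos rfl]
    simp only [mul_sub, mul_add, add_mul, mul_smul_comm, smul_sub, smul_add, smul_smul, neg_sub]
    abel
  · rw [if_neg h, if_neg h]
    simp only [mul_sub, mul_add, add_mul, mul_smul_comm, smul_sub, smul_smul, add_zero]
    abel

open Classical in
theorem pair_inner [Finite E] (x : TwSpace E) {N : ℕ} {S : Finset (Fin N)} {s t : Fin N}
    (hs : s ∉ S) (ht : t ∉ S) (hst : s ≠ t) {w : E ⊕ Fin N} (hw : w ∈ verts E S) :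
    edge s(Sum.inr s, Sum.inr t) *
        (dterm x S t w - wt (Sum.inr t : E ⊕ Fin N) •
          subst (spl (Sum.inr t) (Sum.inr s)) (dterm x S t w))
      - (wt w • (edge s(Sum.inr s, w) *
        (edge s(Sum.inr t, Sum.inr s) * (subst (spl w (Sum.inr s)) (restr x S)
          - wt w • subst (spl2 w (Sum.inr s) w (Sum.inr t)) (restr x S))))) =
      sqJ x S s t w - sqJ x S t s w + sqP x S s t w := by
  have hts : (Sum.inr t : E ⊕ Fin N) ≠ Sum.inr s := fun e => hst (Sum.inr_injective e).symm
  have h1 : subst (spl (Sum.inr t) (Sum.inr s)) (edge s((Sum.inr t : E ⊕ Fin N), w)) =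
      edge s(Sum.inr t, w) + edge s(Sum.inr s, w) := by
    rw [subst_edge _ (verts_ne ht hw).symm, sum_spl_self hts,
      spl_ne (verts_ne ht hw), Finset.sum_singleton, Finset.sum_singleton]
  have hwt : wt (Sum.inr t : E ⊕ Fin N) = 1 / 2 := rfl
  rw [dterm, map_mul, h1, map_sub, map_smul, spl_at x ht, spl_spl_new x hs ht hst hw, hwt, sqJ, sqJ,
    sqP, edge_swap (Sum.inr t) (Sum.inr s), spl2_comm w (Sum.inr t),
    edge_swap_mul s(Sum.inr s, w)]
  generalize edge s(Sum.inr s, w) = a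
  generalize edge s(Sum.inr t, w) = b
  generalize edge s(Sum.inr s, (Sum.inr t : E ⊕ Fin N)) = c
  generalize subst (spl2 w (Sum.inr s) w (Sum.inr t)) (restr x S) = P
  generalize subst (spl w (Sum.inr t)) (restr x S) = Q
  generalize subst (spl w (Sum.inr s)) (restr x S) = R
  generalize restr x S = X
  simp only [mul_sub, mul_add, add_mul, mul_smul_comm, smul_sub, smul_add, smul_smul, smul_neg]
  module

theorem sqP_inl (x : TwSpace E) {N : ℕ} (S : Finset (Fin N)) (s t : Fin N) (a : E) :
    sqP x S s t (Sum.inl a) = 0 := by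
  simp [sqP, wt]

theorem sqP_anti [Finite E] {x : TwSpace E} (hx : Inv x) {N : ℕ} {S : Finset (Fin N)}
    {s t w : Fin N} (htS : t ∈ S) (hwS : w ∈ S) (htw : t ≠ w) :
    sqP x (S.erase t) s t (Sum.inr w) = - sqP x (S.erase w) s w (Sum.inr t) := by
  classical
  have hm : S.erase w = (S.erase t).map (Equiv.swap t w).toEmbedding := by
    ext j
    simp only [Finset.mem_erase, Finset.mem_map, Equiv.coe_toEmbedding]
    constructor
    · rintro ⟨h1, h2⟩
      by_cases e : j = t
      · exact ⟨w, ⟨htw.symm, hwS⟩, by simp [e]⟩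
      · exact ⟨j, ⟨e, h2⟩, Equiv.swap_apply_of_ne_of_ne e h1⟩
    · rintro ⟨a, ⟨h1, h2⟩, rfl⟩
      by_cases e : a = w
      · subst e; simp [htw, htS]
      · rw [Equiv.swap_apply_of_ne_of_ne h1 e]
        exact ⟨e, h2⟩
  have hp : subst (spl2 (Sum.inr t) (Sum.inr s) (Sum.inr t) (Sum.inr w)) (restr x (S.erase w)) =
      subst (spl2 (Sum.inr w) (Sum.inr s) (Sum.inr w) (Sum.inr t)) (restr x (S.erase t)) := by
    rw [hm, ← hx.map_at, subst_relabel _ (map_id_injective (Equiv.swap t w).toEmbedding)]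
    refine subst_congr_on (suppOn_at x _) ?_
    rintro (v | v) hv
    · simp [spl2]
    · have hvt : v ≠ t := by
        rintro rfl
        simp at hv
      by_cases e : v = w
      · subst e
        ext c
        simp [spl2]
        tauto
      · simp [spl2, Equiv.swap_apply_of_ne_of_ne hvt e, hvt, e]
  rw [sqP, sqP, hp, edge_swap_mul]
  simp [wt]

theorem diff_diff [Finite E] {p q : ℤ} (hq : p + 1 = q) {x : TwSpace E} (hx : x ∈ deg E p) :
    diff q (diff p x) = 0 := by
  classical
  have hdx := diff_mem hq hx
  refine Inv.ext (diff_inv hdx) (deg.inv (zero_mem (deg E q))) fun N => ?_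
  have h0 : restr (0 : TwSpace E) (Finset.univ : Finset (Fin N)) = 0 := by
    rw [restr, Pi.zero_apply, map_zero]
  rw [h0, at_diff hdx, dsum]
  generalize (Finset.univ : Finset (Fin N)) = S
  have key : ∀ s ∈ S, ∑ v ∈ verts E (S.erase s), dterm (diff p x) (S.erase s) s v =
      ∑ t ∈ S.erase s, ((∑ v ∈ verts E ((S.erase s).erase t), ∑ w ∈ verts E ((S.erase s).erase t),
          sqG x ((S.erase s).erase t) s t v w)
        + ∑ w ∈ verts E ((S.erase s).erase t),
          (sqJ x ((S.erase s).erase t) s t w - sqJ x ((S.erase s).erase t) t s w))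
        + ∑ t ∈ S.erase s, ∑ w ∈ (S.erase s).erase t, sqP x ((S.erase s).erase t) s t (Sum.inr w) := by
    intro s hs
    have h1 : ∀ v ∈ verts E (S.erase s), dterm (diff p x) (S.erase s) s v =
        ∑ t ∈ S.erase s, ∑ w ∈ verts E ((S.erase s).erase t), edge s(Sum.inr s, v) *
          (dterm x ((S.erase s).erase t) t w - wt v • subst (spl v (Sum.inr s))
            (dterm x ((S.erase s).erase t) t w)) := by
      intro v _
      rw [dterm, at_diff hx, dsum]
      simp only [map_sum, Finset.smul_sum, ← Finset.sum_sub_distrib, Finset.mul_sum]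
    rw [Finset.sum_congr rfl h1, Finset.sum_comm, ← Finset.sum_add_distrib]
    refine Finset.sum_congr rfl fun t ht => ?_
    have hst : s ≠ t := (Finset.ne_of_mem_erase ht).symm
    have hv : verts E (S.erase s) = insert (Sum.inr t) (verts E ((S.erase s).erase t)) := by
      ext u
      rcases u with u | u
      · simp
      · simp only [inr_mem_verts, Finset.mem_insert, Finset.mem_erase, Sum.inr.injEq]
        by_cases e : u = t
        · subst e
          simpa using ht
        · simp [e]
    have hs' : s ∉ (S.erase s).erase t := by simp
    have ht' : t ∉ (S.erase s).erase t := by simp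
    have hP : ∑ w ∈ (S.erase s).erase t, sqP x ((S.erase s).erase t) s t (Sum.inr w) =
        ∑ w ∈ verts E ((S.erase s).erase t), sqP x ((S.erase s).erase t) s t w := by
      rw [verts, Finset.sum_disjSum]
      simp [sqP_inl]
    rw [hv, Finset.sum_insert (by simp), hP]
    generalize (S.erase s).erase t = S0 at *
    have h2 : ∀ v ∈ verts E S0, ∑ w ∈ verts E S0, edge s(Sum.inr s, v) *
        (dterm x S0 t w - wt v • subst (spl v (Sum.inr s)) (dterm x S0 t w)) =
        ∑ w ∈ verts E S0, sqG x S0 s t v w + - (wt v • (edge s(Sum.inr s, v) *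
        (edge s(Sum.inr t, Sum.inr s) * (subst (spl v (Sum.inr s)) (restr x S0)
          - wt v • subst (spl2 v (Sum.inr s) v (Sum.inr t)) (restr x S0))))) := by
      intro v hv
      rw [Finset.sum_congr rfl fun w hw => pair_outer x hs' ht' hst hv hw,
        Finset.sum_add_distrib, Finset.sum_ite_eq' , if_pos hv]
    rw [Finset.sum_congr rfl h2, Finset.sum_add_distrib, add_left_comm, add_assoc]
    congr 1
    rw [← Finset.sum_add_distrib, ← Finset.sum_add_distrib]
    refine Finset.sum_congr rfl fun w hw => ?_
    rw [← sub_eq_add_neg]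
    exact pair_inner x hs' ht' hst hw
  rw [Finset.sum_congr rfl key, Finset.sum_add_distrib, sum_anti S, zero_add]
  · refine Finset.sum_eq_zero fun s hs => ?_
    refine sum_anti (S.erase s) (fun t w => sqP x ((S.erase s).erase t) s t (Sum.inr w)) ?_
    intro t ht w hw htw
    exact sqP_anti (deg.inv hx) ht hw htw
  · intro s hs t ht hst
    rw [Finset.erase_right_comm (a := t) (b := s)]
    generalize (S.erase s).erase t = S0
    rw [neg_add]
    congr 1
    · rw [Finset.sum_comm, ← Finset.sum_neg_distrib]
      refine Finset.sum_congr rfl fun v _ => ?_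
      rw [← Finset.sum_neg_distrib]
      exact Finset.sum_congr rfl fun w _ => sqG_anti x S0 s t w v
    · rw [← Finset.sum_neg_distrib]
      refine Finset.sum_congr rfl fun w _ => ?_
      abel

/-! linearity -/

theorem on_add (x y : TwSpace E) {N : ℕ} (S : Finset (Fin N)) : on (x + y) S = on x S + on y S :=
  map_add _ _ _

theorem on_smul (c : ℝ) (x : TwSpace E) {N : ℕ} (S : Finset (Fin N)) :
    on (c • x) S = c • on x S := map_smul (relabel _) _ _

theorem comp_add_left [Finite F] (i : E) (x x' : TwSpace E) (y : TwSpace F) :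
    comp i (x + x') y = comp i x y + comp i x' y := by
  funext N
  simp only [comp, Pi.add_apply, on_add, Gra.comp, map_add, add_mul, Finset.sum_add_distrib]

theorem comp_add_right [Finite F] (i : E) (x : TwSpace E) (y y' : TwSpace F) :
    comp i x (y + y') = comp i x y + comp i x y' := by
  funext N
  simp only [comp, Pi.add_apply, on_add, Gra.comp, map_add, mul_add, Finset.sum_add_distrib]

theorem comp_smul_left [Finite F] (c : ℝ) (i : E) (x : TwSpace E) (y : TwSpace F) :
    comp i (c • x) y = c • comp i x y := by
  funext N
  simp only [comp, Pi.smul_apply, on_smul, Gra.comp, map_smul, smul_mul_assoc, Finset.smul_sum]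

theorem comp_smul_right [Finite F] (c : ℝ) (i : E) (x : TwSpace E) (y : TwSpace F) :
    comp i x (c • y) = c • comp i x y := by
  funext N
  simp only [comp, Pi.smul_apply, on_smul, Gra.comp, map_smul, mul_smul_comm, Finset.smul_sum]

theorem diff_add [Finite E] (p : ℤ) {x y : TwSpace E} (hx : x ∈ deg E p) (hy : y ∈ deg E p) :
    diff p (x + y) = diff p x + diff p y := by
  funext N
  rw [Pi.add_apply, diff_eq hx, diff_eq hy, diff_eq (add_mem hx hy), ← Finset.sum_add_distrib]
  refine Finset.sum_congr rfl fun s _ => ?_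
  rw [← Finset.sum_add_distrib]
  refine Finset.sum_congr rfl fun v _ => ?_
  have : restr (x + y) ({s}ᶜ : Finset (Fin N)) = restr x {s}ᶜ + restr y {s}ᶜ := map_add _ _ _
  rw [dterm, dterm, dterm, this, map_add, ← mul_add, smul_add]
  congr 1
  abel

theorem diff_smul [Finite E] (p : ℤ) (c : ℝ) {x : TwSpace E} (hx : x ∈ deg E p) :
    diff p (c • x) = c • diff p x := by
  funext N
  rw [Pi.smul_apply, diff_eq hx, diff_eq (Submodule.smul_mem _ c hx), Finset.smul_sum]
  refine Finset.sum_congr rfl fun s _ => ?_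
  rw [Finset.smul_sum]
  refine Finset.sum_congr rfl fun v _ => ?_
  have : restr (c • x) ({s}ᶜ : Finset (Fin N)) = c • restr x {s}ᶜ := map_smul (relabel _) _ _
  rw [dterm, dterm, this, map_smul, smul_comm (wt v), ← smul_sub, mul_smul_comm]

end TwGra

open TwGra in
/-- The dg operad `fGraphs = Tw Gra`. -/
def fGraphs : DGOperad where
  obj E _ p := deg E p
  map e p :=
    { toFun := fun x => ⟨TwGra.map e x.1, map_mem e x.2⟩
      map_add' := fun x y => Subtype.ext (funext fun _ => map_add (Gra.relabel _) _ _)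
      map_smul' := fun c x => Subtype.ext (funext fun _ => map_smul (Gra.relabel _) _ _) }
  unit := ⟨TwGra.unit, unit_mem⟩
  comp h i := LinearMap.mk₂ ℝ (fun x y => ⟨TwGra.comp i x.1 y.1, comp_mem i h x.2 y.2⟩)
    (fun x x' y => Subtype.ext (comp_add_left i x.1 x'.1 y.1))
    (fun c x y => Subtype.ext (comp_smul_left c i x.1 y.1))
    (fun x y y' => Subtype.ext (comp_add_right i x.1 y.1 y'.1))
    (fun c x y => Subtype.ext (comp_smul_right c i x.1 y.1))
  d {E _ p q} h :=
    { toFun := fun x => ⟨diff p x.1, diff_mem h x.2⟩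
      map_add' := fun x y => Subtype.ext (diff_add p x.2 y.2)
      map_smul' := fun c x => Subtype.ext (diff_smul p c x.2) }
  map_refl x := Subtype.ext (TwGra.map_refl x.1)
  map_trans e e' x := Subtype.ext (TwGra.map_trans e e' x.1)
  comp_map h σ τ i x y := Subtype.ext (TwGra.comp_map σ τ i x.2 y.2)
  comp_unit i x := Subtype.ext (TwGra.comp_unit i x.2)
  unit_comp y := Subtype.ext (TwGra.unit_comp y.2)
  comp_seq h₁ h₂ h₃ h₄ i j x y z := Subtype.ext (TwGra.comp_assoc i j x.2 y.2 z.2)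
  comp_par h₁ h₂ h₃ h₄ i j hij x y z := Subtype.ext (TwGra.comp_par hij x.2 y.2 z.2)
  d_d h h' x := Subtype.ext (diff_diff h x.2)
  d_map h e x := Subtype.ext (diff_map e x.2)
  d_comp h hp hq hr h₁ h₂ i x y := Subtype.ext (leibniz i h x.2 y.2)

/-! ## The suboperad of graphs with at least trivalent internal vertices -/

/-- The two conditions on a graph with external vertices `E` and `k` internal vertices: all internal
vertices are at least trivalent, and every connected component contains an external vertex. -/
structure IsGraphsGraph {E : Type} {k : ℕ} (Γ : SimpleGraph (E ⊕ Fin k)) : Prop where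
  trivalent : ∀ j : Fin k, 3 ≤ (Γ.neighborSet (Sum.inr j)).ncard
  external : ∀ c : Γ.ConnectedComponent, ∃ a : E, Sum.inl a ∈ c.supp

/-- The subspace of `Gra (E ⊕ Fin k)` spanned by the graphs satisfying the two conditions. A graph,
with its edges listed in some order without repetition, is the product of its edges in that order. -/
def graphsSpan (E : Type) (k : ℕ) : Submodule ℝ (Gra (E ⊕ Fin k)) :=
  Submodule.span ℝ {x | ∃ (Γ : SimpleGraph (E ⊕ Fin k)) (l : List (Sym2 (E ⊕ Fin k))),
    IsGraphsGraph Γ ∧ l.Nodup ∧ (∀ e, e ∈ l ↔ e ∈ Γ.edgeSet) ∧ x = Gra.monomial l}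

/-- The component with `k` internal vertices of an element of `fGraphs`. -/
def fGraphs.component {E : Type} [Finite E] {p : ℤ} (k : ℕ) :
    fGraphs.obj E p →ₗ[ℝ] Gra (E ⊕ Fin k) :=
  LinearMap.proj (φ := fun k : ℕ => Gra (E ⊕ Fin k)) k ∘ₗ (TwGra.deg E p).subtype

/-- `Graphs`: the (possibly infinite) linear combinations, in `fGraphs`, of graphs satisfying the two
conditions, i.e. the elements whose component with `k` internal vertices is, for every `k`, a linear
combination of such graphs. -/
def graphs (E : Type) [Finite E] (p : ℤ) : Submodule ℝ (fGraphs.obj E p) :=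
  ⨅ k : ℕ, (graphsSpan E k).comap (fGraphs.component k)

end

/-!
A graph satisfies the two conditions if and only if its list of edges is admissible
(`Gra.IsAdmissible`): every internal vertex lies on at least three edges, and every vertex is linked
to an external one. Relabelling obviously preserves this.

For the composition, a graph occurring in `Γ ∘ᵢ Γ'` is mapped to `Γ` by contracting the vertices of
`Γ'` to `i`. Internal vertices keep their valence, since `Γ` has no multiple edges to be merged and
no tadpoles. A path in `Γ` to an external vertex lifts until it meets `i`, where it is continued in
`Γ'` (`Gra.IsAdmissible.insert`).

For the differential, splitting a vertex `v` into `v` and a new internal vertex `s`, joined by an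
edge, moves some of the edges at `v` to `s`. Let `Pₖ` be the sum over all ways of moving `k` edges
(`Gra.move`); it is the coefficient of `X ^ k` of an algebra homomorphism from the exterior algebra
to polynomials over it, so that it is defined without reference to a basis of graphs. Then
`s` has valence `k + 1`, and if `v` has valence `n` in `Γ`, its new valence is `n - k + 1`. Hence the
terms `P₀` and `P₁` are bad, and, for internal `v`, also `Pₙ` and `Pₙ₋₁`, which arise from `P₀` and
`P₁` by exchanging `v` and `s` (`Gra.move_eq_relabel_swap_move`). All other terms are admissible.
The bad terms cancel in the differential:
* the terms in which `s` is univalent are produced by `mu ∘ x` and removed by the splittings of the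
  external vertices, and by twice one half of the splittings of the internal ones, because `x` is
  invariant under permutations of the internal vertices;
* the terms in which `s` is bivalent subdivide an edge `(v, w)`; the edges `(s, v)` and `(s, w)` being
  odd, the contributions of `v` and `w` are opposite (`Gra.sum_edge_mul_move_one`). If `v` is
  internal, then by the invariance of `x` the terms in which `v` becomes bivalent contribute as much
  as those in which `s` does, which makes up for the factor one half.
-/

noncomputable section

namespace Gra

variable {V W : Type}

/-! ### Admissible lists of edges -/

open Classical in
/-- The valence of the vertex `a` in the graph with the list of edges `l`. -/
def valence (a : V) (l : List (Sym2 V)) : ℕ := l.countP fun e => decide (a ∈ e)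

/-- Two vertices are linked if they are joined by a path with edges in `l`. -/
def Linked (l : List (Sym2 V)) : V → V → Prop :=
  Relation.ReflTransGen fun a b => s(a, b) ∈ l

/-- The vertex `a` is linked to a vertex of `X`. -/
def Anchored (X : Set V) (l : List (Sym2 V)) (a : V) : Prop := ∃ b ∈ X, Linked l a b

/-- The list `l` consists of the edges of a graph with vertex set `A ⊆ V`, without repetition and
without tadpoles; the vertices of this graph outside `X` (its internal vertices) are at least
trivalent, and each of its connected components meets `X`. -/
structure IsAdmissible (X A : Set V) (l : List (Sym2 V)) : Prop where
  nodup : l.Nodup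
  notDiag : ∀ e ∈ l, ¬ e.IsDiag
  mem : ∀ e ∈ l, ∀ a ∈ e, a ∈ A
  trivalent : ∀ a ∈ A, a ∉ X → 3 ≤ valence a l
  anchored : ∀ a ∈ A, Anchored X l a

/-- The combinations of graphs with admissible lists of edges. -/
def admissible (X A : Set V) : Submodule ℝ (Gra V) :=
  Submodule.span ℝ {x | ∃ l, IsAdmissible X A l ∧ x = monomial l}

theorem IsAdmissible.monomial_mem {X A : Set V} {l : List (Sym2 V)} (h : IsAdmissible X A l) :
    monomial l ∈ admissible X A := Submodule.subset_span ⟨l, h, rfl⟩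

theorem monomial_nil : monomial ([] : List (Sym2 V)) = 1 := rfl

theorem monomial_cons (e : Sym2 V) (l : List (Sym2 V)) :
    monomial (e :: l) = edge e * monomial l := by simp [monomial]

theorem valence_nil (a : V) : valence a [] = 0 := rfl

theorem valence_append (a : V) (l m : List (Sym2 V)) :
    valence a (l ++ m) = valence a l + valence a m := List.countP_append ..

theorem valence_cons_of_mem {a : V} {e : Sym2 V} (h : a ∈ e) (l : List (Sym2 V)) :
    valence a (e :: l) = valence a l + 1 := by simp [valence, h]

theorem valence_cons_of_notMem {a : V} {e : Sym2 V} (h : a ∉ e) (l : List (Sym2 V)) :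
    valence a (e :: l) = valence a l := by simp [valence, h]

theorem Linked.mono {l m : List (Sym2 V)} (h : ∀ e ∈ l, e ∈ m) {a b : V} (hab : Linked l a b) :
    Linked m a b :=
  Relation.ReflTransGen.mono (fun _ _ => h _) _ _ hab

theorem Linked.trans_anchored {X : Set V} {l : List (Sym2 V)} {a b : V} (hab : Linked l a b)
    (hb : Anchored X l b) : Anchored X l a := by
  obtain ⟨c, hc, h⟩ := hb
  exact ⟨c, hc, Relation.ReflTransGen.trans hab h⟩

theorem Anchored.mono {X : Set V} {l m : List (Sym2 V)} (h : ∀ e ∈ l, e ∈ m) {a : V}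
    (ha : Anchored X l a) : Anchored X m a := by
  obtain ⟨b, hb, hab⟩ := ha
  exact ⟨b, hb, hab.mono h⟩

theorem Linked.map {l : List (Sym2 V)} (f : V → W) {a b : V} (h : Linked l a b) :
    Linked (l.map (Sym2.map f)) (f a) (f b) := by
  refine Relation.ReflTransGen.lift f (fun c d hcd => ?_) _ _ h
  exact List.mem_map.2 ⟨_, hcd, by simp⟩

/-- If a graph is obtained from the graph `l` by replacing vertices by the fibres of a map `π`, and
anchoredness spreads over the fibres, then it is inherited from the graph `l`. -/
theorem Anchored.of_map {π : W → V} {X : Set V} {Z : Set W} {l : List (Sym2 V)}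
    {m m' : List (Sym2 W)} (hm : m.map (Sym2.map π) = l) (hsub : ∀ e ∈ m, e ∈ m')
    (hfib : ∀ w w', π w = π w' → Anchored Z m' w' → Anchored Z m' w)
    (hX : ∀ w, π w ∈ X → Anchored Z m' w) {w : W} (h : Anchored X l (π w)) :
    Anchored Z m' w := by
  obtain ⟨b, hb, hab⟩ := h
  generalize hv : π w = v at hab
  induction hab using Relation.ReflTransGen.head_induction_on generalizing w with
  | refl => exact hX w (hv ▸ hb)
  | @head a c hac _ ih =>
    subst hv
    have hac' : s(π w, c) ∈ m.map (Sym2.map π) := hm ▸ hac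
    obtain ⟨e, he, hee⟩ := List.mem_map.1 hac'
    induction e with | _ u u' =>
    have key : ∀ u u', s(u, u') ∈ m → π u = π w → π u' = c → Anchored Z m' w := by
      intro u u' hu h1 h2
      refine hfib w u h1.symm ?_
      exact Linked.trans_anchored (Relation.ReflTransGen.single (hsub _ hu)) (ih h2)
    rw [Sym2.map_mk, Sym2.eq_iff] at hee
    rcases hee with ⟨h1, h2⟩ | ⟨h1, h2⟩
    · exact key u u' he h1 h2
    · exact key u' u (Sym2.eq_swap ▸ he) h2 h1

theorem valence_map_of_fiber {π : W → V} {w : W} (h : ∀ w', π w' = π w → w' = w)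
    (m : List (Sym2 W)) : valence (π w) (m.map (Sym2.map π)) = valence w m := by
  rw [valence, valence, List.countP_map]
  congr 1
  ext e
  simp only [Function.comp_apply, Sym2.mem_map, decide_eq_decide]
  exact ⟨fun ⟨a, ha, e⟩ => h a e ▸ ha, fun hw => ⟨w, hw, rfl⟩⟩

theorem not_isDiag_of_map {π : W → V} {e : Sym2 W} (h : ¬ (e.map π).IsDiag) : ¬ e.IsDiag := by
  induction e with | _ a b =>
  simp only [Sym2.map_mk, Sym2.mk_isDiag_iff] at h ⊢
  exact fun e => h (congrArg π e)

theorem monomial_map {f : V → W} (hf : Function.Injective f) (l : List (Sym2 V)) :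
    relabel f (monomial l) = monomial (l.map (Sym2.map f)) := by
  induction l with
  | nil => simp [monomial]
  | cons e l ih => rw [List.map_cons, monomial_cons, monomial_cons, map_mul, ih, relabel_edge hf]

theorem IsAdmissible.map {f : V → W} (hf : Function.Injective f) {X A : Set V} {Y B : Set W}
    (hX : ∀ a, f a ∈ Y ↔ a ∈ X) (hB : f '' A = B) {l : List (Sym2 V)} (h : IsAdmissible X A l) :
    IsAdmissible Y B (l.map (Sym2.map f)) where
  nodup := h.nodup.map (Sym2.map.injective hf)
  notDiag := by
    intro e he
    obtain ⟨e, hel, rfl⟩ := List.mem_map.1 he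
    rw [Sym2.isDiag_map hf]
    exact h.notDiag e hel
  mem := by
    intro e he b hb
    obtain ⟨e, hel, rfl⟩ := List.mem_map.1 he
    obtain ⟨a, ha, rfl⟩ := Sym2.mem_map.1 hb
    exact hB ▸ ⟨a, h.mem e hel a ha, rfl⟩
  trivalent := by
    subst hB
    rintro _ ⟨a, ha, rfl⟩ hY
    rw [valence_map_of_fiber fun b hb => hf hb]
    exact h.trivalent a ha fun hx => hY ((hX a).2 hx)
  anchored := by
    subst hB
    rintro _ ⟨a, ha, rfl⟩
    obtain ⟨b, hb, hab⟩ := h.anchored a ha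
    exact ⟨f b, (hX b).2 hb, hab.map f⟩

theorem relabel_mem_admissible {f : V → W} (hf : Function.Injective f) {X A : Set V} {Y B : Set W}
    (hX : ∀ a, f a ∈ Y ↔ a ∈ X) (hB : f '' A = B) {x : Gra V} (hx : x ∈ admissible X A) :
    relabel f x ∈ admissible Y B := by
  induction hx using Submodule.span_induction with
  | zero => simp
  | add x y _ _ hx hy => simpa using add_mem hx hy
  | smul c x _ hx => simpa using Submodule.smul_mem _ c hx
  | mem x hx =>
    obtain ⟨l, hl, rfl⟩ := hx
    rw [monomial_map hf]
    exact (hl.map hf hX hB).monomial_mem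

/-! ### Insertion -/

/-- Inserting a graph at the external vertex `i` of a graph. The vertices of the inserted graph
form the fibre of `π` over `i`. -/
theorem IsAdmissible.insert {π : W → V} {i : V} {X A : Set V} {Y Z : Set W}
    (hA : ∀ w, π w ∈ A) (hinj : ∀ w w', π w' = π w → π w ≠ i → w' = w)
    (hZ : ∀ w, π w ≠ i → (w ∈ Z ↔ π w ∈ X)) (hZY : ∀ w, π w = i → (w ∈ Z ↔ w ∈ Y))
    {l : List (Sym2 V)} {l' m : List (Sym2 W)} (hl : IsAdmissible X A l)
    (hl' : l'.map (Sym2.map π) = l) (hm : IsAdmissible Y {w | π w = i} m) :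
    IsAdmissible Z Set.univ (l' ++ m) := by
  have hdisj : ∀ w, π w ≠ i → valence w m = 0 := by
    intro w hw
    rw [valence, List.countP_eq_zero]
    intro e he h
    exact hw (hm.mem e he w (by simpa using h))
  have hnd : ∀ e ∈ l', ¬ (e.map π).IsDiag := fun e he =>
    hl.notDiag _ (hl' ▸ List.mem_map_of_mem he)
  have hfib : ∀ w, π w = i → Anchored Z (l' ++ m) w := by
    intro w hw
    obtain ⟨b, hb, hwb⟩ := hm.anchored w hw
    have hbi : π b = i := by
      rcases Relation.ReflTransGen.cases_tail hwb with h | ⟨c, _, h⟩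
      · rw [h, hw]
      · exact hm.mem _ h b (Sym2.mem_mk_right _ _)
    exact ⟨b, (hZY b hbi).2 hb, hwb.mono fun e he => List.mem_append_right _ he⟩
  refine ⟨?_, ?_, fun _ _ _ _ => Set.mem_univ _, ?_, ?_⟩
  · refine List.Nodup.append (List.Nodup.of_map (Sym2.map π) (hl' ▸ hl.nodup)) hm.nodup ?_
    intro e he he'
    refine hnd e he ?_
    have := hm.mem e he'
    induction e with | _ a b =>
    rw [Sym2.map_mk, Sym2.mk_isDiag_iff, this a (by simp), this b (by simp)]
  · intro e he
    rcases List.mem_append.1 he with he | he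
    · exact not_isDiag_of_map (hnd e he)
    · exact hm.notDiag e he
  · intro w _ hw
    rw [valence_append]
    by_cases h : π w = i
    · have := hm.trivalent w h fun hY => hw ((hZY w h).2 hY)
      omega
    · have := hl.trivalent (π w) (hA w) fun hX => hw ((hZ w h).2 hX)
      rw [← hl', valence_map_of_fiber fun w' hw' => hinj w w' hw' h] at this
      omega
  · intro w _
    refine Anchored.of_map hl' (fun e he => List.mem_append_left _ he) ?_ ?_
      (hl.anchored (π w) (hA w))
    · intro u u' hu hu'
      by_cases h : π u' = i
      · exact hfib u (hu.trans h)
      · exact hinj u' u hu h ▸ hu'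
    · intro u hu
      by_cases h : π u = i
      · exact hfib u h
      · exact ⟨u, (hZ u h).2 hu, Relation.ReflTransGen.refl⟩

/-- Replacing the vertices of a graph by subsets of the fibres of `π` produces a combination of
graphs which are mapped to the given graph by `π`. -/
theorem subst_monomial_mem {π : W → V} {A : Set V} {T : V → Finset W}
    (hT : ∀ a ∈ A, ∀ w ∈ T a, π w = a) {l : List (Sym2 V)} (hd : ∀ e ∈ l, ¬ e.IsDiag)
    (hA : ∀ e ∈ l, ∀ a ∈ e, a ∈ A) :
    subst T (monomial l) ∈
      Submodule.span ℝ {x | ∃ l' : List (Sym2 W), l'.map (Sym2.map π) = l ∧ x = monomial l'} := by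
  induction l with
  | nil => exact Submodule.subset_span ⟨[], rfl, by simp [monomial]⟩
  | cons e l ih =>
    have ih := ih (fun e he => hd e (List.mem_cons_of_mem _ he))
      (fun e he => hA e (List.mem_cons_of_mem _ he))
    have hd := hd e List.mem_cons_self
    have hA := hA e List.mem_cons_self
    rw [monomial_cons, map_mul]
    induction e with | _ a b =>
    rw [subst_edge _ (by simpa using hd), Finset.sum_mul]
    refine Submodule.sum_mem _ fun a' ha' => ?_
    rw [Finset.sum_mul]
    refine Submodule.sum_mem _ fun b' hb' => ?_
    have ha := hT a (hA a (by simp)) a' ha'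
    have hb := hT b (hA b (by simp)) b' hb'
    generalize subst T (monomial l) = z at ih
    induction ih using Submodule.span_induction with
    | zero => simp
    | add x y _ _ hx hy => rw [mul_add]; exact add_mem hx hy
    | smul c x _ hx => rw [mul_smul_comm]; exact Submodule.smul_mem _ c hx
    | mem x hx =>
      obtain ⟨l', hl', rfl⟩ := hx
      exact Submodule.subset_span ⟨s(a', b') :: l', by simp [hl', ha, hb], (monomial_cons _ _).symm⟩

theorem subst_mul_mem_admissible {π : W → V} {i : V} {X A : Set V} {Y Z : Set W}
    (hA : ∀ w, π w ∈ A) (hinj : ∀ w w', π w' = π w → π w ≠ i → w' = w)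
    (hZ : ∀ w, π w ≠ i → (w ∈ Z ↔ π w ∈ X)) (hZY : ∀ w, π w = i → (w ∈ Z ↔ w ∈ Y))
    {T : V → Finset W} (hT : ∀ a ∈ A, ∀ w ∈ T a, π w = a) {x : Gra V} {y : Gra W}
    (hx : x ∈ admissible X A) (hy : y ∈ admissible Y {w | π w = i}) :
    subst T x * y ∈ admissible Z Set.univ := by
  induction hx using Submodule.span_induction with
  | zero => simp
  | add x x' _ _ hx hx' => rw [map_add, add_mul]; exact add_mem hx hx'
  | smul c x _ hx => rw [map_smul, smul_mul_assoc]; exact Submodule.smul_mem _ c hx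
  | mem x hx =>
    obtain ⟨l, hl, rfl⟩ := hx
    have h := Submodule.mul_mem_mul (subst_monomial_mem hT hl.notDiag hl.mem) hy
    rw [admissible, Submodule.span_mul_span] at h
    refine Submodule.span_mono ?_ h
    rintro _ ⟨_, ⟨l', hl', rfl⟩, _, ⟨m, hm, rfl⟩, rfl⟩
    exact ⟨l' ++ m, hl.insert hA hinj hZ hZY hl' hm, (monomial_append l' m).symm⟩

section Splitting

variable [DecidableEq V]

/-! ### Moving edges from one vertex to another -/

/-- The linear map replacing an edge `(v, w)` by `(s, w)`; the edges not incident to `v` are mapped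
to zero. -/
def moveEdge (v s : V) : EdgeSpace V →ₗ[ℝ] EdgeSpace V :=
  Finsupp.linearCombination ℝ fun e : {e : Sym2 V // ¬ e.IsDiag} =>
    if v ∈ e.1 then edgeVec (e.1.map (Equiv.swap v s)) else 0

/-- An edge `e` is sent to `e + e' X`, where `e'` is `e` with its end `v` moved to `s`. -/
def movePolyEdge (v s : V) : EdgeSpace V →ₗ[ℝ] Polynomial (Gra V) where
  toFun e := Polynomial.C (ExteriorAlgebra.ι ℝ e) +
    Polynomial.X * Polynomial.C (ExteriorAlgebra.ι ℝ (moveEdge v s e))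
  map_add' e f := by
    simp only [map_add, mul_add]
    abel
  map_smul' c e := by simp [smul_add, ← Polynomial.smul_C]

theorem movePolyEdge_sq (v s : V) (e : EdgeSpace V) :
    movePolyEdge v s e * movePolyEdge v s e = 0 := by
  have h1 := ExteriorAlgebra.ι_sq_zero (R := ℝ) e
  have h2 := ExteriorAlgebra.ι_sq_zero (R := ℝ) (moveEdge v s e)
  have h3 := ExteriorAlgebra.ι_add_mul_swap (R := ℝ) e (moveEdge v s e)
  simp only [movePolyEdge, LinearMap.coe_mk, AddHom.coe_mk]
  generalize ExteriorAlgebra.ι ℝ e = a at *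
  generalize ExteriorAlgebra.ι ℝ (moveEdge v s e) = b at *
  have : (Polynomial.C a + Polynomial.X * Polynomial.C b) *
      (Polynomial.C a + Polynomial.X * Polynomial.C b) =
      Polynomial.C (a * a) + Polynomial.X * Polynomial.C (a * b + b * a)
        + Polynomial.X * (Polynomial.X * Polynomial.C (b * b)) := by
    simp only [add_mul, mul_add, Polynomial.C_mul, Polynomial.C_add, mul_assoc]
    rw [← mul_assoc (Polynomial.C a) Polynomial.X, ← mul_assoc (Polynomial.C b) Polynomial.X,
      ← Polynomial.X_mul_C a, ← Polynomial.X_mul_C b, mul_assoc, mul_assoc]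
    abel
  rw [this, h1, h2, h3]
  simp

/-- Reconnecting edges at the vertex `v` to the vertex `s`, with a variable counting the number of
reconnected edges. -/
def movePoly (v s : V) : Gra V →ₐ[ℝ] Polynomial (Gra V) :=
  ExteriorAlgebra.lift ℝ ⟨movePolyEdge v s, movePolyEdge_sq v s⟩

/-- The sum over all ways of choosing `k` edges at the vertex `v` of a graph and reconnecting them to
the vertex `s`. -/
def move (v s : V) (k : ℕ) : Gra V →ₗ[ℝ] Gra V where
  toFun x := (movePoly v s x).coeff k
  map_add' x y := by rw [map_add, Polynomial.coeff_add]
  map_smul' c x := by rw [map_smul, Polynomial.coeff_smul, RingHom.id_apply]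

theorem movePoly_edge (v s : V) (e : Sym2 V) :
    movePoly v s (edge e) = Polynomial.C (edge e) +
      Polynomial.X * Polynomial.C (ExteriorAlgebra.ι ℝ (moveEdge v s (edgeVec e))) := by
  rw [movePoly, edge, ExteriorAlgebra.lift_ι_apply]
  rfl

theorem moveEdge_edgeVec (v s : V) (e : Sym2 V) :
    moveEdge v s (edgeVec e) = if v ∈ e then edgeVec (e.map (Equiv.swap v s)) else 0 := by
  by_cases hd : e.IsDiag
  · have hd' : (e.map (Equiv.swap v s)).IsDiag := (Sym2.isDiag_map (Equiv.injective _)).2 hd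
    rw [edgeVec, dif_pos hd, edgeVec, dif_pos hd', map_zero, ite_self]
  · rw [edgeVec, dif_neg hd, moveEdge, Finsupp.linearCombination_single, one_smul]

theorem movePoly_edge_of_mem {v s : V} {e : Sym2 V} (h : v ∈ e) :
    movePoly v s (edge e) =
      Polynomial.C (edge e) + Polynomial.X * Polynomial.C (edge (e.map (Equiv.swap v s))) := by
  rw [movePoly_edge, moveEdge_edgeVec, if_pos h]
  rfl

theorem movePoly_edge_of_notMem {v s : V} {e : Sym2 V} (h : v ∉ e) :
    movePoly v s (edge e) = Polynomial.C (edge e) := by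
  rw [movePoly_edge, moveEdge_edgeVec, if_neg h, map_zero, map_zero, mul_zero, add_zero]

section

variable {v s : V} {e : Sym2 V}

theorem move_edge_mul_of_notMem (h : v ∉ e) (k : ℕ) (x : Gra V) :
    move v s k (edge e * x) = edge e * move v s k x := by
  simp [move, movePoly_edge_of_notMem h]

theorem move_zero_edge_mul (x : Gra V) :
    move v s 0 (edge e * x) = edge e * move v s 0 x := by
  by_cases h : v ∈ e
  · simp [move, movePoly_edge_of_mem h, add_mul, mul_assoc]
  · exact move_edge_mul_of_notMem h 0 x

theorem move_succ_edge_mul_of_mem (h : v ∈ e) (k : ℕ) (x : Gra V) :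
    move v s (k + 1) (edge e * x) =
      edge e * move v s (k + 1) x + edge (e.map (Equiv.swap v s)) * move v s k x := by
  simp [move, movePoly_edge_of_mem h, add_mul, mul_assoc]

theorem move_zero_one : move v s 0 1 = 1 := by simp [move]

theorem move_succ_one (k : ℕ) : move v s (k + 1) 1 = 0 := by
  simp [move, Polynomial.coeff_one]

end

theorem move_zero_monomial (v s : V) (l : List (Sym2 V)) :
    move v s 0 (monomial l) = monomial l := by
  induction l with
  | nil => exact move_zero_one
  | cons e l ih => rw [monomial_cons, move_zero_edge_mul, ih]

theorem move_eq_zero_of_valence_lt (v s : V) (l : List (Sym2 V)) {k : ℕ} (h : valence v l < k) :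
    move v s k (monomial l) = 0 := by
  induction l generalizing k with
  | nil =>
    obtain ⟨k, rfl⟩ := Nat.exists_eq_succ_of_ne_zero (Nat.ne_zero_of_lt h)
    exact move_succ_one k
  | cons e l ih =>
    rw [monomial_cons]
    by_cases he : v ∈ e
    · rw [valence_cons_of_mem he] at h
      obtain ⟨k, rfl⟩ := Nat.exists_eq_succ_of_ne_zero (Nat.ne_zero_of_lt h)
      rw [move_succ_edge_mul_of_mem he, ih (by omega), ih (by omega), mul_zero, mul_zero, add_zero]
    · rw [valence_cons_of_notMem he] at h
      rw [move_edge_mul_of_notMem he, ih h, mul_zero]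

theorem map_swap_eq_self {v s : V} {e : Sym2 V} (hv : v ∉ e) (hs : s ∉ e) :
    e.map (Equiv.swap v s) = e := by
  induction e with | _ a b =>
  simp only [Sym2.mem_iff, not_or] at hv hs
  rw [Sym2.map_mk, Equiv.swap_apply_of_ne_of_ne (Ne.symm hv.1) (Ne.symm hs.1),
    Equiv.swap_apply_of_ne_of_ne (Ne.symm hv.2) (Ne.symm hs.2)]

theorem subst_spl_edge_of_mem {v s : V} {e : Sym2 V} (hd : ¬ e.IsDiag) (hs : s ∉ e)
    (hv : v ∈ e) : subst (TwGra.spl v s) (edge e) =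
      edge e + edge (e.map (Equiv.swap v s)) := by
  obtain ⟨w, rfl⟩ := Sym2.mem_iff_exists.1 hv
  have hvw : w ≠ v := fun h => hd (by simp [h])
  have hsv : v ≠ s := fun h => hs (by simp [h])
  have hsw : w ≠ s := fun h => hs (by simp [h])
  rw [subst_edge _ hvw.symm, TwGra.spl_ne hvw, TwGra.sum_spl_self hsv,
    Finset.sum_singleton, Finset.sum_singleton, Sym2.map_mk, Equiv.swap_apply_left,
    Equiv.swap_apply_of_ne_of_ne hvw hsw]

theorem subst_spl_edge_of_notMem {V : Type} {v s : V} {e : Sym2 V} (hd : ¬ e.IsDiag) (hv : v ∉ e) :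
    subst (TwGra.spl v s) (edge e) = edge e := by
  induction e with | _ a b =>
  simp only [Sym2.mem_iff, not_or] at hv
  rw [subst_edge _ (by simpa using hd), TwGra.spl_ne (Ne.symm hv.1), TwGra.spl_ne (Ne.symm hv.2),
    Finset.sum_singleton, Finset.sum_singleton]

/-- Splitting off a new vertex `s` from the vertex `v` of a graph moves any number of edges from `v`
to `s`. -/
theorem subst_spl_monomial {v s : V} {l : List (Sym2 V)} (hd : ∀ e ∈ l, ¬ e.IsDiag)
    (hs : ∀ e ∈ l, s ∉ e) : subst (TwGra.spl v s) (monomial l) =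
      ∑ k ∈ Finset.range (valence v l + 1), move v s k (monomial l) := by
  induction l with
  | nil => simp [monomial_nil, valence_nil, move_zero_one]
  | cons e l ih =>
    have ih := ih (fun e he => hd e (List.mem_cons_of_mem _ he))
      (fun e he => hs e (List.mem_cons_of_mem _ he))
    have hd := hd e List.mem_cons_self
    have hs := hs e List.mem_cons_self
    rw [monomial_cons, map_mul, ih]
    by_cases hv : v ∈ e
    · have h : ∑ k ∈ Finset.range (valence v l + 1 + 1), move v s k (edge e * monomial l) =
          edge e * (∑ k ∈ Finset.range (valence v l + 1 + 1), move v s k (monomial l)) +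
            edge (e.map (Equiv.swap v s)) *
              ∑ k ∈ Finset.range (valence v l + 1), move v s k (monomial l) := by
        rw [Finset.sum_range_succ', Finset.sum_congr rfl fun k _ => move_succ_edge_mul_of_mem hv k _,
          Finset.sum_add_distrib, move_zero_edge_mul, Finset.sum_range_succ' _ (valence v l + 1),
          mul_add, Finset.mul_sum, Finset.mul_sum]
        abel
      rw [subst_spl_edge_of_mem hd hs hv, valence_cons_of_mem hv, h,
        Finset.sum_range_succ _ (valence v l + 1),
        move_eq_zero_of_valence_lt v s l (Nat.lt_succ_self _), add_zero, add_mul]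
    · rw [subst_spl_edge_of_notMem hd hv, valence_cons_of_notMem hv, Finset.mul_sum]
      exact Finset.sum_congr rfl fun k _ => (move_edge_mul_of_notMem hv k _).symm

/-- Moving `j` of the edges at `v` to `s` amounts to exchanging `v` and `s` after moving the other
edges. -/
theorem move_eq_relabel_swap_move {v s : V} {l : List (Sym2 V)}
    (hs : ∀ e ∈ l, s ∉ e) {j k : ℕ} (h : j + k = valence v l) :
    move v s j (monomial l) = relabel (Equiv.swap v s) (move v s k (monomial l)) := by
  have hi := (Equiv.swap v s).injective
  induction l generalizing j k with
  | nil =>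
    rw [valence_nil] at h
    obtain ⟨rfl, rfl⟩ : j = 0 ∧ k = 0 := by omega
    rw [monomial_nil, move_zero_one, map_one]
  | cons e l ih =>
    have ih := @ih (fun e he => hs e (List.mem_cons_of_mem _ he))
    have hs := hs e List.mem_cons_self
    rw [monomial_cons]
    by_cases hv : v ∈ e
    · have hee : (e.map (Equiv.swap v s)).map (Equiv.swap v s) = e := by
        rw [Sym2.map_map, ← Equiv.coe_trans, Equiv.swap_swap]
        simp
      rw [valence_cons_of_mem hv] at h
      rcases j with _ | j <;> rcases k with _ | k
      · omega
      · rw [move_zero_edge_mul, move_succ_edge_mul_of_mem hv,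
          move_eq_zero_of_valence_lt v s l (by omega : valence v l < k + 1), mul_zero, zero_add,
          map_mul, relabel_edge hi, hee, ← ih (j := 0) (k := k) (by omega)]
      · rw [move_zero_edge_mul, move_succ_edge_mul_of_mem hv,
          move_eq_zero_of_valence_lt v s l (by omega : valence v l < j + 1), mul_zero, zero_add,
          map_mul, relabel_edge hi, ih (j := j) (k := 0) (by omega)]
      · rw [move_succ_edge_mul_of_mem hv, move_succ_edge_mul_of_mem hv, map_add, map_mul, map_mul,
          relabel_edge hi, relabel_edge hi, hee, ← ih (j := j + 1) (k := k) (by omega),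
          ← ih (j := j) (k := k + 1) (by omega), add_comm]
    · rw [valence_cons_of_notMem hv] at h
      rw [move_edge_mul_of_notMem hv, move_edge_mul_of_notMem hv, map_mul, relabel_edge hi,
        map_swap_eq_self hv hs, ih h]

/-! ### Splitting a vertex -/

/-- The map of vertices which undoes the splitting of `v` into `v` and `s`. -/
def collapse (v s u : V) : V := if u = s then v else u

theorem collapse_self (v s : V) : collapse v s s = v := if_pos rfl

theorem collapse_of_ne (v : V) {s u : V} (h : u ≠ s) : collapse v s u = u := if_neg h

theorem map_collapse_of_notMem (v : V) {s : V} {e : Sym2 V} (hs : s ∉ e) :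
    e.map (collapse v s) = e := by
  rw [Sym2.map_congr (g := id), Sym2.map_id, id]
  intro u hu
  exact collapse_of_ne v fun h => hs (h ▸ hu)

theorem map_collapse_map_swap {v s : V} {e : Sym2 V} (hs : s ∉ e) :
    (e.map (Equiv.swap v s)).map (collapse v s) = e := by
  rw [Sym2.map_map, Sym2.map_congr (g := id), Sym2.map_id, id]
  intro u hu
  have hus : u ≠ s := fun h => hs (h ▸ hu)
  by_cases huv : u = v
  · rw [huv, Function.comp_apply, Equiv.swap_apply_left, collapse_self, id]
  · rw [Function.comp_apply, Equiv.swap_apply_of_ne_of_ne huv hus, collapse_of_ne v hus, id]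

theorem left_notMem_map_swap {v s : V} {e : Sym2 V} (hs : s ∉ e) : v ∉ e.map (Equiv.swap v s) := by
  rw [Sym2.mem_map]
  rintro ⟨u, hu, h⟩
  rw [Equiv.swap_apply_eq_iff, Equiv.swap_apply_left] at h
  exact hs (h ▸ hu)

theorem right_mem_map_swap {v s : V} {e : Sym2 V} (hv : v ∈ e) : s ∈ e.map (Equiv.swap v s) :=
  Sym2.mem_map.2 ⟨v, hv, Equiv.swap_apply_left v s⟩

theorem move_monomial_mem {v s : V} {l : List (Sym2 V)} (hs : ∀ e ∈ l, s ∉ e) (k : ℕ) :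
    move v s k (monomial l) ∈ Submodule.span ℝ {x | ∃ l' : List (Sym2 V),
      l'.map (Sym2.map (collapse v s)) = l ∧ valence s l' = k ∧ valence v l' + k = valence v l ∧
        x = monomial l'} := by
  induction l generalizing k with
  | nil =>
    rcases k with _ | k
    · rw [monomial_nil, move_zero_one]
      exact Submodule.subset_span ⟨[], rfl, rfl, rfl, rfl⟩
    · rw [monomial_nil, move_succ_one]
      exact zero_mem _
  | cons e l ih =>
    have ih := ih (fun e he => hs e (List.mem_cons_of_mem _ he))
    have hs := hs e List.mem_cons_self
    have h1 : edge e * move v s k (monomial l) ∈ Submodule.span ℝ {x | ∃ l' : List (Sym2 V),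
        l'.map (Sym2.map (collapse v s)) = e :: l ∧ valence s l' = k ∧
          valence v l' + k = valence v (e :: l) ∧ x = monomial l'} := by
      have ih := ih k
      generalize move v s k (monomial l) = z at ih
      induction ih using Submodule.span_induction with
      | zero => simp
      | add x y _ _ hx hy => rw [mul_add]; exact add_mem hx hy
      | smul c x _ hx => rw [mul_smul_comm]; exact Submodule.smul_mem _ c hx
      | mem x hx =>
        obtain ⟨l', hl', h1, h2, rfl⟩ := hx
        refine Submodule.subset_span ⟨e :: l', ?_, ?_, ?_, (monomial_cons _ _).symm⟩
        · rw [List.map_cons, hl', map_collapse_of_notMem v hs]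
        · rw [valence_cons_of_notMem hs, h1]
        · by_cases hv : v ∈ e
          · rw [valence_cons_of_mem hv, valence_cons_of_mem hv]
            omega
          · rw [valence_cons_of_notMem hv, valence_cons_of_notMem hv, h2]
    rw [monomial_cons]
    by_cases hv : v ∈ e
    · rcases k with _ | k
      · rwa [move_zero_edge_mul]
      · rw [move_succ_edge_mul_of_mem hv]
        refine add_mem h1 ?_
        have ih := ih k
        generalize move v s k (monomial l) = z at ih
        induction ih using Submodule.span_induction with
        | zero => simp
        | add x y _ _ hx hy => rw [mul_add]; exact add_mem hx hy
        | smul c x _ hx => rw [mul_smul_comm]; exact Submodule.smul_mem _ c hx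
        | mem x hx =>
          obtain ⟨l', hl', h1, h2, rfl⟩ := hx
          refine Submodule.subset_span
            ⟨e.map (Equiv.swap v s) :: l', ?_, ?_, ?_, (monomial_cons _ _).symm⟩
          · rw [List.map_cons, hl', map_collapse_map_swap hs]
          · rw [valence_cons_of_mem (right_mem_map_swap hv), h1]
          · rw [valence_cons_of_notMem (left_notMem_map_swap hs), valence_cons_of_mem hv]
            omega
    · rwa [move_edge_mul_of_notMem hv]

/-- Splitting the vertex `v` of a graph into two vertices `v` and `s` joined by an edge, if at least
two of the edges at `v` are moved to `s` and, in case `v` is internal, at least two are kept. -/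
theorem IsAdmissible.split {v s : V} {X A : Set V} (hsA : s ∉ A) (hvA : v ∈ A)
    (hA : ∀ u, u ≠ s → u ∈ A) {l l' : List (Sym2 V)} (hl : IsAdmissible X A l)
    (hl' : l'.map (Sym2.map (collapse v s)) = l) (hs2 : 2 ≤ valence s l')
    (hv2 : v ∉ X → 2 ≤ valence v l') : IsAdmissible X Set.univ (s(s, v) :: l') := by
  have hvs : v ≠ s := fun h => hsA (h ▸ hvA)
  have hnd : ∀ e ∈ l', ¬ (e.map (collapse v s)).IsDiag := fun e he =>
    hl.notDiag _ (hl' ▸ List.mem_map_of_mem he)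
  have hcol : ∀ u, collapse v s u ∈ A := by
    intro u
    by_cases h : u = s
    · rwa [h, collapse_self]
    · rw [collapse_of_ne v h]
      exact hA u h
  have hsv : Linked (s(s, v) :: l') s v := Relation.ReflTransGen.single List.mem_cons_self
  have hvs' : Linked (s(s, v) :: l') v s :=
    Relation.ReflTransGen.single (Sym2.eq_swap (a := s) ▸ List.mem_cons_self)
  refine ⟨?_, ?_, fun _ _ _ _ => Set.mem_univ _, ?_, ?_⟩
  · refine List.nodup_cons.2 ⟨fun h => hnd _ h ?_, List.Nodup.of_map _ (hl' ▸ hl.nodup)⟩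
    rw [Sym2.map_mk, collapse_self, collapse_of_ne v hvs, Sym2.mk_isDiag_iff]
  · intro e he
    rcases List.mem_cons.1 he with rfl | he
    · simpa using hvs.symm
    · exact not_isDiag_of_map (hnd e he)
  · intro u _ hu
    by_cases hus : u = s
    · rw [hus, valence_cons_of_mem (Sym2.mem_mk_left _ _)]
      omega
    by_cases huv : u = v
    · have := hv2 (huv ▸ hu)
      rw [huv, valence_cons_of_mem (Sym2.mem_mk_right _ _)]
      omega
    · have h := hl.trivalent u (hA u hus) hu
      have hf : ∀ w, collapse v s w = collapse v s u → w = u := by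
        intro w hw
        by_cases hws : w = s
        · rw [hws, collapse_self, collapse_of_ne v hus] at hw
          exact absurd hw.symm huv
        · rwa [collapse_of_ne v hws, collapse_of_ne v hus] at hw
      have hval := valence_map_of_fiber hf l'
      rw [collapse_of_ne v hus, hl'] at hval
      rw [valence_cons_of_notMem (by simp [hus, huv]), ← hval]
      exact h
  · intro u _
    refine Anchored.of_map hl' (fun e he => List.mem_cons_of_mem _ he) ?_ ?_
      (hl.anchored _ (hcol u))
    · intro w w' h hw'
      by_cases hw : w = s <;> by_cases hws : w' = s
      · exact (hws.trans hw.symm) ▸ hw'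
      · rw [hw, collapse_self, collapse_of_ne v hws] at h
        rw [hw]
        exact hsv.trans_anchored (h ▸ hw')
      · rw [hws, collapse_self, collapse_of_ne v hw] at h
        rw [h]
        exact hvs'.trans_anchored (hws ▸ hw')
      · rw [collapse_of_ne v hw, collapse_of_ne v hws] at h
        rwa [h]
    · intro w hw
      by_cases h : w = s
      · rw [h, collapse_self] at hw
        exact ⟨v, hw, h ▸ hsv⟩
      · rw [collapse_of_ne v h] at hw
        exact ⟨w, hw, Relation.ReflTransGen.refl⟩

theorem edge_mul_move_mem_admissible {v s : V} {X A : Set V} (hsA : s ∉ A) (hvA : v ∈ A)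
    (hA : ∀ u, u ≠ s → u ∈ A) {l : List (Sym2 V)} (hl : IsAdmissible X A l) {k : ℕ} (hk : 2 ≤ k)
    (hv : v ∉ X → k + 2 ≤ valence v l) :
    edge s(s, v) * move v s k (monomial l) ∈ admissible X Set.univ := by
  have h := move_monomial_mem (v := v) (fun e he h => hsA (hl.mem e he s h)) k
  generalize move v s k (monomial l) = z at h
  induction h using Submodule.span_induction with
  | zero => simp
  | add x y _ _ hx hy => rw [mul_add]; exact add_mem hx hy
  | smul c x _ hx => rw [mul_smul_comm]; exact Submodule.smul_mem _ c hx
  | mem x hx =>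
    obtain ⟨l', hl', h1, h2, rfl⟩ := hx
    rw [← monomial_cons]
    refine (hl.split hsA hvA hA hl' (h1 ▸ hk) fun hX => ?_).monomial_mem
    have := hv hX
    omega

/-- Splitting off a new internal vertex from an external vertex produces, apart from admissible
graphs, those in which at most one edge is moved to the new vertex. -/
theorem edge_mul_split_external {v s : V} {X A : Set V} (hsA : s ∉ A) (hvA : v ∈ A)
    (hA : ∀ u, u ≠ s → u ∈ A) (hv : v ∈ X) {x : Gra V} (hx : x ∈ admissible X A) :
    edge s(s, v) * (subst (TwGra.spl v s) x - (x + move v s 1 x)) ∈ admissible X Set.univ := by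
  induction hx using Submodule.span_induction with
  | zero => simp
  | add x y _ _ hx hy =>
    convert add_mem hx hy using 1
    rw [← mul_add, map_add, map_add]
    congr 1
    abel
  | smul c x _ hx =>
    convert Submodule.smul_mem _ c hx using 1
    rw [← mul_smul_comm, map_smul, map_smul, ← smul_add, ← smul_sub]
  | mem x hx =>
    obtain ⟨l, hl, rfl⟩ := hx
    have h := subst_spl_monomial (v := v) hl.notDiag (fun e he h => hsA (hl.mem e he s h))
    have h2 := Finset.sum_range_succ (fun k => move v s k (monomial l)) (valence v l + 1)
    rw [move_eq_zero_of_valence_lt v s l (Nat.lt_succ_self _), add_zero,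
      Finset.sum_range_succ', Finset.sum_range_succ', move_zero_monomial] at h2
    rw [h, ← h2, zero_add, add_assoc, add_comm (move v s 1 _), add_sub_cancel_right,
      Finset.mul_sum]
    exact Submodule.sum_mem _ fun k _ => edge_mul_move_mem_admissible hsA hvA hA hl (by omega)
      fun h => absurd hv h

/-- Splitting an internal vertex into two produces, apart from admissible graphs, those in which at
most one edge is moved or at most one edge is kept. As the vertex is at least trivalent, these
cases exclude each other. -/
theorem edge_mul_split_internal {v s : V} {X A : Set V} (hsA : s ∉ A) (hvA : v ∈ A)
    (hA : ∀ u, u ≠ s → u ∈ A) (hv : v ∉ X) {x : Gra V} (hx : x ∈ admissible X A) :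
    edge s(s, v) * (subst (TwGra.spl v s) x -
      (x + move v s 1 x + relabel (Equiv.swap v s) (x + move v s 1 x))) ∈
        admissible X Set.univ := by
  induction hx using Submodule.span_induction with
  | zero => simp
  | add x y _ _ hx hy =>
    convert add_mem hx hy using 1
    rw [← mul_add]
    congr 1
    simp only [map_add]
    abel
  | smul c x _ hx =>
    convert Submodule.smul_mem _ c hx using 1
    rw [← mul_smul_comm]
    congr 1
    simp only [map_add, map_smul, smul_add, smul_sub]
  | mem x hx =>
    obtain ⟨l, hl, rfl⟩ := hx
    have hs : ∀ e ∈ l, s ∉ e := fun e he h => hsA (hl.mem e he s h)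
    obtain ⟨m, hm⟩ := Nat.exists_eq_add_of_le (hl.trivalent v hvA hv)
    have h0 := move_eq_relabel_swap_move (v := v) hs (j := 3 + m) (k := 0) (by omega)
    have h1 := move_eq_relabel_swap_move (v := v) hs (j := m + 2) (k := 1) (by omega)
    rw [move_zero_monomial] at h0
    rw [subst_spl_monomial hl.notDiag hs, hm, Finset.sum_range_succ, h0, map_add, ← h1,
      add_comm 3 m, Finset.sum_range_succ, Finset.sum_range_succ', Finset.sum_range_succ',
      move_zero_monomial, zero_add]
    have h : ∀ a b c d e : Gra V, a + b + c + d + e - (c + b + (e + d)) = a := by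
      intros
      abel
    rw [h, Finset.mul_sum]
    refine Submodule.sum_mem _ fun k hk => edge_mul_move_mem_admissible hsA hvA hA hl (by omega) ?_
    have := Finset.mem_range.1 hk
    omega

/-- Placing a new bivalent vertex `s` on an edge, in the two ways given by the ends of the edge,
produces graphs that cancel. -/
theorem sum_edge_mul_move_one {s : V} {X : Set V} {A : Finset V} (hsA : s ∉ A) {x : Gra V}
    (hx : x ∈ admissible X (A : Set V)) : ∑ v ∈ A, edge s(s, v) * move v s 1 x = 0 := by
  induction hx using Submodule.span_induction with
  | zero => simp
  | add x y _ _ hx hy => simp [mul_add, Finset.sum_add_distrib, hx, hy]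
  | smul c x _ hx => simp [← Finset.smul_sum, hx]
  | mem x hx =>
    obtain ⟨l, hl, rfl⟩ := hx
    have hd := hl.notDiag
    have hm := hl.mem
    clear hl
    induction l with
    | nil => simp [monomial_nil, move_succ_one 0]
    | cons e l ih =>
      have ih := ih (fun e he => hd e (List.mem_cons_of_mem _ he))
        (fun e he => hm e (List.mem_cons_of_mem _ he))
      have hd := hd e List.mem_cons_self
      have hm := hm e List.mem_cons_self
      have key : ∀ v ∈ A, edge s(s, v) * move v s 1 (monomial (e :: l)) =
          - (edge e * (edge s(s, v) * move v s 1 (monomial l))) +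
            if v ∈ e then edge s(s, v) * edge (e.map (Equiv.swap v s)) * monomial l else 0 := by
        intro v _
        have hanti : edge s(s, v) * (edge e * move v s 1 (monomial l)) =
            - (edge e * (edge s(s, v) * move v s 1 (monomial l))) := by
          rw [← mul_assoc, edge_mul_edge, neg_mul, mul_assoc]
        rw [monomial_cons]
        split_ifs with hv
        · rw [move_succ_edge_mul_of_mem hv, mul_add, zero_add, hanti, move_zero_monomial, mul_assoc]
        · rw [move_edge_mul_of_notMem hv, hanti, add_zero]
      rw [Finset.sum_congr rfl key, Finset.sum_add_distrib, Finset.sum_neg_distrib,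
        ← Finset.mul_sum, ih, mul_zero, neg_zero, zero_add]
      induction e with | _ a b =>
      have hab : a ≠ b := by simpa using hd
      have ha : a ∈ A := hm a (by simp)
      have hb : b ∈ A := hm b (by simp)
      have has : a ≠ s := fun h => hsA (h ▸ ha)
      have hbs : b ≠ s := fun h => hsA (h ▸ hb)
      rw [← Finset.sum_filter]
      have hf : A.filter (fun v => v ∈ s(a, b)) = {a, b} := by
        ext u
        simp only [Finset.mem_filter, Sym2.mem_iff, Finset.mem_insert, Finset.mem_singleton]
        constructor
        · exact fun h => h.2
        · rintro (rfl | rfl)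
          · exact ⟨ha, Or.inl rfl⟩
          · exact ⟨hb, Or.inr rfl⟩
      rw [hf, Finset.sum_pair hab, Sym2.map_mk, Sym2.map_mk, Equiv.swap_apply_left,
        Equiv.swap_apply_left, Equiv.swap_apply_of_ne_of_ne hab.symm hbs,
        Equiv.swap_apply_of_ne_of_ne hab has, edge_swap a s, edge_mul_edge s(s, b), neg_mul,
        add_neg_cancel]

theorem relabel_move_monomial {f : V → V} (hf : Function.Injective f) (v s : V) (k : ℕ)
    (l : List (Sym2 V)) :
    relabel f (move v s k (monomial l)) = move (f v) (f s) k (relabel f (monomial l)) := by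
  induction l generalizing k with
  | nil =>
    rw [monomial_nil, map_one (relabel f)]
    rcases k with _ | k
    · rw [move_zero_one, move_zero_one, map_one (relabel f)]
    · rw [move_succ_one, move_succ_one, map_zero]
  | cons e l ih =>
    rw [monomial_cons, map_mul (relabel f), relabel_edge hf]
    by_cases hv : v ∈ e
    · rcases k with _ | k
      · rw [move_zero_edge_mul, move_zero_edge_mul, map_mul, relabel_edge hf, ih]
      · have hv' : f v ∈ e.map f := Sym2.mem_map.2 ⟨v, hv, rfl⟩
        have he : (e.map f).map (Equiv.swap (f v) (f s)) = (e.map (Equiv.swap v s)).map f := by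
          rw [Sym2.map_map, Sym2.map_map]
          refine Sym2.map_congr fun u _ => ?_
          exact hf.swap_apply v s u
        rw [move_succ_edge_mul_of_mem hv, move_succ_edge_mul_of_mem hv', map_add, map_mul, map_mul,
          relabel_edge hf, relabel_edge hf, ih, ih, he]
    · have hv' : f v ∉ e.map f := by
        rw [Sym2.mem_map]
        rintro ⟨u, hu, h⟩
        exact hv (hf h ▸ hu)
      rw [move_edge_mul_of_notMem hv, move_edge_mul_of_notMem hv', map_mul, relabel_edge hf, ih]

theorem relabel_move {f : V → V} (hf : Function.Injective f) (v s : V) (k : ℕ) {X A : Set V}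
    {x : Gra V} (hx : x ∈ admissible X A) :
    relabel f (move v s k x) = move (f v) (f s) k (relabel f x) := by
  induction hx using Submodule.span_induction with
  | zero => simp
  | add x y _ _ hx hy => simp [hx, hy]
  | smul c x _ hx => simp [hx]
  | mem x hx =>
    obtain ⟨l, _, rfl⟩ := hx
    exact relabel_move_monomial hf v s k l

end Splitting

end Gra

/-! ### The spaces of graphs -/

open Gra

theorem SimpleGraph.ncard_neighborSet_eq_valence {V : Type} {Γ : SimpleGraph V} {l : List (Sym2 V)}
    (hl : l.Nodup) (h : ∀ e, e ∈ l ↔ e ∈ Γ.edgeSet) (a : V) :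
    (Γ.neighborSet a).ncard = valence a l := by
  classical
  have h1 : (fun b => s(a, b)) '' Γ.neighborSet a =
      ((l.filter fun e => decide (a ∈ e)).toFinset : Set (Sym2 V)) := by
    ext e
    simp only [Set.mem_image, SimpleGraph.mem_neighborSet, List.coe_toFinset, List.mem_filter,
      decide_eq_true_eq, Set.mem_ofPred_eq, h]
    constructor
    · rintro ⟨b, hb, rfl⟩
      exact ⟨hb, Sym2.mem_mk_left _ _⟩
    · rintro ⟨he, ha⟩
      obtain ⟨b, rfl⟩ := Sym2.mem_iff_exists.1 ha
      exact ⟨b, he, rfl⟩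
  rw [← Set.ncard_image_of_injective (Γ.neighborSet a) (f := fun b => s(a, b))
    fun b c hbc => Sym2.congr_right.1 hbc, h1, Set.ncard_coe_finset,
    List.toFinset_card_of_nodup (hl.filter _), valence, List.countP_eq_length_filter]

theorem isAdmissible_iff_isGraphsGraph {E : Type} {k : ℕ} {Γ : SimpleGraph (E ⊕ Fin k)}
    {l : List (Sym2 (E ⊕ Fin k))} (hl : l.Nodup) (h : ∀ e, e ∈ l ↔ e ∈ Γ.edgeSet) :
    IsAdmissible (Set.range Sum.inl) Set.univ l ↔ IsGraphsGraph Γ := by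
  have hlink : ∀ a b, Linked l a b ↔ Γ.Reachable a b := by
    intro a b
    rw [SimpleGraph.reachable_iff_reflTransGen, Linked]
    have : (fun a b => s(a, b) ∈ l) = Γ.Adj := by
      ext a b
      rw [h, SimpleGraph.mem_edgeSet]
    rw [this]
  constructor
  · intro hl'
    refine ⟨fun j => ?_, fun c => ?_⟩
    · rw [SimpleGraph.ncard_neighborSet_eq_valence hl h]
      exact hl'.trivalent _ (Set.mem_univ _) (by simp)
    · induction c using SimpleGraph.ConnectedComponent.ind with | _ v =>
      obtain ⟨_, ⟨a, rfl⟩, ha⟩ := hl'.anchored v (Set.mem_univ _)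
      refine ⟨a, ?_⟩
      rw [SimpleGraph.ConnectedComponent.mem_supp_iff, SimpleGraph.ConnectedComponent.eq]
      exact ((hlink _ _).1 ha).symm
  · intro hΓ
    refine ⟨hl, fun e he => Γ.not_isDiag_of_mem_edgeSet ((h e).1 he), fun _ _ _ _ => Set.mem_univ _,
      ?_, ?_⟩
    · rintro (a | j) _ ha
      · exact absurd ⟨a, rfl⟩ ha
      · rw [← SimpleGraph.ncard_neighborSet_eq_valence hl h]
        exact hΓ.trivalent j
    · intro v _
      obtain ⟨a, ha⟩ := hΓ.external (Γ.connectedComponentMk v)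
      rw [SimpleGraph.ConnectedComponent.mem_supp_iff, SimpleGraph.ConnectedComponent.eq] at ha
      exact ⟨_, ⟨a, rfl⟩, (hlink _ _).2 ha.symm⟩

theorem graphsSpan_eq_admissible (E : Type) (k : ℕ) :
    graphsSpan E k = admissible (Set.range Sum.inl) Set.univ := by
  refine congrArg (Submodule.span ℝ) (Set.ext fun x => ?_)
  constructor
  · rintro ⟨Γ, l, hΓ, hl, h, rfl⟩
    exact ⟨l, (isAdmissible_iff_isGraphsGraph hl h).2 hΓ, rfl⟩
  · rintro ⟨l, hl, rfl⟩
    have h : ∀ e, e ∈ l ↔ e ∈ (SimpleGraph.fromEdgeSet {e | e ∈ l}).edgeSet := by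
      intro e
      rw [SimpleGraph.edgeSet_fromEdgeSet]
      exact ⟨fun he => ⟨he, hl.notDiag e he⟩, fun he => he.1⟩
    exact ⟨_, l, (isAdmissible_iff_isGraphsGraph hl.nodup h).1 hl, hl.nodup, h, rfl⟩

/-! ### Closure under the operations -/

namespace TwGra

variable {E F : Type} {N : ℕ}

/-- All components of the family are combinations of graphs satisfying the two conditions. -/
def IsGraphs (x : TwSpace E) : Prop := ∀ k, x k ∈ admissible (Set.range Sum.inl) Set.univ

theorem mem_graphs_iff [Finite E] {p : ℤ} {x : fGraphs.obj E p} :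
    x ∈ graphs E p ↔ IsGraphs x.1 := by
  simp only [graphs, Submodule.mem_iInf, graphsSpan_eq_admissible]
  rfl

theorem IsGraphs.restr_mem [Finite E] {x : TwSpace E} (hx : IsGraphs x) {N : ℕ}
    (S : Finset (Fin N)) :
    restr x S ∈ admissible (Set.range Sum.inl) (verts E S : Set (E ⊕ Fin N)) := by
  refine relabel_mem_admissible (map_id_injective (S.orderEmbOfFin rfl).toEmbedding) ?_ ?_
    (hx S.card)
  · rintro (a | a) <;> simp
  · ext (a | j)
    · simp
    · have h : (∃ b, S.orderEmbOfFin rfl b = j) ↔ j ∈ S :=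
        Set.ext_iff.1 (Finset.range_orderEmbOfFin S rfl) j
      simpa using h

theorem isGraphs_unit : IsGraphs unit := by
  intro k
  by_cases h : k = 0
  · subst h
    rw [unit, if_pos rfl, ← monomial_nil]
    refine IsAdmissible.monomial_mem ⟨List.nodup_nil, by simp, by simp, ?_, ?_⟩
    · rintro (a | j) _ ha
      · exact absurd ⟨a, rfl⟩ ha
      · exact j.elim0
    · rintro (a | j) _
      · exact ⟨_, ⟨a, rfl⟩, Relation.ReflTransGen.refl⟩
      · exact j.elim0
  · rw [unit, if_neg h]
    exact zero_mem _

theorem IsGraphs.map (e : E ≃ F) {x : TwSpace E} (hx : IsGraphs x) : IsGraphs (map e x) := by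
  intro k
  refine relabel_mem_admissible (equiv_injective e) ?_ ?_ (hx k)
  · rintro (a | a) <;> simp
  · rw [Set.image_univ, Set.range_eq_univ]
    exact Sum.map_surjective.2 ⟨e.surjective, Function.surjective_id⟩

open Classical in
/-- The map from the vertices of `x ∘ᵢ y`, where `x` has internal vertices `S`, to those of `x` which
sends the vertices of `y` to `i`. -/
def contract (i : E) {N : ℕ} (S : Finset (Fin N)) : ({a : E // a ≠ i} ⊕ F) ⊕ Fin N → E ⊕ Fin N
  | Sum.inl (Sum.inl a) => Sum.inl a
  | Sum.inl (Sum.inr _) => Sum.inl i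
  | Sum.inr j => if j ∈ S then Sum.inr j else Sum.inl i

theorem IsGraphs.comp [Finite E] [Finite F] (i : E) {x : TwSpace E} {y : TwSpace F}
    (hx : IsGraphs x) (hy : IsGraphs y) : IsGraphs (comp i x y) := by
  classical
  intro N
  refine Submodule.sum_mem _ fun S _ => ?_
  rw [term_eq, term]
  refine subst_mul_mem_admissible (π := contract i S) (i := Sum.inl i)
    (Y := Set.range Sum.inl) ?_ ?_ ?_ (fun _ _ => Iff.rfl) ?_ (hx.restr_mem S)
    (relabel_mem_admissible sumInr_injective ?_ ?_ (hy.restr_mem Sᶜ))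
  · rintro ((a | b) | j)
    · simp [contract]
    · simp [contract]
    · by_cases hj : j ∈ S <;> simp [contract, hj]
  · rintro ((a | b) | j) ((a' | b') | j') h h'
    all_goals simp only [contract] at h h'
    all_goals (try split_ifs at h h') <;> simp_all [Subtype.ext_iff]
  · rintro ((a | b) | j) h
    · simp [contract]
    · simp [contract] at h
    · by_cases hj : j ∈ S
      · simp [contract, hj]
      · simp [contract, hj] at h
  · rintro (a | j) ha w hw
    · by_cases h : a = i
      · subst h
        rw [ker_self] at hw
        obtain ⟨(b | j), hb, rfl⟩ := Finset.mem_map.1 hw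
        · rfl
        · have hj : j ∉ S := by simpa using hb
          simp [contract, hj]
      · rw [ker_ne h, Finset.mem_singleton] at hw
        subst hw
        rfl
    · rw [ker_inr, Finset.mem_singleton] at hw
      have hj : j ∈ S := by simpa using ha
      simp [hw, contract, hj]
  · rintro (a | j) <;> simp
  · ext ((a | b) | j)
    · simpa [contract] using a.2
    · simp [contract]
    · by_cases hj : j ∈ S <;> simp [contract, hj]

theorem relabel_swap_restr [DecidableEq (E ⊕ Fin N)] {x : TwSpace E} (hx : Inv x) (s j : Fin N) :
    relabel (Equiv.swap (Sum.inr j) (Sum.inr s)) (restr x {s}ᶜ) = restr x {j}ᶜ := by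
  have hm : ({j}ᶜ : Finset (Fin N)) = ({s}ᶜ : Finset (Fin N)).map (Equiv.swap j s).toEmbedding := by
    ext u
    rw [Finset.mem_map_equiv, Finset.mem_compl, Finset.mem_compl, Finset.mem_singleton,
      Finset.mem_singleton, Equiv.symm_swap, Equiv.swap_apply_eq_iff, Equiv.swap_apply_right]
  rw [hm, ← hx.map_at]
  congr 2
  funext u
  rcases u with a | u
  · simp [Equiv.swap_apply_of_ne_of_ne]
  · exact (Sum.inr_injective.swap_apply j s u)

theorem IsGraphs.diff [Finite E] {p : ℤ} {x : TwSpace E} (hxp : x ∈ deg E p) (hx : IsGraphs x) :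
    IsGraphs (diff p x) := by
  classical
  intro N
  rw [diff_eq hxp]
  -- `H s v` subdivides the edges at `v` by the new vertex `s`.
  let H : Fin N → E ⊕ Fin N → Gra (E ⊕ Fin N) := fun s v =>
    edge s(Sum.inr s, v) * move v (Sum.inr s) 1 (restr x {s}ᶜ)
  -- `K s j` collects the graphs in which `s` has at most one edge besides the edge to `j`.
  let K : Fin N → Fin N → Gra (E ⊕ Fin N) := fun s j =>
    edge s(Sum.inr s, Sum.inr j) *
      (restr x {s}ᶜ + move (Sum.inr j) (Sum.inr s) 1 (restr x {s}ᶜ))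
  -- `C s (Sum.inr j)` is antisymmetric in `s` and `j`.
  let C : Fin N → E ⊕ Fin N → Gra (E ⊕ Fin N) := fun s =>
    Sum.elim (fun _ => 0) fun j => (1 / 2 : ℝ) • (K s j - K j s)
  have hs : ∀ s : Fin N, Sum.inr s ∉ verts E ({s}ᶜ : Finset (Fin N)) := by simp
  have hA : ∀ s : Fin N, ∀ u, u ≠ Sum.inr s → u ∈ (verts E {s}ᶜ : Set (E ⊕ Fin N)) := by
    rintro s (a | j) h
    · simp
    · simpa using h
  have key : ∀ s, ∀ v ∈ verts E {s}ᶜ, dterm x {s}ᶜ s v + H s v - C s v ∈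
      admissible (Set.range Sum.inl) (Set.univ : Set (E ⊕ Fin N)) := by
    rintro s (a | j) hv
    · have h := edge_mul_split_external (hs s) hv (hA s) (Set.mem_range_self a) (hx.restr_mem {s}ᶜ)
      convert neg_mem h using 1
      simp only [dterm, H, C, wt, Sum.elim_inl, one_smul, mul_sub, mul_add]
      abel
    · have h := edge_mul_split_internal (hs s) hv (hA s) (by simp) (hx.restr_mem {s}ᶜ)
      rw [map_add (relabel _), relabel_move (Equiv.injective _) _ _ _ (hx.restr_mem {s}ᶜ),
        relabel_swap_restr (deg.inv hxp), Equiv.swap_apply_left, Equiv.swap_apply_right] at h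
      convert Submodule.smul_mem _ (-(1 / 2) : ℝ) h using 1
      simp only [dterm, H, C, K, wt, Sum.elim_inr, mul_sub, mul_add, edge_swap (Sum.inr j),
        mul_smul_comm]
      module
  have hH : ∀ s, ∑ v ∈ verts E {s}ᶜ, H s v = 0 := fun s =>
    sum_edge_mul_move_one (hs s) (hx.restr_mem {s}ᶜ)
  have hC : ∑ s, ∑ v ∈ verts E {s}ᶜ, C s v = 0 := by
    have hK : ∑ s, ∑ j ∈ {s}ᶜ, K s j = ∑ s, ∑ j ∈ {s}ᶜ, K j s :=
      Finset.sum_comm' fun s j => by simp [eq_comm]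
    simp only [verts, Finset.sum_disjSum, C, Sum.elim_inl, Sum.elim_inr, Finset.sum_const_zero,
      zero_add, ← Finset.smul_sum, Finset.sum_sub_distrib]
    rw [hK, sub_self, smul_zero]
  have h := Submodule.sum_mem _ fun s (_ : s ∈ Finset.univ) => Submodule.sum_mem _ (key s)
  simpa only [Finset.sum_sub_distrib, Finset.sum_add_distrib, hH, hC, Finset.sum_const_zero,
    add_zero, sub_zero] using h

end TwGra

end

theorem mainTheorem7 : fGraphs.IsSuboperad graphs where
  unit_mem := TwGra.mem_graphs_iff.2 TwGra.isGraphs_unit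
  map_mem e _ _ := fun hx => TwGra.mem_graphs_iff.2 ((TwGra.mem_graphs_iff.1 hx).map e)
  comp_mem _ i _ _ := fun hx hy =>
    TwGra.mem_graphs_iff.2 ((TwGra.mem_graphs_iff.1 hx).comp i (TwGra.mem_graphs_iff.1 hy))
  d_mem _ x := fun hx => TwGra.mem_graphs_iff.2 ((TwGra.mem_graphs_iff.1 hx).diff x.2)
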